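/- **Theorem (Magnetic graphene and hBN).** *Setting.* Consider the hexagonal lattice with edges of length one, generated by $E_1=(\tfrac32,\tfrac{\sqrt3}2)$, $E_2=(0,\sqrt3)$; each cell $\gamma\in\mathbb Z^2$ contains a vertex $N_\gamma$ and a vertex $B_\gamma$, and the edges $f_\gamma,g_\gamma,h_\gamma$, identified with $[0,1]$, run from $N_\gamma$ to $B_\gamma$, $B_{\gamma-(1,0)}$, $B_{\gamma-(0,1)}$. Let $i(e),t(e)$ be the initial and terminal vertex of $e$. Let $U\in L^2[0,1]$ be real with $U(x)=U(1-x)$, let $a_e\in C^1[0,1]$ be a real magnetic potential on each edge, $\beta_e=\int_0^1a_e(s)\,ds$, and let $\delta_N,\delta_B\in\mathbb R$, $\alpha(N_\gamma)=\delta_N$, $\alpha(B_\gamma)=\delta_B$. Let $H$ be the operator $(f_e)\mapsto(-f_e''+Uf_e)$ in $\bigoplus_eL^2[0,1]$ on the $(f_e)\in\bigoplus_e H^2[0,1]$ such that at each vertex $v$ the numbers $f_e(0)$ ($i(e)=v$) and $e^{i\beta_e}f_e(1)$ ($t(e)=v$) have a common value $f(v)$ and $$\sum_{i(e)=v}f_e'(0)-\sum_{t(e)=v}e^{i\beta_e}f_e'(1)=\alpha(v)f(v).$$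 Suppose that the flux $\beta_{f,(m,n)}-\beta_{h,(m,n+1)}+\beta_{g,(m,n+1)}-\beta_{f,(m-1,n+1)}+\beta_{h,(m-1,n+1)}-\beta_{g,(m,n)}$ has the same value $\phi$ for all $m,n\in\mathbb Z$. Let $\sigma_D$ be the spectrum of $-d^2/dx^2+U$ on $[0,1]$ with Dirichlet conditions. For real $\lambda\notin\sigma_D$ let $\varphi_1$ solve $-\varphi_1''+U\varphi_1=\lambda\varphi_1$, $\varphi_1(0)=0$, $\varphi_1(1)=1$, and put $\eta(\lambda)=\varphi_1'(1)/\varphi_1'(0)$, $\alpha_N=\delta_N/\varphi_1'(0)$, $\alpha_B=\delta_B/\varphi_1'(0)$. For $\phi=2\pi/q$ ($q=1,2$) the *dispersion relation* of $H$ is the set of all $(\theta,\lambda)\in\mathbb R^2\times\mathbb R$ for which $-u''+Uu=\lambda u$ has a nonzero solution on the edges that satisfies the vertex conditions and, after the change of gauge to $\beta_f=\beta_g=0$, $\beta_{h,\gamma}=-\gamma_1\phi$, the Floquet conditions $u(x+qE_1)=e^{i\theta_1}u(x)$, $u(x+E_2)=e^{i\theta_2}u(x)$. Let $|\theta|_q$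 be the Euclidean length of the $k\in\mathbb R^2$ with $k\cdot qE_1=\theta_1$, $k\cdot E_2=\theta_2$. A point $(\theta_D,\lambda_D)$ is a *Dirac cone* if near it the dispersion relation consists of two bands $\lambda_\pm(\theta)$, with $\lambda_\pm(\theta_D)=\lambda_D$ and $\lambda_\pm(\theta)-\lambda_D=\pm c\,|\theta-\theta_D|_q+\mathcal O(|\theta-\theta_D|_q^2)$ for some $c>0$. We say that $H$ has a *gap* at $\lambda_0$ and $\theta_D$ if there are $\lambda_1<\lambda_0<\lambda_2$ such that $(\lambda_1,\lambda_2)$ contains no point of $\sigma(H)$ and no value $\lambda$ of the dispersion relation, while $\lambda_1,\lambda_2\in\sigma(H)$ and $(\theta_D,\lambda_1),(\theta_D,\lambda_2)$ lie in the dispersion relation. *Claim.* Let $\Lambda$ be the set of all real $\lambda\notin\sigma_D$ with $\eta(\lambda)=-\frac{\alpha_N+\alpha_B}6$. Then $\Lambda$ is infinite, and: 1. Suppose $\phi=\pi$ (so $q=2$). For all $\theta\in\mathbb R^2$ (in particular for $\theta\in[0,\frac\pi2)\times[-\frac\pi2,\frac\pi2)$) and all real $\lambda\notin\sigma_D$,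 $(\theta,\lambda)$ belongs to the dispersion relation if and only if $\eta(\lambda)$ is one of the four numbers (all choices of the two signs) $$\eta^{\pm}_{\mp}(\theta)=-\frac{\alpha_N+\alpha_B}{6}\pm\frac16\sqrt{(\alpha_N-\alpha_B)^2+12\mp4\sqrt2\sqrt{3+\cos\theta_1+\cos2\theta_2-\cos(\theta_1-2\theta_2)}}.$$ (a) If $\alpha(v)$ is constant ($\delta_N=\delta_B$, magnetic graphene), then $H$ has Dirac cones: with $\theta_D=(\frac\pi3,-\frac\pi6)$, $(\theta_D,\lambda_D)$ is a Dirac cone for every $\lambda_D\in\Lambda$. (b) If $\alpha(v)$ is not constant ($\delta_N\ne\delta_B$, magnetic hBN), then $H$ has gaps: it has a gap at $\lambda_0$ and $\theta_D=(\frac\pi3,-\frac\pi6)$ for every $\lambda_0\in\Lambda$. 2. Suppose $\phi=2\pi$ (so $q=1$), and let $\theta_D=(\frac{2\pi}3,-\frac{2\pi}3)$. If $\delta_N=\delta_B$, then $(\theta_D,\lambda_D)$ is a Dirac cone for every $\lambda_D\in\Lambda$. If $\delta_N\neq\delta_B$, then $H$ has a gap at $\lambda_0$ and $\theta_D$ for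 every $\lambda_0\in\Lambda$. -/

import Mathlib

open MeasureTheory Set Filter Topology Asymptotics
open scoped Real InnerProductSpace

noncomputable section

namespace MagneticHex

/-! ### The hexagonal lattice -/

/-- The two kinds of vertices in a fundamental cell. -/
inductive Atom
  | N
  | B

/-- A vertex: its kind, and the cell `γ ∈ ℤ²` it belongs to. -/
abbrev Vertex := Atom × (ℤ × ℤ)

/-- An edge: its kind (`0`, `1`, `2` for `f`, `g`, `h`), and the cell `γ ∈ ℤ²` it starts in. -/
abbrev Edge := Fin 3 × (ℤ × ℤ)

/-- The edges `f_γ`, `g_γ`, `h_γ` run from `(N, γ)` to `(B, γ)`, `(B, γ - (1,0))`,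
`(B, γ - (0,1))` respectively. -/
def shift : Fin 3 → ℤ × ℤ := ![(0, 0), (1, 0), (0, 1)]

/-- Initial vertex of an edge. -/
def init (e : Edge) : Vertex := (Atom.N, e.2)

/-- Terminal vertex of an edge. -/
def term (e : Edge) : Vertex := (Atom.B, e.2 - shift e.1)

/-- The edges leaving the vertex `(N, γ)` are the three edges `(j, γ)`. -/
theorem init_eq_iff (e : Edge) (γ : ℤ × ℤ) :
    init e = (Atom.N, γ) ↔ ∃ j, e = (j, γ) := by
  obtain ⟨i, ε⟩ := e
  simp [init]

/-- The edges arriving at the vertex `(B, γ)` are the three edges `(j, γ + shift j)`. -/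
theorem term_eq_iff (e : Edge) (γ : ℤ × ℤ) :
    term e = (Atom.B, γ) ↔ ∃ j, e = (j, γ + shift j) := by
  obtain ⟨i, ε⟩ := e
  simp [term, sub_eq_iff_eq_add]

/-- The vector `E₁` of the hexagonal lattice with edges of length one. -/
def latticeE₁ : EuclideanSpace ℝ (Fin 2) := !₂[3 / 2, √3 / 2]

/-- The vector `E₂` of the hexagonal lattice with edges of length one. -/
def latticeE₂ : EuclideanSpace ℝ (Fin 2) := !₂[0, √3]

/-! ### Functions on an edge -/

/-- Lebesgue measure on `[0,1]`. -/
abbrev μ01 : Measure ℝ := volume.restrict (Icc (0 : ℝ) 1)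

/-- `u` belongs to the Sobolev space `H²[0,1]`, with first derivative `v` (its continuous
representative) and second derivative `w ∈ L²[0,1]`. -/
def IsH2 {F : Type*} [NormedAddCommGroup F] [NormedSpace ℝ F] (u v w : ℝ → F) : Prop :=
  MemLp w 2 μ01 ∧
  (∀ x ∈ Icc (0 : ℝ) 1, u x = u 0 + ∫ t in (0 : ℝ)..x, v t) ∧
  (∀ x ∈ Icc (0 : ℝ) 1, v x = v 0 + ∫ t in (0 : ℝ)..x, w t)

/-- `u ∈ H²[0,1]`, with derivative `v`, solves `-u'' + U u = E u` on `[0,1]`. -/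
def IsEdgeSolution {F : Type*} [NormedAddCommGroup F] [NormedSpace ℝ F]
    (U : ℝ → ℝ) (E : ℝ) (u v : ℝ → F) : Prop :=
  ∃ w : ℝ → F, IsH2 u v w ∧ ∀ᵐ x ∂μ01, -w x + U x • u x = E • u x

/-- The spectrum of `-d²/dx² + U` on `[0,1]` with Dirichlet conditions, which consists of
eigenvalues. -/
def dirichletSpectrum (U : ℝ → ℝ) : Set ℝ :=
  {E | ∃ u v : ℝ → ℝ, IsEdgeSolution U E u v ∧ u 0 = 0 ∧ u 1 = 0 ∧ ∃ x ∈ Icc (0 : ℝ) 1, u x ≠ 0}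

/-- The solution `φ₁` of `-φ'' + U φ = E φ` with `φ₁(0) = 0`, `φ₁(1) = 1`, together with its
derivative; it exists and is unique on `[0,1]` for `E` outside the Dirichlet spectrum, and is
only used there. -/
def phi₁ (U : ℝ → ℝ) (E : ℝ) : (ℝ → ℝ) × (ℝ → ℝ) :=
  Classical.epsilon fun p => IsEdgeSolution U E p.1 p.2 ∧ p.1 0 = 0 ∧ p.1 1 = 1

/-- `η(E) = φ₁'(1) / φ₁'(0)`. -/
def eta (U : ℝ → ℝ) (E : ℝ) : ℝ := (phi₁ U E).2 1 / (phi₁ U E).2 0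

/-- The normalized Robin parameter `α = δ / φ₁'(0)` at energy `E`. -/
def alpha (U : ℝ → ℝ) (E δ : ℝ) : ℝ := δ / (phi₁ U E).2 0

/-! ### Magnetic data and vertex conditions -/

/-- `β_e = ∫₀¹ a_e`. -/
def beta (a : Edge → ℝ → ℝ) (e : Edge) : ℝ := ∫ t in (0 : ℝ)..1, a e t

/-- The magnetic flux through every hexagon equals `φ`. -/
def HasConstantFlux (β : Edge → ℝ) (φ : ℝ) : Prop :=
  ∀ m n : ℤ,
    β (0, (m, n)) - β (2, (m, n + 1)) + β (1, (m, n + 1)) - β (0, (m - 1, n + 1))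
      + β (2, (m - 1, n + 1)) - β (1, (m, n)) = φ

/-- The Robin coupling `α(v)`: `δN` at the initial vertices of the edges, `δB` at the terminal
vertices. -/
def robin (δN δB : ℝ) : Vertex → ℝ
  | (Atom.N, _) => δN
  | (Atom.B, _) => δB

/-- The phase `e^{ix}`. -/
def phase (x : ℝ) : ℂ := Complex.exp (Complex.I * x)

/-- The vertex conditions for functions `u = (u_e)` with derivatives `v = (v_e)`: there are vertex
values `V` with `u_e(0) = V(i(e))` and `e^{iβ_e} u_e(1) = V(t(e))`, and at each vertex `x`
`∑_{i(e)=x} u_e'(0) - ∑_{t(e)=x} e^{iβ_e} u_e'(1) = α(x) V(x)`. -/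
def VertexConditions (β : Edge → ℝ) (δN δB : ℝ) (u v : Edge → ℝ → ℂ) : Prop :=
  ∃ V : Vertex → ℂ,
    (∀ e, u e 0 = V (init e)) ∧
    (∀ e, phase (β e) * u e 1 = V (term e)) ∧
    (∀ γ : ℤ × ℤ, ∑ j : Fin 3, v (j, γ) 0
      = (robin δN δB (Atom.N, γ) : ℂ) * V (Atom.N, γ)) ∧
    (∀ γ : ℤ × ℤ, -∑ j : Fin 3, phase (β (j, γ + shift j)) * v (j, γ + shift j) 1
      = (robin δN δB (Atom.B, γ) : ℂ) * V (Atom.B, γ))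

/-! ### The operator and its spectrum -/

/-- The Hilbert space `⨁_e L²[0,1]`. -/
abbrev GraphL2 := lp (fun _ : Edge => Lp ℂ 2 μ01) 2

/-- The graph of the magnetic Schrödinger operator `H` in `⨁_e L²[0,1]`: `f ∈ dom H` and
`H f = g`. The domain consists of the `f ∈ ⨁_e H²[0,1]` that satisfy the vertex conditions, and
`H f = (-f_e'' + U f_e)_e`. -/
def SchrodingerGraph (U : ℝ → ℝ) (β : Edge → ℝ) (δN δB : ℝ) (f g : GraphL2) : Prop :=
  ∃ u v w : Edge → ℝ → ℂ,
    (∀ e, IsH2 (u e) (v e) (w e)) ∧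
    Summable (fun e => ∫ x, (‖u e x‖ ^ 2 + ‖v e x‖ ^ 2 + ‖w e x‖ ^ 2) ∂μ01) ∧
    VertexConditions β δN δB u v ∧
    (∀ e, (f e : ℝ → ℂ) =ᵐ[μ01] u e) ∧
    (∀ e, (g e : ℝ → ℂ) =ᵐ[μ01] fun x => -w e x + U x • u e x)

/-- The spectrum of `H`: the complement of the set of `z` for which `H - z` is a bijection of
`dom H` onto the Hilbert space with bounded inverse `R`. -/
def schrodingerSpectrum (U : ℝ → ℝ) (β : Edge → ℝ) (δN δB : ℝ) : Set ℂ :=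
  {z | ¬ ∃ R : GraphL2 →L[ℂ] GraphL2,
    ∀ f k : GraphL2, SchrodingerGraph U β δN δB f (k + z • f) ↔ R k = f}

/-! ### Floquet theory -/

/-- The Landau gauge of flux `φ`: `β_f = β_g = 0`, `β_h = -γ₁ φ`. -/
def landau (φ : ℝ) (e : Edge) : ℝ := if e.1 = 2 then -(e.2.1 : ℝ) * φ else 0

/-- Translation of an edge by `p₁ E₁ + p₂ E₂`. -/
def translate (p : ℤ × ℤ) (e : Edge) : Edge := (e.1, e.2 + p)

/-- The dispersion relation of `H` for the period lattice `q E₁ ℤ + E₂ ℤ`: the pairs `(θ, E)` for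
which there is a nonzero solution of `-u'' + U u = E u` on all edges that satisfies the vertex
conditions and which, in the Landau gauge, obeys the Floquet conditions
`u(x + q E₁) = e^{iθ₁} u(x)` and `u(x + E₂) = e^{iθ₂} u(x)`. The function `χ` is the change of
gauge (unique up to an additive constant) from `β` to the Landau gauge of the same flux `φ`. -/
def dispersion (U : ℝ → ℝ) (β : Edge → ℝ) (δN δB φ : ℝ) (q : ℕ) : Set ((ℝ × ℝ) × ℝ) :=
  {p | ∃ χ : Vertex → ℝ, (∀ e, β e = landau φ e + χ (term e) - χ (init e)) ∧
    ∃ u v : Edge → ℝ → ℂ,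
      (∃ e, ∃ x ∈ Icc (0 : ℝ) 1, u e x ≠ 0) ∧
      (∀ e, IsEdgeSolution U p.2 (u e) (v e)) ∧
      VertexConditions β δN δB u v ∧
      (∀ e, ∀ x ∈ Icc (0 : ℝ) 1,
        phase (-χ (init (translate (q, 0) e))) * u (translate (q, 0) e) x
          = phase p.1.1 * (phase (-χ (init e)) * u e x)) ∧
      (∀ e, ∀ x ∈ Icc (0 : ℝ) 1,
        phase (-χ (init (translate (0, 1) e))) * u (translate (0, 1) e) x
          = phase p.1.2 * (phase (-χ (init e)) * u e x))}

/-- The vector `k ∈ ℝ²` with `k · (q E₁) = θ₁` and `k · E₂ = θ₂`. -/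
def quasimomentum (q : ℕ) (θ : ℝ × ℝ) : EuclideanSpace ℝ (Fin 2) :=
  !₂[2 / 3 * (θ.1 / q - θ.2 / 2), θ.2 / √3]

theorem inner_quasimomentum_E₁ (q : ℕ) (hq : q ≠ 0) (θ : ℝ × ℝ) :
    ⟪quasimomentum q θ, (q : ℝ) • latticeE₁⟫_ℝ = θ.1 := by
  have h3 : (√3 : ℝ) ≠ 0 := by positivity
  have hq' : (q : ℝ) ≠ 0 := by exact_mod_cast hq
  simp [quasimomentum, latticeE₁, PiLp.inner_apply, Fin.sum_univ_two]
  field_simp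
  ring

theorem inner_quasimomentum_E₂ (q : ℕ) (θ : ℝ × ℝ) :
    ⟪quasimomentum q θ, latticeE₂⟫_ℝ = θ.2 := by
  have h3 : (√3 : ℝ) ≠ 0 := by positivity
  simp [quasimomentum, latticeE₂, PiLp.inner_apply, Fin.sum_univ_two]
  field_simp

/-- `(E₀, θ₀)` is a Dirac cone of the dispersion relation `D` (for the periods `q E₁`, `E₂`): near
it, `D` consists of two bands `E₊`, `E₋` that touch there conically,
`E±(θ) - E₀ = ± c |k - k₀| + O(|k - k₀|²)` with `c > 0`, where `|k - k₀|` is the length of the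
difference of the quasimomenta belonging to `θ` and `θ₀`. -/
def IsDiracCone (D : Set ((ℝ × ℝ) × ℝ)) (q : ℕ) (θ₀ : ℝ × ℝ) (E₀ : ℝ) : Prop :=
  ∃ c > 0, ∃ ε > 0, ∃ Ep Em : ℝ × ℝ → ℝ,
    (∀ᶠ θ in 𝓝 θ₀, ∀ E, |E - E₀| < ε → ((θ, E) ∈ D ↔ E = Ep θ ∨ E = Em θ)) ∧
    Ep θ₀ = E₀ ∧ Em θ₀ = E₀ ∧
    (fun θ => Ep θ - E₀ - c * ‖quasimomentum q (θ - θ₀)‖)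
      =O[𝓝 θ₀] (fun θ => ‖quasimomentum q (θ - θ₀)‖ ^ 2) ∧
    (fun θ => Em θ - E₀ + c * ‖quasimomentum q (θ - θ₀)‖)
      =O[𝓝 θ₀] (fun θ => ‖quasimomentum q (θ - θ₀)‖ ^ 2)

/-- There is a gap of the operator around the energy `E₀`, between two bands of its dispersion
relation `D`: an open interval `(E₁, E₂)` containing `E₀` that is disjoint from the spectrum `S`
and from all values of `D`, while its end points are in the spectrum and are values of `D` at the
quasimomentum `θ₀`. -/
def HasGapAt (S : Set ℂ) (D : Set ((ℝ × ℝ) × ℝ)) (θ₀ : ℝ × ℝ) (E₀ : ℝ) : Prop :=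
  ∃ E₁ E₂ : ℝ, E₁ < E₀ ∧ E₀ < E₂ ∧
    (∀ E ∈ Ioo E₁ E₂, (E : ℂ) ∉ S ∧ ∀ θ : ℝ × ℝ, (θ, E) ∉ D) ∧
    (E₁ : ℂ) ∈ S ∧ (E₂ : ℂ) ∈ S ∧ (θ₀, E₁) ∈ D ∧ (θ₀, E₂) ∈ D

/-- The energies `E` outside the Dirichlet spectrum with `η(E) = -(α_N + α_B) / 6`. -/
def centralEnergies (U : ℝ → ℝ) (δN δB : ℝ) : Set ℝ :=
  {E | E ∉ dirichletSpectrum U ∧ eta U E = -(alpha U E δN + alpha U E δB) / 6}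

/-- `-(α_N + α_B)/6 + (s/6) √((α_N - α_B)² + 12 + 4 t √2 √(3 + cos θ₁ + cos 2θ₂ - cos (θ₁ - 2θ₂)))`,
for signs `s, t`. -/
def etaRoot (s t αN αB : ℝ) (θ : ℝ × ℝ) : ℝ :=
  -(αN + αB) / 6
    + s * √((αN - αB) ^ 2 + 12
        + t * (4 * √2 * √(3 + Real.cos θ.1 + Real.cos (2 * θ.2) - Real.cos (θ.1 - 2 * θ.2)))) / 6

end MagneticHex

end

/-! Let `s` be the solution on an edge with s(0) = 0 and s'(0) = 1. Off the Dirichlet spectrum, that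
is where s(1) ≠ 0, a solution `u` on an edge is fixed by its two end values. Because `U` is even,
Green's formula gives s(1)u'(0) = u(1) - s'(1)u(0) and s(1)u'(1) = s'(1)u(1) - u(0). Hence the
vertex conditions become a discrete system for the vertex values, T V_B = 3 D_N V_N and T* V_N = 3
D_B V_B, where T is magnetic hopping and D_δ = s'(1) + δ s(1)/3 (`discr`), with D_N and D_B for δ =
δN and δB. As η = s'(1) and α = δ s(1), one has D_δ = η + α/3. The energy enters only through D_N
and D_B (`kirchhoff_iff`, `mem_dispersion_iff`).

In the Landau gauge the system is periodic, and Floquet conditions reduce it to a finite matrix.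
With X = 9 D_N D_B, flux 2π gives X = |1 + e^{iθ₁} + e^{iθ₂}|² (`floquet_one_iff`), and flux π gives
X² - 6X + |1 - e^{2iθ₂} - e^{iθ₁}|² = 0 (`floquet_two_iff`). Solving the latter for η produces the
four explicit roots (`etaRoot_iff`). At θ_D both symbols vanish, so X = 0 is a root there.

The central energies are the zeros of D_δ for the mean coupling δ = (δN + δB)/2. Comparing D_δ(k²)
with cos k shows that D_δ changes sign between (nπ)² and ((n+1)π)² for large n, so there are
infinitely many. If the couplings agree, X = 9D² and the dispersion relation near λ_D reads D =
±ρ(θ), with ρ conical at θ_D (`cone_one`, `cone_two`). The Wronskian identity gives D a simple zero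
with quadratic remainder (`discr_hasStrictDerivAt`), and composing with the local inverse of D
produces the cone (`isDiracCone_of_discr`).

If the couplings differ, D_N = -D_B ≠ 0 at a central energy, so the product D_N D_B is negative up
to its nearest zeros on either side (`exists_gap`). While it is negative, 9 D_N D_B - TT* is
invertible because TT* ≥ 0, and solving the discrete system and then the edge problems gives a
bounded resolvent (`notMem_schrodingerSpectrum`); no Floquet solution exists either. At the end
points X = 0, so θ_D carries a Floquet solution. Its modulus is periodic, and exponential cutoffs of
it contradict a bounded resolvent (`mem_schrodingerSpectrum_of_bounded`). -/

noncomputable section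

namespace MagneticHex

set_option linter.unusedSectionVars false

/-! ### Primitives and `H²` functions on `[0,1]` -/

section Primitive

variable {F : Type*} [NormedAddCommGroup F] [NormedSpace ℝ F]

/-- `u` is a primitive of the integrable function `v` on `[0,1]`. -/
def IsPrimitive (u v : ℝ → F) : Prop :=
  IntervalIntegrable v volume 0 1 ∧ ∀ x ∈ Icc (0 : ℝ) 1, u x = u 0 + ∫ t in (0 : ℝ)..x, v t

instance : IsProbabilityMeasure μ01 := ⟨by simp⟩

theorem intervalIntegrable_iff_integrable_μ01 {f : ℝ → F} :
    IntervalIntegrable f volume 0 1 ↔ Integrable f μ01 :=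
  intervalIntegrable_iff_integrableOn_Icc_of_le zero_le_one

theorem integral_μ01 (f : ℝ → F) : ∫ x, f x ∂μ01 = ∫ x in (0 : ℝ)..1, f x := by
  rw [intervalIntegral.integral_of_le zero_le_one, integral_Icc_eq_integral_Ioc]

theorem intervalIntegrable_of_memLp {w : ℝ → F} (hw : MemLp w 2 μ01) :
    IntervalIntegrable w volume 0 1 :=
  intervalIntegrable_iff_integrable_μ01.2 (hw.integrable one_le_two)

theorem intervalIntegrable_mono01 {f : ℝ → F} (hf : IntervalIntegrable f volume 0 1) {x y : ℝ}
    (hx : x ∈ Icc (0 : ℝ) 1) (hy : y ∈ Icc (0 : ℝ) 1) : IntervalIntegrable f volume x y :=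
  hf.mono_set (by
    rw [uIcc_of_le (zero_le_one' ℝ)]
    exact uIcc_subset_Icc hx hy)

theorem ae_μ01_iff {p : ℝ → Prop} :
    (∀ᵐ x ∂μ01, p x) ↔ ∀ᵐ x, x ∈ Icc (0 : ℝ) 1 → p x :=
  ae_restrict_iff' measurableSet_Icc

theorem integral_congr01 {f g : ℝ → F} (h : f =ᵐ[μ01] g) {x : ℝ} (hx : x ∈ Icc (0 : ℝ) 1) :
    ∫ t in (0 : ℝ)..x, f t = ∫ t in (0 : ℝ)..x, g t := by
  refine intervalIntegral.integral_congr_ae ?_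
  filter_upwards [ae_μ01_iff.1 h] with t ht hm
  rw [uIoc_of_le hx.1] at hm
  exact ht ⟨hm.1.le, hm.2.trans hx.2⟩

theorem memLp_of_continuousOn {u : ℝ → F} (hu : ContinuousOn u (Icc 0 1)) (p : ENNReal) :
    MemLp u p μ01 := by
  obtain ⟨C, hC⟩ := isCompact_Icc.exists_bound_of_continuousOn hu
  refine MemLp.of_bound (hu.aestronglyMeasurable_of_isCompact isCompact_Icc measurableSet_Icc) C ?_
  exact (ae_restrict_iff' measurableSet_Icc).2 (ae_of_all _ fun x hx => hC x hx)

theorem continuousOn_of_integral {u v : ℝ → F} (hv : IntervalIntegrable v volume 0 1)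
    (hu : ∀ x ∈ Icc (0 : ℝ) 1, u x = u 0 + ∫ t in (0 : ℝ)..x, v t) :
    ContinuousOn u (Icc 0 1) := by
  have h := intervalIntegral.continuousOn_primitive_interval'
    (a := (0 : ℝ)) hv (by simp)
  rw [uIcc_of_le (zero_le_one' ℝ)] at h
  exact (continuousOn_const.add h).congr hu

theorem IsPrimitive.continuousOn {u v : ℝ → F} (h : IsPrimitive u v) : ContinuousOn u (Icc 0 1) :=
  continuousOn_of_integral h.1 h.2

theorem ContinuousOn.intervalIntegrable01 {u : ℝ → F} (hu : ContinuousOn u (Icc 0 1)) :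
    IntervalIntegrable u volume 0 1 :=
  ContinuousOn.intervalIntegrable (by rwa [uIcc_of_le (zero_le_one' ℝ)])

theorem isPrimitive_of_hasDerivAt {u v : ℝ → F} [CompleteSpace F] (hv : Continuous v)
    (hu : ∀ x, HasDerivAt u (v x) x) : IsPrimitive u v := by
  refine ⟨hv.intervalIntegrable _ _, fun x _ => ?_⟩
  rw [intervalIntegral.integral_eq_sub_of_hasDerivAt (fun t _ => hu t) (hv.intervalIntegrable _ _)]
  abel

theorem IsPrimitive.add {u v u' v' : ℝ → F} (h : IsPrimitive u v) (h' : IsPrimitive u' v') :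
    IsPrimitive (fun x => u x + u' x) (fun x => v x + v' x) := by
  refine ⟨h.1.add h'.1, fun x hx => ?_⟩
  dsimp only
  rw [intervalIntegral.integral_add (intervalIntegrable_mono01 h.1 (by simp) hx)
    (intervalIntegrable_mono01 h'.1 (by simp) hx), h.2 x hx, h'.2 x hx]
  abel

theorem IsPrimitive.clm_comp {G : Type*} [NormedAddCommGroup G] [NormedSpace ℝ G]
    [CompleteSpace F] [CompleteSpace G] {u v : ℝ → F} (h : IsPrimitive u v) (L : F →L[ℝ] G) :
    IsPrimitive (fun x => L (u x)) (fun x => L (v x)) := by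
  refine ⟨⟨L.integrable_comp h.1.1, L.integrable_comp h.1.2⟩, fun x hx => ?_⟩
  dsimp only
  rw [L.intervalIntegral_comp_comm (intervalIntegrable_mono01 h.1 (by simp) hx), h.2 x hx, map_add]

theorem IsPrimitive.reflect {u v : ℝ → F} (h : IsPrimitive u v) :
    IsPrimitive (fun x => u (1 - x)) (fun x => -v (1 - x)) := by
  have hi : IntervalIntegrable (fun x => v (1 - x)) volume 0 1 := by
    simpa using (h.1.comp_sub_left 1).symm
  refine ⟨hi.neg, fun x hx => ?_⟩
  have hx' : 1 - x ∈ Icc (0 : ℝ) 1 := ⟨by linarith [hx.2], by linarith [hx.1]⟩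
  dsimp only
  have e := intervalIntegral.integral_add_adjacent_intervals
    (intervalIntegrable_mono01 h.1 (by simp : (0 : ℝ) ∈ Icc (0 : ℝ) 1) hx')
    (intervalIntegrable_mono01 h.1 hx' (by simp : (1 : ℝ) ∈ Icc (0 : ℝ) 1))
  rw [intervalIntegral.integral_neg, intervalIntegral.integral_comp_sub_left, sub_zero,
    h.2 _ hx', h.2 1 (by simp), ← e]
  abel

/-- Integration by parts for primitives of integrable real functions. -/
theorem IsPrimitive.mul_sub_mul {F f G g : ℝ → ℝ} (hF : IsPrimitive F f) (hG : IsPrimitive G g)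
    {x : ℝ} (hx : x ∈ Icc (0 : ℝ) 1) :
    F x * G x - F 0 * G 0 = ∫ t in (0 : ℝ)..x, (f t * G t + F t * g t) := by
  -- `F` is controlled on [0,1] only, so absolute continuity and a.e. differentiability are shown
  -- for the globally defined integral and transferred to `F` afterwards.
  have key : ∀ {F f : ℝ → ℝ}, IsPrimitive F f →
      AbsolutelyContinuousOnInterval (fun y => F 0 + ∫ t in (0 : ℝ)..y, f t) 0 x ∧
      ∀ᵐ y, y ∈ uIcc 0 x → HasDerivAt (fun y => F 0 + ∫ t in (0 : ℝ)..y, f t) (f y) y := by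
    intro F f hF
    have hi := intervalIntegrable_mono01 hF.1 (by simp : (0 : ℝ) ∈ Icc (0 : ℝ) 1) hx
    constructor
    · have h1 : AbsolutelyContinuousOnInterval (fun _ : ℝ => F 0) 0 x :=
        (LipschitzWith.const (F 0)).lipschitzOnWith.absolutelyContinuousOnInterval
      exact h1.add (hi.absolutelyContinuousOnInterval_intervalIntegral (c := 0) (by simp))
    · filter_upwards [hi.ae_hasDerivAt_integral] with y hy hm
      exact (hy hm 0 (by simp)).const_add _
  have h := (key hF).1.integral_deriv_mul_eq_sub (key hG).1
  simp only [intervalIntegral.integral_same, add_zero] at h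
  rw [← hF.2 x hx, ← hG.2 x hx] at h
  rw [← h]
  refine intervalIntegral.integral_congr_ae ?_
  filter_upwards [(key hF).2, (key hG).2] with y h1 h2 hm
  have hm' : y ∈ uIcc 0 x := uIoc_subset_uIcc hm
  have hy : y ∈ Icc (0 : ℝ) 1 := by
    rw [uIcc_of_le hx.1] at hm'
    exact ⟨hm'.1, hm'.2.trans hx.2⟩
  rw [(h1 hm').deriv, (h2 hm').deriv, ← hF.2 y hy, ← hG.2 y hy]

/-- Integration by parts for a real and a complex primitive. -/
theorem IsPrimitive.smul_sub_smul {F f : ℝ → ℝ} {G g : ℝ → ℂ} (hF : IsPrimitive F f)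
    (hG : IsPrimitive G g) {x : ℝ} (hx : x ∈ Icc (0 : ℝ) 1) :
    F x • G x - F 0 • G 0 = ∫ t in (0 : ℝ)..x, (f t • G t + F t • g t) := by
  have h0 : (0 : ℝ) ∈ Icc (0 : ℝ) 1 := by simp
  have hc : ∀ {H : ℝ → ℝ}, ContinuousOn H (Icc 0 1) → ContinuousOn H (uIcc 0 1) := by
    intro H hH; rwa [uIcc_of_le (zero_le_one' ℝ)]
  have hc' : ContinuousOn G (uIcc 0 1) := by
    rw [uIcc_of_le (zero_le_one' ℝ)]; exact hG.continuousOn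
  have hi : IntervalIntegrable (fun t => f t • G t + F t • g t) volume 0 x := by
    refine intervalIntegrable_mono01 (IntervalIntegrable.add ?_ ?_) h0 hx
    · exact hF.1.smul_continuousOn hc'
    · exact hG.1.continuousOn_smul (hc hF.continuousOn)
  apply Complex.ext
  · have := hF.mul_sub_mul (hG.clm_comp Complex.reCLM) hx
    rw [← Complex.reCLM_apply (∫ t in (0 : ℝ)..x, _), ← Complex.reCLM.intervalIntegral_comp_comm hi]
    simpa using this
  · have := hF.mul_sub_mul (hG.clm_comp Complex.imCLM) hx
    rw [← Complex.imCLM_apply (∫ t in (0 : ℝ)..x, _), ← Complex.imCLM.intervalIntegral_comp_comm hi]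
    simpa using this

end Primitive

section H2

variable {F : Type*} [NormedAddCommGroup F] [NormedSpace ℝ F] {u v w u' v' w' : ℝ → F}

theorem IsH2.deriv_isPrimitive (h : IsH2 u v w) : IsPrimitive v w :=
  ⟨intervalIntegrable_of_memLp h.1, h.2.2⟩

theorem IsH2.continuousOn_deriv (h : IsH2 u v w) : ContinuousOn v (Icc 0 1) :=
  h.deriv_isPrimitive.continuousOn

theorem IsH2.isPrimitive (h : IsH2 u v w) : IsPrimitive u v :=
  ⟨ContinuousOn.intervalIntegrable01 h.continuousOn_deriv, h.2.1⟩

theorem IsH2.continuousOn (h : IsH2 u v w) : ContinuousOn u (Icc 0 1) :=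
  h.isPrimitive.continuousOn

theorem IsH2.of_isPrimitive (hw : MemLp w 2 μ01) (hu : IsPrimitive u v) (hv : IsPrimitive v w) :
    IsH2 u v w :=
  ⟨hw, hu.2, hv.2⟩

theorem IsH2.add (h : IsH2 u v w) (h' : IsH2 u' v' w') :
    IsH2 (fun x => u x + u' x) (fun x => v x + v' x) (fun x => w x + w' x) :=
  .of_isPrimitive (h.1.add h'.1) (h.isPrimitive.add h'.isPrimitive)
    (h.deriv_isPrimitive.add h'.deriv_isPrimitive)

theorem IsH2.clm_comp {G : Type*} [NormedAddCommGroup G] [NormedSpace ℝ G]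
    [CompleteSpace F] [CompleteSpace G] (h : IsH2 u v w) (L : F →L[ℝ] G) :
    IsH2 (fun x => L (u x)) (fun x => L (v x)) (fun x => L (w x)) :=
  .of_isPrimitive (L.comp_memLp' h.1) (h.isPrimitive.clm_comp L)
    (h.deriv_isPrimitive.clm_comp L)

theorem ae_μ01_comp_reflect {p : ℝ → Prop} (h : ∀ᵐ x ∂μ01, p x) : ∀ᵐ x ∂μ01, p (1 - x) := by
  rw [ae_μ01_iff] at h ⊢
  have := (Measure.measurePreserving_sub_left volume (1 : ℝ)).quasiMeasurePreserving.ae h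
  filter_upwards [this] with x hx hm
  exact hx ⟨by linarith [hm.2], by linarith [hm.1]⟩

theorem memLp_reflect {w : ℝ → F} {p : ENNReal} (hw : MemLp w p μ01) :
    MemLp (fun x => w (1 - x)) p μ01 := by
  have h := (Measure.measurePreserving_sub_left volume (1 : ℝ)).restrict_preimage
    (measurableSet_Icc (a := (0 : ℝ)) (b := 1))
  have h2 : (fun x : ℝ => 1 - x) ⁻¹' Icc (0 : ℝ) 1 = Icc 0 1 := by
    ext x
    simp only [mem_preimage, mem_Icc]
    constructor <;> rintro ⟨h1, h2⟩ <;> constructor <;> linarith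
  rw [h2] at h
  exact hw.comp_measurePreserving h

theorem IsH2.reflect (h : IsH2 u v w) :
    IsH2 (fun x => u (1 - x)) (fun x => -v (1 - x)) (fun x => w (1 - x)) := by
  refine .of_isPrimitive (memLp_reflect h.1) h.isPrimitive.reflect ?_
  have := h.deriv_isPrimitive.reflect
  refine ⟨by simpa [Pi.neg_def] using this.1.neg, fun x hx => ?_⟩
  have h1 := this.2 x hx
  dsimp only at h1 ⊢
  rw [h1, intervalIntegral.integral_neg, neg_add, neg_neg]

/-- A priori bound for `-u'' + q u = k` in terms of the initial values and `∫ |k|`. -/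
theorem IsH2.apriori (h : IsH2 u v w) {q : ℝ → ℝ} (hq : IntervalIntegrable q volume 0 1) {Q : ℝ}
    (hQ : ∫ t in (0 : ℝ)..1, |q t| ≤ Q) {x : ℝ} (hx : x ∈ Icc (0 : ℝ) 1) :
    ‖u x‖ ≤ (3 + 2 * Q) * Real.exp (2 * Q + 1) *
        (‖u 0‖ + ‖v 0‖ + ∫ t in (0 : ℝ)..1, ‖w t - q t • u t‖) ∧
      ‖v x‖ ≤ (3 + 2 * Q) * Real.exp (2 * Q + 1) *
        (‖u 0‖ + ‖v 0‖ + ∫ t in (0 : ℝ)..1, ‖w t - q t • u t‖) := by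
  have h0 : (0 : ℝ) ∈ Icc (0 : ℝ) 1 := by simp
  have hQ0 : 0 ≤ Q :=
    le_trans (intervalIntegral.integral_nonneg zero_le_one fun t _ => abs_nonneg _) hQ
  -- The exponent of a weighted sup norm: it makes Q/κ ≤ 1/2, so the term containing the potential
  -- can be absorbed without any smallness of `q`.
  set κ := 2 * Q + 1 with hκ
  have hκ0 : 0 < κ := by positivity
  have hqu : IntervalIntegrable (fun t => q t • u t) volume 0 1 :=
    hq.smul_continuousOn (by rw [uIcc_of_le (zero_le_one' ℝ)]; exact h.continuousOn)
  have hw := h.deriv_isPrimitive.1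
  set R := ∫ t in (0 : ℝ)..1, ‖w t - q t • u t‖ with hR
  have hRn : 0 ≤ R := intervalIntegral.integral_nonneg zero_le_one fun t _ => norm_nonneg _
  set D := ‖u 0‖ + ‖v 0‖ + R with hD
  -- `M` is the maximum of ‖u(t)‖e^{-κt}; it replaces Gronwall's inequality.
  obtain ⟨x₀, hx₀, hmax⟩ := isCompact_Icc.exists_isMaxOn ⟨0, h0⟩
    (h.continuousOn.norm.mul (by fun_prop : ContinuousOn (fun t : ℝ => Real.exp (-(κ * t))) (Icc 0 1)))
  set M := ‖u x₀‖ * Real.exp (-(κ * x₀)) with hM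
  have hM0 : 0 ≤ M := by positivity
  have hu : ∀ t ∈ Icc (0 : ℝ) 1, ‖u t‖ ≤ M * Real.exp (κ * t) := by
    intro t ht
    have h1 : ‖u t‖ * Real.exp (-(κ * t)) ≤ M := hmax ht
    rwa [Real.exp_neg, ← div_eq_mul_inv, div_le_iff₀ (Real.exp_pos _)] at h1
  have hv : ∀ t ∈ Icc (0 : ℝ) 1, ‖v t‖ ≤ ‖v 0‖ + R + Q * M * Real.exp (κ * t) := by
    intro t ht
    have e1 : ‖∫ s in (0 : ℝ)..t, (w s - q s • u s)‖ ≤ R := by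
      refine (intervalIntegral.norm_integral_le_integral_norm ht.1).trans ?_
      exact intervalIntegral.integral_mono_interval le_rfl ht.1 ht.2
        (ae_of_all _ fun _ => norm_nonneg _) (hw.sub hqu).norm
    have e2 : ‖∫ s in (0 : ℝ)..t, q s • u s‖ ≤ Q * M * Real.exp (κ * t) := by
      calc ‖∫ s in (0 : ℝ)..t, q s • u s‖ ≤ ∫ s in (0 : ℝ)..t, |q s| * (M * Real.exp (κ * t)) := by
            refine intervalIntegral.norm_integral_le_of_norm_le ht.1 (ae_of_all _ fun s hs => ?_)
              (intervalIntegrable_mono01 (hq.abs.mul_const _) h0 ht)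
            rw [norm_smul, Real.norm_eq_abs]
            refine mul_le_mul_of_nonneg_left ?_ (abs_nonneg _)
            refine (hu s ⟨hs.1.le, hs.2.trans ht.2⟩).trans ?_
            have := hs.2
            gcongr
        _ = (∫ s in (0 : ℝ)..t, |q s|) * (M * Real.exp (κ * t)) := by
            rw [intervalIntegral.integral_mul_const]
        _ ≤ Q * (M * Real.exp (κ * t)) := by
            gcongr
            refine le_trans ?_ hQ
            exact intervalIntegral.integral_mono_interval le_rfl ht.1 ht.2
              (ae_of_all _ fun _ => abs_nonneg _) hq.abs
        _ = _ := by ring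
    have e3 : v t = v 0 + (∫ s in (0 : ℝ)..t, (w s - q s • u s)) + ∫ s in (0 : ℝ)..t, q s • u s := by
      rw [h.2.2 t ht, intervalIntegral.integral_sub (intervalIntegrable_mono01 hw h0 ht)
        (intervalIntegrable_mono01 hqu h0 ht)]
      abel
    rw [e3]
    exact (norm_add₃_le).trans (by gcongr)
  have hux : ∀ t ∈ Icc (0 : ℝ) 1, ‖u t‖ ≤ D + Q * M / κ * Real.exp (κ * t) := by
    intro t ht
    have e1 : ‖∫ s in (0 : ℝ)..t, v s‖ ≤ ∫ s in (0 : ℝ)..t, (‖v 0‖ + R + Q * M * Real.exp (κ * s)) := by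
      refine intervalIntegral.norm_integral_le_of_norm_le ht.1 (ae_of_all _ fun s hs => ?_)
        (Continuous.intervalIntegrable (by fun_prop) _ _)
      exact hv s ⟨hs.1.le, hs.2.trans ht.2⟩
    have e2 : ∫ s in (0 : ℝ)..t, (‖v 0‖ + R + Q * M * Real.exp (κ * s))
        = t * (‖v 0‖ + R) + Q * M * ((Real.exp (κ * t) - 1) / κ) := by
      rw [intervalIntegral.integral_add (by simp) (Continuous.intervalIntegrable (by fun_prop) _ _),
        intervalIntegral.integral_const, intervalIntegral.integral_const_mul,
        intervalIntegral.integral_comp_mul_left _ hκ0.ne', integral_exp]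
      simp only [smul_eq_mul, sub_zero, mul_zero, Real.exp_zero]
      field_simp
    have e3 : t * (‖v 0‖ + R) ≤ ‖v 0‖ + R := mul_le_of_le_one_left (by positivity) ht.2
    have e4 : Q * M * ((Real.exp (κ * t) - 1) / κ) ≤ Q * M / κ * Real.exp (κ * t) := by
      have : 0 ≤ Q * M / κ := by positivity
      calc _ = Q * M / κ * Real.exp (κ * t) - Q * M / κ := by ring
        _ ≤ _ := by linarith
    rw [h.2.1 t ht]
    refine (norm_add_le _ _).trans ?_
    rw [hD]
    linarith
  have hD0 : 0 ≤ D := by positivity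
  -- The bound `hux` at the maximiser reads M ≤ D + (Q/κ)M, and Q/κ ≤ 1/2 absorbs the last term.
  have hM2 : M ≤ 2 * D := by
    have h1 := hux x₀ hx₀
    have h2 : Q / κ ≤ 1 / 2 := by
      rw [div_le_div_iff₀ hκ0 two_pos, hκ]; linarith
    have h3 : 1 ≤ Real.exp (κ * x₀) := Real.one_le_exp (mul_nonneg hκ0.le hx₀.1)
    have h4 : M ≤ D + Q * M / κ := by
      have h6 : ‖u x₀‖ = M * Real.exp (κ * x₀) := by
        rw [hM, mul_assoc, ← Real.exp_add, neg_add_cancel, Real.exp_zero, mul_one]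
      have h7 : M * Real.exp (κ * x₀) ≤ (D + Q * M / κ) * Real.exp (κ * x₀) := by
        have := mul_le_mul_of_nonneg_left h3 hD0
        linarith
      exact le_of_mul_le_mul_right h7 (Real.exp_pos _)
    have h5 : Q * M / κ ≤ 1 / 2 * M := by
      rw [mul_div_right_comm]; gcongr
    linarith
  have hE : ∀ t ∈ Icc (0 : ℝ) 1, Real.exp (κ * t) ≤ Real.exp κ := fun t ht =>
    Real.exp_le_exp.2 (mul_le_of_le_one_right hκ0.le ht.2)
  have hE1 : 1 ≤ Real.exp κ := Real.one_le_exp hκ0.le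
  constructor
  · calc ‖u x‖ ≤ M * Real.exp (κ * x) := hu x hx
      _ ≤ 2 * D * Real.exp κ := mul_le_mul hM2 (hE x hx) (Real.exp_pos _).le (by positivity)
      _ ≤ (3 + 2 * Q) * Real.exp κ * D := by
        have : 0 ≤ (1 + 2 * Q) * (Real.exp κ * D) := by positivity
        linarith
  · calc ‖v x‖ ≤ ‖v 0‖ + R + Q * M * Real.exp (κ * x) := hv x hx
      _ ≤ D + Q * (2 * D) * Real.exp κ := by
        have := norm_nonneg (u 0)
        have h1 := mul_le_mul (mul_le_mul_of_nonneg_left hM2 hQ0) (hE x hx) (Real.exp_pos _).le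
          (by positivity)
        rw [hD] at h1 ⊢
        linarith
      _ ≤ (3 + 2 * Q) * Real.exp κ * D := by
        have h1 : D ≤ Real.exp κ * D := le_mul_of_one_le_left hD0 hE1
        have h2 : 0 ≤ Real.exp κ * D := by positivity
        linarith

end H2

/-! ### The initial value problem -/

section InitialValueProblem

variable {F : Type*} [NormedAddCommGroup F] [NormedSpace ℝ F]

theorem memLp_smul_continuousOn {q : ℝ → ℝ} {u : ℝ → F} (hq : MemLp q 2 μ01)
    (hu : ContinuousOn u (Icc 0 1)) : MemLp (fun x => q x • u x) 2 μ01 := by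
  obtain ⟨C, hC⟩ := isCompact_Icc.exists_bound_of_continuousOn hu
  refine (hq.norm.const_mul C).mono' (hq.1.smul
    (hu.aestronglyMeasurable_of_isCompact isCompact_Icc measurableSet_Icc)) ?_
  refine (ae_restrict_iff' measurableSet_Icc).2 (ae_of_all _ fun x hx => ?_)
  rw [norm_smul, mul_comm]
  exact mul_le_mul_of_nonneg_right (hC x hx) (norm_nonneg _)

/-- The initial value problem `u'' = q u - k`, `u(0) = A`, `u'(0) = B` has a solution. -/
theorem exists_initialValueProblem [CompleteSpace F] {q : ℝ → ℝ} {k : ℝ → F} (hq : MemLp q 2 μ01)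
    (hk : MemLp k 2 μ01) (A B : F) :
    ∃ u v : ℝ → F, IsH2 u v (fun x => q x • u x - k x) ∧ u 0 = A ∧ v 0 = B := by
  have h0 : (0 : ℝ) ∈ Icc (0 : ℝ) 1 := by simp
  have hqi := intervalIntegrable_of_memLp hq
  have hki := intervalIntegrable_of_memLp hk
  set Q := ∫ t in (0 : ℝ)..1, |q t| with hQ
  have hQ0 : 0 ≤ Q := intervalIntegral.integral_nonneg zero_le_one fun t _ => abs_nonneg _
  set κ := 2 * Q + 1 with hκ
  have hκ0 : 0 < κ := by positivity
  -- The unknown of the fixed point problem is z = e^{-κt}u. In this variable the Volterra map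
  -- contracts by 1/2 in the plain sup norm on all of [0,1].
  let Y : C(Icc (0 : ℝ) 1, F) → ℝ → F := fun z t =>
    Real.exp (κ * t) • IccExtend (zero_le_one' ℝ) z t
  have hY : ∀ z, Continuous (Y z) := fun z =>
    (by fun_prop : Continuous fun t : ℝ => Real.exp (κ * t)).smul z.continuous.Icc_extend'
  have hqY : ∀ z, IntervalIntegrable (fun t => q t • Y z t) volume 0 1 := fun z =>
    hqi.smul_continuousOn (hY z).continuousOn
  let G : C(Icc (0 : ℝ) 1, F) → ℝ → F := fun z x => B + ∫ t in (0 : ℝ)..x, (q t • Y z t - k t)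
  have hG : ∀ z, ContinuousOn (G z) (Icc 0 1) := fun z =>
    continuousOn_of_integral ((hqY z).sub hki) fun x _ => by simp [G]
  have hGi : ∀ z, IntervalIntegrable (G z) volume 0 1 := fun z =>
    ContinuousOn.intervalIntegrable01 (hG z)
  let P : C(Icc (0 : ℝ) 1, F) → ℝ → F := fun z x => A + ∫ t in (0 : ℝ)..x, G z t
  have hP : ∀ z, ContinuousOn (P z) (Icc 0 1) := fun z =>
    continuousOn_of_integral (hGi z) fun x _ => by simp [P]
  let Φ : C(Icc (0 : ℝ) 1, F) → C(Icc (0 : ℝ) 1, F) := fun z =>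
    ⟨fun x => Real.exp (-(κ * x)) • P z x,
      (by fun_prop : Continuous fun x : Icc (0 : ℝ) 1 => Real.exp (-(κ * x))).smul
        (continuousOn_iff_continuous_domRestrict.1 (hP z))⟩
  have hΦ : ContractingWith (1 / 2) Φ := by
    refine ⟨by rw [← NNReal.coe_lt_coe]; norm_num, LipschitzWith.of_dist_le_mul fun z z' => ?_⟩
    have hd : 0 ≤ dist z z' := dist_nonneg
    refine (ContinuousMap.dist_le (by positivity)).2 fun x => ?_
    have hYd : ∀ t ∈ Icc (0 : ℝ) 1, ‖Y z t - Y z' t‖ ≤ Real.exp (κ * t) * dist z z' := by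
      intro t ht
      simp only [Y, ← smul_sub, norm_smul, Real.norm_eq_abs, Real.abs_exp]
      refine mul_le_mul_of_nonneg_left ?_ (Real.exp_pos _).le
      rw [← dist_eq_norm, IccExtend_of_mem _ _ ht, IccExtend_of_mem _ _ ht]
      exact ContinuousMap.dist_apply_le_dist _
    have hGd : ∀ t ∈ Icc (0 : ℝ) 1, ‖G z t - G z' t‖ ≤ Q * dist z z' * Real.exp (κ * t) := by
      intro t ht
      have e : G z t - G z' t = ∫ s in (0 : ℝ)..t, q s • (Y z s - Y z' s) := by
        simp only [G, add_sub_add_left_eq_sub]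
        rw [← intervalIntegral.integral_sub
          (intervalIntegrable_mono01 ((hqY z).sub hki) h0 ht)
          (intervalIntegrable_mono01 ((hqY z').sub hki) h0 ht)]
        congr 1; ext s; rw [smul_sub]; abel
      rw [e]
      calc _ ≤ ∫ s in (0 : ℝ)..t, |q s| * (Real.exp (κ * t) * dist z z') := by
            refine intervalIntegral.norm_integral_le_of_norm_le ht.1 (ae_of_all _ fun s hs => ?_)
              (intervalIntegrable_mono01 (hqi.abs.mul_const _) h0 ht)
            rw [norm_smul, Real.norm_eq_abs]
            refine mul_le_mul_of_nonneg_left ?_ (abs_nonneg _)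
            refine (hYd s ⟨hs.1.le, hs.2.trans ht.2⟩).trans ?_
            have := hs.2
            gcongr
        _ = (∫ s in (0 : ℝ)..t, |q s|) * (Real.exp (κ * t) * dist z z') := by
            rw [intervalIntegral.integral_mul_const]
        _ ≤ Q * (Real.exp (κ * t) * dist z z') := by
            gcongr
            exact intervalIntegral.integral_mono_interval le_rfl ht.1 ht.2
              (ae_of_all _ fun _ => abs_nonneg _) hqi.abs
        _ = _ := by ring
    have hx := x.2
    have e : P z x - P z' x = ∫ s in (0 : ℝ)..x, (G z s - G z' s) := by
      simp only [P, add_sub_add_left_eq_sub]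
      rw [intervalIntegral.integral_sub (intervalIntegrable_mono01 (hGi z) h0 hx)
        (intervalIntegrable_mono01 (hGi z') h0 hx)]
    have e1 : ‖P z x - P z' x‖ ≤ ∫ s in (0 : ℝ)..x, Q * dist z z' * Real.exp (κ * s) := by
      rw [e]
      refine intervalIntegral.norm_integral_le_of_norm_le hx.1 (ae_of_all _ fun s hs => ?_)
        (Continuous.intervalIntegrable (by fun_prop) _ _)
      exact hGd s ⟨hs.1.le, hs.2.trans hx.2⟩
    have e2 : ∫ s in (0 : ℝ)..x, Q * dist z z' * Real.exp (κ * s)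
        = Q * dist z z' * ((Real.exp (κ * x) - 1) / κ) := by
      rw [intervalIntegral.integral_const_mul, intervalIntegral.integral_comp_mul_left _ hκ0.ne',
        integral_exp]
      simp only [smul_eq_mul, mul_zero, Real.exp_zero]
      field_simp
    have e3 : Q * dist z z' * ((Real.exp (κ * x) - 1) / κ) ≤ 1 / 2 * dist z z' * Real.exp (κ * x) := by
      have h2 : Q / κ ≤ 1 / 2 := by
        rw [div_le_div_iff₀ hκ0 two_pos, hκ]; linarith
      calc _ = Q / κ * (dist z z' * (Real.exp (κ * x) - 1)) := by ring
        _ ≤ Q / κ * (dist z z' * Real.exp (κ * x)) := by gcongr; linarith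
        _ ≤ 1 / 2 * (dist z z' * Real.exp (κ * x)) := by gcongr
        _ = _ := by ring
    have e4 : dist (Φ z x) (Φ z' x) = Real.exp (-(κ * x)) * ‖P z x - P z' x‖ := by
      rw [dist_eq_norm]
      change ‖Real.exp (-(κ * x)) • P z x - Real.exp (-(κ * x)) • P z' x‖ = _
      rw [← smul_sub, norm_smul, Real.norm_eq_abs, Real.abs_exp]
    rw [e4]
    calc _ ≤ Real.exp (-(κ * x)) * (1 / 2 * dist z z' * Real.exp (κ * x)) := by
          gcongr
          exact e1.trans (e2.le.trans e3)
      _ = 1 / 2 * dist z z' * (Real.exp (-(κ * x)) * Real.exp (κ * x)) := by ring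
      _ = _ := by rw [← Real.exp_add]; simp
  set z := hΦ.fixedPoint Φ with hz
  have hfix : Φ z = z := hΦ.fixedPoint_isFixedPt
  have hPY : ∀ x ∈ Icc (0 : ℝ) 1, P z x = Y z x := by
    intro x hx
    have h1 : Real.exp (-(κ * x)) • P z x = z ⟨x, hx⟩ := congrArg (fun f => f ⟨x, hx⟩) hfix
    simp only [Y]
    rw [IccExtend_of_mem _ _ hx, ← h1, smul_smul, ← Real.exp_add]
    simp
  -- The fixed point equation identifies the two functions on [0,1] only, which suffices under the
  -- integral.
  have hae : (fun t => q t • Y z t - k t) =ᵐ[μ01] fun t => q t • P z t - k t := by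
    rw [EventuallyEq, ae_μ01_iff]
    exact ae_of_all _ fun t ht => by rw [hPY t ht]
  refine ⟨P z, G z, ⟨(memLp_smul_continuousOn hq (hP z)).sub hk, fun x _ => by simp [P],
    fun x hx => ?_⟩, by simp [P], by simp [G]⟩
  rw [← integral_congr01 hae hx]
  simp [G]

theorem memLp_sub_const {U : ℝ → ℝ} (hU : MemLp U 2 μ01) (E : ℝ) :
    MemLp (fun x => U x - E) 2 μ01 :=
  hU.sub (memLp_const E)

theorem IsEdgeSolution.of_isH2 {U : ℝ → ℝ} {E : ℝ} {u v : ℝ → F}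
    (h : IsH2 u v fun x => (U x - E) • u x) : IsEdgeSolution U E u v :=
  ⟨_, h, ae_of_all _ fun x => by rw [sub_smul]; abel⟩

/-- The equation fixes the second derivative almost everywhere, so the existential witness may be
exchanged for the explicit (U - E)u. -/
theorem IsEdgeSolution.isH2 {U : ℝ → ℝ} {E : ℝ} {u v : ℝ → F} (hU : MemLp U 2 μ01)
    (h : IsEdgeSolution U E u v) : IsH2 u v fun x => (U x - E) • u x := by
  obtain ⟨w, hw, he⟩ := h
  have hae : w =ᵐ[μ01] fun x => (U x - E) • u x := by
    filter_upwards [he] with x hx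
    rw [sub_smul, ← hx]; abel
  exact ⟨memLp_smul_continuousOn (memLp_sub_const hU E) hw.continuousOn, hw.2.1,
    fun x hx => by rw [← integral_congr01 hae hx]; exact hw.2.2 x hx⟩

/-- The constant in the a priori bound for `-u'' + U u = E u + k`. -/
def aprioriConst (U : ℝ → ℝ) (E : ℝ) : ℝ :=
  (3 + 2 * ((∫ t in (0 : ℝ)..1, |U t|) + |E|)) *
    Real.exp (2 * ((∫ t in (0 : ℝ)..1, |U t|) + |E|) + 1)

theorem integral_abs_nonneg (U : ℝ → ℝ) : 0 ≤ ∫ t in (0 : ℝ)..1, |U t| :=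
  intervalIntegral.integral_nonneg zero_le_one fun _ _ => abs_nonneg _

theorem aprioriConst_pos (U : ℝ → ℝ) (E : ℝ) : 0 < aprioriConst U E := by
  have := integral_abs_nonneg U
  unfold aprioriConst
  positivity

theorem aprioriConst_mono (U : ℝ → ℝ) {E E' : ℝ} (h : |E| ≤ |E'|) :
    aprioriConst U E ≤ aprioriConst U E' := by
  have := integral_abs_nonneg U
  unfold aprioriConst
  gcongr

theorem IsH2.apriori_bound {U : ℝ → ℝ} (hU : MemLp U 2 μ01) (E : ℝ) {u v w : ℝ → F}
    (h : IsH2 u v w) {x : ℝ} (hx : x ∈ Icc (0 : ℝ) 1) :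
    ‖u x‖ ≤ aprioriConst U E *
        (‖u 0‖ + ‖v 0‖ + ∫ t in (0 : ℝ)..1, ‖w t - (U t - E) • u t‖) ∧
      ‖v x‖ ≤ aprioriConst U E *
        (‖u 0‖ + ‖v 0‖ + ∫ t in (0 : ℝ)..1, ‖w t - (U t - E) • u t‖) := by
  have hUi := intervalIntegrable_of_memLp hU
  refine h.apriori (q := fun t => U t - E) (intervalIntegrable_of_memLp (memLp_sub_const hU E))
    ?_ hx
  have h1 : ∫ t in (0 : ℝ)..1, |U t - E| ≤ ∫ t in (0 : ℝ)..1, (|U t| + |E|) :=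
    intervalIntegral.integral_mono_on zero_le_one
      (intervalIntegrable_of_memLp (memLp_sub_const hU E)).abs (hUi.abs.add (by simp))
      fun t _ => abs_sub _ _
  rw [intervalIntegral.integral_add hUi.abs (by simp)] at h1
  simpa using h1

theorem IsEdgeSolution.apriori_bound {U : ℝ → ℝ} (hU : MemLp U 2 μ01) {E : ℝ} {u v : ℝ → F}
    (h : IsEdgeSolution U E u v) {x : ℝ} (hx : x ∈ Icc (0 : ℝ) 1) :
    ‖u x‖ ≤ aprioriConst U E * (‖u 0‖ + ‖v 0‖) ∧ ‖v x‖ ≤ aprioriConst U E * (‖u 0‖ + ‖v 0‖) := by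
  simpa using (h.isH2 hU).apriori_bound hU E hx

theorem IsEdgeSolution.add {U : ℝ → ℝ} {E : ℝ} {u v u' v' : ℝ → F}
    (h : IsEdgeSolution U E u v) (h' : IsEdgeSolution U E u' v') :
    IsEdgeSolution U E (fun x => u x + u' x) (fun x => v x + v' x) := by
  obtain ⟨w, hw, he⟩ := h
  obtain ⟨w', hw', he'⟩ := h'
  refine ⟨_, hw.add hw', ?_⟩
  filter_upwards [he, he'] with x hx hx'
  rw [smul_add, smul_add, ← hx, ← hx']
  abel

theorem IsEdgeSolution.clm_comp {G : Type*} [NormedAddCommGroup G] [NormedSpace ℝ G]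
    [CompleteSpace F] [CompleteSpace G] {U : ℝ → ℝ} {E : ℝ} {u v : ℝ → F}
    (h : IsEdgeSolution U E u v) (L : F →L[ℝ] G) :
    IsEdgeSolution U E (fun x => L (u x)) (fun x => L (v x)) := by
  obtain ⟨w, hw, he⟩ := h
  refine ⟨_, hw.clm_comp L, ?_⟩
  filter_upwards [he] with x hx
  rw [← map_smul, ← map_smul, ← hx, map_add, map_neg]

theorem IsEdgeSolution.reflect {U : ℝ → ℝ} (hUeven : ∀ᵐ x ∂μ01, U x = U (1 - x)) {E : ℝ}
    {u v : ℝ → F} (h : IsEdgeSolution U E u v) :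
    IsEdgeSolution U E (fun x => u (1 - x)) (fun x => -v (1 - x)) := by
  obtain ⟨w, hw, he⟩ := h
  refine ⟨_, hw.reflect, ?_⟩
  filter_upwards [ae_μ01_comp_reflect he, hUeven] with x hx hx'
  rw [hx', hx]

end InitialValueProblem

/-! ### The sine-type solution -/

/-- The solution `s` of `-s'' + U s = E s` with `s(0) = 0`, `s'(0) = 1`, and its derivative. -/
def sine (U : ℝ → ℝ) (E : ℝ) : (ℝ → ℝ) × (ℝ → ℝ) :=
  Classical.epsilon fun p => IsEdgeSolution U E p.1 p.2 ∧ p.1 0 = 0 ∧ p.2 0 = 1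

section Sine

variable {U : ℝ → ℝ}

theorem sine_spec (hU : MemLp U 2 μ01) (E : ℝ) :
    IsEdgeSolution U E (sine U E).1 (sine U E).2 ∧ (sine U E).1 0 = 0 ∧ (sine U E).2 0 = 1 := by
  refine Classical.epsilon_spec
    (p := fun p : (ℝ → ℝ) × (ℝ → ℝ) => IsEdgeSolution U E p.1 p.2 ∧ p.1 0 = 0 ∧ p.2 0 = 1) ?_
  obtain ⟨u, v, h, h0, h1⟩ := exists_initialValueProblem (F := ℝ) (k := fun _ => 0)
    (memLp_sub_const hU E) (by simp) 0 1
  refine ⟨(u, v), .of_isH2 ?_, h0, h1⟩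
  simpa using h

theorem sine_isH2 (hU : MemLp U 2 μ01) (E : ℝ) :
    IsH2 (sine U E).1 (sine U E).2 fun x => (U x - E) * (sine U E).1 x :=
  (sine_spec hU E).1.isH2 hU

/-- A solution with `u(0) = 0` is a multiple of `s`. -/
theorem IsEdgeSolution.eq_mul_sine (hU : MemLp U 2 μ01) {E : ℝ} {u v : ℝ → ℝ}
    (h : IsEdgeSolution U E u v) (h0 : u 0 = 0) {x : ℝ} (hx : x ∈ Icc (0 : ℝ) 1) :
    u x = v 0 * (sine U E).1 x ∧ v x = v 0 * (sine U E).2 x := by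
  obtain ⟨hs, hs0, hs1⟩ := sine_spec hU E
  have := (h.add (hs.clm_comp (ContinuousLinearMap.lsmul ℝ ℝ (-(v 0))))).apriori_bound hU hx
  simp [h0, hs0, hs1] at this
  constructor <;> linarith [this.1, this.2]

/-- An eigenfunction vanishes at 0, hence is a nonzero multiple of `s`; conversely `s` itself is an
eigenfunction. -/
theorem mem_dirichletSpectrum_iff (hU : MemLp U 2 μ01) {E : ℝ} :
    E ∈ dirichletSpectrum U ↔ (sine U E).1 1 = 0 := by
  obtain ⟨hs, hs0, hs1⟩ := sine_spec hU E
  constructor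
  · rintro ⟨u, v, h, h0, h1, x, hx, hne⟩
    have hv : v 0 ≠ 0 := fun hv => hne (by rw [(h.eq_mul_sine hU h0 hx).1, hv, zero_mul])
    have := (h.eq_mul_sine hU h0 (x := 1) (by simp)).1
    rw [h1] at this
    exact (mul_eq_zero.1 this.symm).resolve_left hv
  · intro h1
    refine ⟨_, _, hs, hs0, h1, ?_⟩
    -- If s vanished identically then s'' = 0 a.e., so s' = 1 throughout and s(1) - s(0) = 1, a
    -- contradiction.
    by_contra! hall
    have hae : (fun x => (U x - E) * (sine U E).1 x) =ᵐ[μ01] fun _ => 0 := by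
      rw [EventuallyEq, ae_μ01_iff]
      exact ae_of_all _ fun x hx => by rw [hall x hx, mul_zero]
    have hv : ∀ x ∈ Icc (0 : ℝ) 1, (sine U E).2 x = 1 := by
      intro x hx
      rw [(sine_isH2 hU E).2.2 x hx, integral_congr01 hae hx]
      simp [hs1]
    have h2 := (sine_isH2 hU E).2.1 1 (by simp)
    have hae' : (sine U E).2 =ᵐ[μ01] fun _ => (1 : ℝ) := by
      rw [EventuallyEq, ae_μ01_iff]
      exact ae_of_all _ hv
    rw [integral_congr01 hae' (by simp), h1, hs0] at h2
    norm_num at h2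

/-- φ₁ = s/s(1). Everything is rewritten through `s`, which is defined at every energy and depends
continuously on it. -/
theorem phi₁_eq (hU : MemLp U 2 μ01) {E : ℝ} (hE : E ∉ dirichletSpectrum U) :
    (phi₁ U E).2 0 = 1 / (sine U E).1 1 ∧ (phi₁ U E).2 1 = (sine U E).2 1 / (sine U E).1 1 := by
  obtain ⟨hs, hs0, hs1⟩ := sine_spec hU E
  have hne : (sine U E).1 1 ≠ 0 := fun h => hE ((mem_dirichletSpectrum_iff hU).2 h)
  have key : IsEdgeSolution U E (phi₁ U E).1 (phi₁ U E).2 ∧ (phi₁ U E).1 0 = 0 ∧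
      (phi₁ U E).1 1 = 1 := by
    refine Classical.epsilon_spec
      (p := fun p : (ℝ → ℝ) × (ℝ → ℝ) => IsEdgeSolution U E p.1 p.2 ∧ p.1 0 = 0 ∧ p.1 1 = 1) ?_
    refine ⟨(_, _), hs.clm_comp (ContinuousLinearMap.lsmul ℝ ℝ ((sine U E).1 1)⁻¹), ?_, ?_⟩
    · simp [hs0]
    · simp [hne]
  have h := key.1.eq_mul_sine hU key.2.1 (x := 1) (by simp)
  rw [key.2.2] at h
  have h0 : (phi₁ U E).2 0 = 1 / (sine U E).1 1 := by
    rw [eq_div_iff hne]; exact h.1.symm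
  refine ⟨h0, ?_⟩
  rw [h.2, h0]; ring

theorem eta_eq (hU : MemLp U 2 μ01) {E : ℝ} (hE : E ∉ dirichletSpectrum U) :
    eta U E = (sine U E).2 1 := by
  have hne : (sine U E).1 1 ≠ 0 := fun h => hE ((mem_dirichletSpectrum_iff hU).2 h)
  rw [eta, (phi₁_eq hU hE).1, (phi₁_eq hU hE).2]
  field_simp

theorem alpha_eq (hU : MemLp U 2 μ01) {E : ℝ} (hE : E ∉ dirichletSpectrum U) (δ : ℝ) :
    alpha U E δ = δ * (sine U E).1 1 := by
  rw [alpha, (phi₁_eq hU hE).1, one_div, div_inv_eq_mul]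

/-- The function `D_δ(E) = s'(1) + δ s(1) / 3`. -/
def discr (U : ℝ → ℝ) (δ E : ℝ) : ℝ := (sine U E).2 1 + δ / 3 * (sine U E).1 1

/-- Zero Cauchy data at 1 become zero initial data after reflecting both `s` and the potential, and
the a priori bound then contradicts s'(0) = 1. -/
theorem sine_deriv_ne_zero (hU : MemLp U 2 μ01) {E : ℝ} (h : (sine U E).1 1 = 0) :
    (sine U E).2 1 ≠ 0 := by
  intro h'
  obtain ⟨hs, hs0, hs1⟩ := sine_spec hU E
  have hy : IsEdgeSolution (fun x => U (1 - x)) E (fun x => (sine U E).1 (1 - x))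
      (fun x => -(sine U E).2 (1 - x)) := by
    obtain ⟨w, hw, he⟩ := hs
    exact ⟨_, hw.reflect, ae_μ01_comp_reflect he⟩
  have := (hy.apriori_bound (memLp_reflect hU) (x := 1) (by simp)).2
  simp [h, h', hs1] at this
  norm_num at this

/-- The defining equation says η + (α_N + α_B)/6 = 0. The exclusion of Dirichlet energies is
automatic on the right side: there D_δ = s'(1) ≠ 0. -/
theorem mem_centralEnergies_iff (hU : MemLp U 2 μ01) {δN δB E : ℝ} :
    E ∈ centralEnergies U δN δB ↔ discr U ((δN + δB) / 2) E = 0 := by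
  constructor
  · rintro ⟨hE, h⟩
    rw [eta_eq hU hE, alpha_eq hU hE, alpha_eq hU hE] at h
    rw [discr, h]; ring
  · intro h
    have hE : E ∉ dirichletSpectrum U := by
      rw [mem_dirichletSpectrum_iff hU]
      intro h0
      rw [discr, h0, mul_zero, add_zero] at h
      exact sine_deriv_ne_zero hU h0 h
    refine ⟨hE, ?_⟩
    rw [eta_eq hU hE, alpha_eq hU hE, alpha_eq hU hE]
    rw [discr] at h
    linarith

end Sine

/-! ### Boundary values of solutions on an edge -/

section EdgeFormulas

variable {U : ℝ → ℝ}

theorem intervalIntegrable_smul_of_continuousOn {F : Type*} [NormedAddCommGroup F]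
    [NormedSpace ℝ F] {f : ℝ → ℝ} {g : ℝ → F} (hf : ContinuousOn f (Icc 0 1))
    (hg : IntervalIntegrable g volume 0 1) : IntervalIntegrable (fun t => f t • g t) volume 0 1 :=
  hg.continuousOn_smul (by rwa [uIcc_of_le (zero_le_one' ℝ)])

theorem intervalIntegrable_smul_continuousOn {F : Type*} [NormedAddCommGroup F]
    [NormedSpace ℝ F] {f : ℝ → ℝ} {g : ℝ → F} (hf : IntervalIntegrable f volume 0 1)
    (hg : ContinuousOn g (Icc 0 1)) : IntervalIntegrable (fun t => f t • g t) volume 0 1 :=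
  hf.smul_continuousOn (by rwa [uIcc_of_le (zero_le_one' ℝ)])

/-- Green's formula with `s`, which determines `u'(1)`. -/
theorem IsH2.green_right (hU : MemLp U 2 μ01) (E : ℝ) {u v w : ℝ → ℂ} (h : IsH2 u v w) :
    (sine U E).2 1 • u 1 - u 0 - (sine U E).1 1 • v 1
      = ∫ t in (0 : ℝ)..1, (sine U E).1 t • ((U t - E) • u t - w t) := by
  obtain ⟨-, hs0, hs1⟩ := sine_spec hU E
  have hs := sine_isH2 hU E
  have h1 := hs.isPrimitive.smul_sub_smul h.deriv_isPrimitive (x := 1) (by simp)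
  have h2 := hs.deriv_isPrimitive.smul_sub_smul h.isPrimitive (x := 1) (by simp)
  have i1 := (intervalIntegrable_smul_continuousOn hs.isPrimitive.1 h.continuousOn_deriv).add
    (intervalIntegrable_smul_of_continuousOn hs.continuousOn h.deriv_isPrimitive.1)
  have i2 := (intervalIntegrable_smul_continuousOn hs.deriv_isPrimitive.1 h.continuousOn).add
    (intervalIntegrable_smul_of_continuousOn hs.continuousOn_deriv h.isPrimitive.1)
  have h3 : (∫ t in (0 : ℝ)..1, (sine U E).1 t • ((U t - E) • u t - w t))
      = ((sine U E).2 1 • u 1 - (sine U E).2 0 • u 0)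
        - ((sine U E).1 1 • v 1 - (sine U E).1 0 • v 0) := by
    rw [h1, h2, ← intervalIntegral.integral_sub i2 i1]
    congr 1
    ext t
    rw [smul_sub, smul_smul, mul_comm]
    abel
  rw [h3, hs0, hs1, zero_smul, one_smul, sub_zero]

/-- Green's formula with the reflected `s`, which determines `u'(0)`. -/
theorem IsH2.green_left (hU : MemLp U 2 μ01) (hUeven : ∀ᵐ x ∂μ01, U x = U (1 - x)) (E : ℝ)
    {u v w : ℝ → ℂ} (h : IsH2 u v w) :
    (sine U E).2 1 • u 0 - u 1 + (sine U E).1 1 • v 0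
      = ∫ t in (0 : ℝ)..1, (sine U E).1 (1 - t) • ((U t - E) • u t - w t) := by
  have h1 := h.reflect.green_right hU E
  simp only [sub_self, sub_zero, smul_neg, sub_neg_eq_add] at h1
  rw [h1]
  have h2 := intervalIntegral.integral_comp_sub_left (a := (0 : ℝ)) (b := 1)
    (fun t => (sine U E).1 (1 - t) • ((U t - E) • u t - w t)) 1
  simp only [sub_self, sub_zero, sub_sub_cancel] at h2
  rw [← h2]
  refine integral_congr01 ?_ (by simp)
  filter_upwards [hUeven] with t ht
  rw [ht]

variable {E : ℝ}

theorem sine_ne_zero (hU : MemLp U 2 μ01) (hE : E ∉ dirichletSpectrum U) : (sine U E).1 1 ≠ 0 :=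
  fun h => hE ((mem_dirichletSpectrum_iff hU).2 h)

/-- With `IsEdgeSolution.deriv_zero` this is the Dirichlet-to-Neumann relation of an edge: Green's
formula with vanishing source. Keeping s(1) as a factor makes it valid at all energies. -/
theorem IsEdgeSolution.deriv_one (hU : MemLp U 2 μ01) {u v : ℝ → ℂ}
    (h : IsEdgeSolution U E u v) :
    ((sine U E).1 1 : ℂ) * v 1 = (sine U E).2 1 * u 1 - u 0 := by
  have := (h.isH2 hU).green_right hU E
  simp only [sub_self, smul_zero, intervalIntegral.integral_zero, Complex.real_smul] at this
  linear_combination -this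

theorem IsEdgeSolution.deriv_zero (hU : MemLp U 2 μ01) (hUeven : ∀ᵐ x ∂μ01, U x = U (1 - x))
    {u v : ℝ → ℂ} (h : IsEdgeSolution U E u v) :
    ((sine U E).1 1 : ℂ) * v 0 = u 1 - (sine U E).2 1 * u 0 := by
  have := (h.isH2 hU).green_left hU hUeven E
  simp only [sub_self, smul_zero, intervalIntegral.integral_zero, Complex.real_smul] at this
  linear_combination this

/-- The solution with the boundary values `A` at `0` and `Z` at `1`. -/
def edgeSol (U : ℝ → ℝ) (E : ℝ) (A Z : ℂ) (x : ℝ) : ℂ :=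
  ((sine U E).1 (1 - x) / (sine U E).1 1 : ℝ) * A + ((sine U E).1 x / (sine U E).1 1 : ℝ) * Z

/-- The derivative of `edgeSol`. -/
def edgeSolDeriv (U : ℝ → ℝ) (E : ℝ) (A Z : ℂ) (x : ℝ) : ℂ :=
  (-(sine U E).2 (1 - x) / (sine U E).1 1 : ℝ) * A + ((sine U E).2 x / (sine U E).1 1 : ℝ) * Z

/-- Evenness of `U` makes s(1 - x) a solution as well. At Dirichlet energies the quotients are 0 by
the division convention, so no restriction on `E` is needed. -/
theorem isEdgeSolution_edgeSol (hU : MemLp U 2 μ01) (hUeven : ∀ᵐ x ∂μ01, U x = U (1 - x))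
    (E : ℝ) (A Z : ℂ) : IsEdgeSolution U E (edgeSol U E A Z) (edgeSolDeriv U E A Z) := by
  obtain ⟨hs, -, -⟩ := sine_spec hU E
  have h1 := (hs.reflect hUeven).clm_comp
    ((1 : ℝ →L[ℝ] ℝ).smulRight (((sine U E).1 1)⁻¹ • A))
  have h2 := hs.clm_comp ((1 : ℝ →L[ℝ] ℝ).smulRight (((sine U E).1 1)⁻¹ • Z))
  convert! h1.add h2 using 2
  · simp [edgeSol, div_eq_mul_inv, mul_assoc]
  · simp [edgeSolDeriv, div_eq_mul_inv, mul_assoc]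

theorem edgeSol_zero (hU : MemLp U 2 μ01) (hE : E ∉ dirichletSpectrum U) (A Z : ℂ) :
    edgeSol U E A Z 0 = A := by
  simp [edgeSol, (sine_spec hU E).2.1, sine_ne_zero hU hE]

theorem edgeSol_one (hU : MemLp U 2 μ01) (hE : E ∉ dirichletSpectrum U) (A Z : ℂ) :
    edgeSol U E A Z 1 = Z := by
  simp [edgeSol, (sine_spec hU E).2.1, sine_ne_zero hU hE]

/-- A solution is determined by its boundary values. -/
theorem IsEdgeSolution.eq_edgeSol (hU : MemLp U 2 μ01) (hUeven : ∀ᵐ x ∂μ01, U x = U (1 - x))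
    (hE : E ∉ dirichletSpectrum U) {u v : ℝ → ℂ} (h : IsEdgeSolution U E u v) {x : ℝ}
    (hx : x ∈ Icc (0 : ℝ) 1) : u x = edgeSol U E (u 0) (u 1) x := by
  have hs := sine_ne_zero hU hE
  have he := isEdgeSolution_edgeSol hU hUeven E (u 0) (u 1)
  have hd := h.add (he.clm_comp (-1 : ℂ →L[ℝ] ℂ))
  have h0 := hd.deriv_zero hU hUeven
  simp only [neg_apply, one_apply_eq_self,
    edgeSol_zero hU hE, edgeSol_one hU hE, add_neg_cancel, mul_zero, sub_zero] at h0
  have h1 := (mul_eq_zero.1 h0).resolve_left (by exact_mod_cast hs)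
  have h2 := (hd.apriori_bound hU hx).1
  simp only [neg_apply, one_apply_eq_self,
    edgeSol_zero hU hE, add_neg_cancel, h1, norm_zero, add_zero, mul_zero] at h2
  exact add_neg_eq_zero.1 (norm_le_zero_iff.1 h2)

end EdgeFormulas

/-! ### Dependence on the energy -/

section Energy

variable {U : ℝ → ℝ}

theorem sine_le (hU : MemLp U 2 μ01) (E : ℝ) {x : ℝ} (hx : x ∈ Icc (0 : ℝ) 1) :
    |(sine U E).1 x| ≤ aprioriConst U E := by
  obtain ⟨hs, hs0, hs1⟩ := sine_spec hU E
  simpa [hs0, hs1] using (hs.apriori_bound hU hx).1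

/-- The difference of the two solutions has zero initial data and solves the equation at energy `E`
with a source of size |E' - E||s_{E'}|; the a priori bound does the rest. -/
theorem sine_lipschitz (hU : MemLp U 2 μ01) (E E' : ℝ) {x : ℝ} (hx : x ∈ Icc (0 : ℝ) 1) :
    |(sine U E').1 x - (sine U E).1 x| ≤ aprioriConst U E * (aprioriConst U E' * |E' - E|) ∧
    |(sine U E').2 x - (sine U E).2 x| ≤ aprioriConst U E * (aprioriConst U E' * |E' - E|) := by
  obtain ⟨-, hs0, hs1⟩ := sine_spec hU E
  obtain ⟨-, hs0', hs1'⟩ := sine_spec hU E'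
  have hd := (sine_isH2 hU E').add ((sine_isH2 hU E).clm_comp (-1 : ℝ →L[ℝ] ℝ))
  have h := hd.apriori_bound hU E hx
  simp only [neg_apply, one_apply_eq_self, hs0, hs0', hs1, hs1',
    ← sub_eq_add_neg, sub_self, norm_zero, zero_add, smul_eq_mul, Real.norm_eq_abs] at h
  have hle : ∫ t in (0 : ℝ)..1, |(U t - E') * (sine U E').1 t - (U t - E) * (sine U E).1 t
      - (U t - E) * ((sine U E').1 t - (sine U E).1 t)| ≤ aprioriConst U E' * |E' - E| := by
    have : ∀ t ∈ Icc (0 : ℝ) 1, ‖|(U t - E') * (sine U E').1 t - (U t - E) * (sine U E).1 t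
        - (U t - E) * ((sine U E').1 t - (sine U E).1 t)|‖ ≤ aprioriConst U E' * |E' - E| := by
      intro t ht
      rw [Real.norm_eq_abs, abs_abs]
      have e : (U t - E') * (sine U E').1 t - (U t - E) * (sine U E).1 t
        - (U t - E) * ((sine U E').1 t - (sine U E).1 t) = -((sine U E').1 t * (E' - E)) := by ring
      rw [e, abs_neg, abs_mul]
      exact mul_le_mul_of_nonneg_right (sine_le hU E' ht) (abs_nonneg _)
    refine (le_abs_self _).trans ?_
    have h2 := intervalIntegral.norm_integral_le_of_norm_le_const (a := (0 : ℝ)) (b := 1)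
      (fun t ht => this t (by rw [uIoc_of_le zero_le_one] at ht; exact ⟨ht.1.le, ht.2⟩))
    simpa using h2
  have hC := (aprioriConst_pos U E).le
  exact ⟨h.1.trans (mul_le_mul_of_nonneg_left hle hC), h.2.trans (mul_le_mul_of_nonneg_left hle hC)⟩

theorem sine_lipschitz_near (hU : MemLp U 2 μ01) (E₀ : ℝ) : ∃ C, 0 < C ∧
    ∀ E E' : ℝ, |E - E₀| ≤ 1 → |E' - E₀| ≤ 1 → ∀ x ∈ Icc (0 : ℝ) 1,
      |(sine U E).1 x| ≤ C ∧ |(sine U E').1 x - (sine U E).1 x| ≤ C * |E' - E| ∧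
      |(sine U E').2 x - (sine U E).2 x| ≤ C * |E' - E| := by
  set A := aprioriConst U (|E₀| + 1)
  have hA : 0 < A := aprioriConst_pos _ _
  have hle : ∀ E, |E - E₀| ≤ 1 → aprioriConst U E ≤ A := fun E hE =>
    aprioriConst_mono U (by
      have := abs_sub_abs_le_abs_sub E E₀
      rw [abs_of_nonneg (by positivity : 0 ≤ |E₀| + 1)]
      linarith)
  refine ⟨A + A * A, by positivity, fun E E' hE hE' x hx => ?_⟩
  have h := sine_lipschitz hU E E' hx
  have h1 : aprioriConst U E * (aprioriConst U E' * |E' - E|) ≤ (A + A * A) * |E' - E| := by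
    have := mul_le_mul (hle E hE) (hle E' hE') (aprioriConst_pos U E').le hA.le
    rw [← mul_assoc]
    gcongr
    nlinarith
  refine ⟨((sine_le hU E hx).trans (hle E hE)).trans ?_, h.1.trans h1, h.2.trans h1⟩
  nlinarith

theorem continuous_of_lipschitz_near {f : ℝ → ℝ}
    (h : ∀ E₀, ∃ C, ∀ E, |E - E₀| ≤ 1 → |f E - f E₀| ≤ C * |E - E₀|) : Continuous f := by
  refine continuous_iff_continuousAt.2 fun E₀ => ?_
  obtain ⟨C, hC⟩ := h E₀
  rw [ContinuousAt, tendsto_iff_norm_sub_tendsto_zero]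
  have h1 : Tendsto (fun E => C * |E - E₀|) (𝓝 E₀) (𝓝 0) := by
    have : Continuous fun E => C * |E - E₀| := by fun_prop
    simpa using this.tendsto E₀
  refine squeeze_zero' (Eventually.of_forall fun _ => norm_nonneg _) ?_ h1
  filter_upwards [Metric.closedBall_mem_nhds E₀ one_pos] with E hE
  exact hC E hE

theorem continuous_sine_one (hU : MemLp U 2 μ01) : Continuous fun E => (sine U E).1 1 :=
  continuous_of_lipschitz_near fun E₀ => by
    obtain ⟨C, -, hC⟩ := sine_lipschitz_near hU E₀
    exact ⟨C, fun E hE => (hC E₀ E (by simp) hE 1 (by simp)).2.1⟩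

theorem continuous_sine_deriv_one (hU : MemLp U 2 μ01) : Continuous fun E => (sine U E).2 1 :=
  continuous_of_lipschitz_near fun E₀ => by
    obtain ⟨C, -, hC⟩ := sine_lipschitz_near hU E₀
    exact ⟨C, fun E hE => (hC E₀ E (by simp) hE 1 (by simp)).2.2⟩

theorem continuous_discr (hU : MemLp U 2 μ01) (δ : ℝ) : Continuous (discr U δ) :=
  (continuous_sine_deriv_one hU).add ((continuous_sine_one hU).const_mul _)

/-- The overlap `∫ s_E s_{E'}`. -/
def overlap (U : ℝ → ℝ) (E E' : ℝ) : ℝ := ∫ t in (0 : ℝ)..1, (sine U E).1 t * (sine U E').1 t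

/-- The terms with δ cancel, leaving the Lagrange identity for s_E and s_{E'}, whose Wronskian has
derivative (E' - E)s_E s_{E'}. It controls differences of D_δ without differentiating the solutions
in the energy. -/
theorem discr_wronskian (hU : MemLp U 2 μ01) (δ E E' : ℝ) :
    discr U δ E * (sine U E').1 1 - (sine U E).1 1 * discr U δ E' = (E' - E) * overlap U E E' := by
  obtain ⟨-, hs0, hs1⟩ := sine_spec hU E
  obtain ⟨-, hs0', hs1'⟩ := sine_spec hU E'
  have hs := sine_isH2 hU E
  have hs' := sine_isH2 hU E'
  have h1 := hs.deriv_isPrimitive.mul_sub_mul hs'.isPrimitive (x := 1) (by simp)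
  have h2 := hs.isPrimitive.mul_sub_mul hs'.deriv_isPrimitive (x := 1) (by simp)
  have i1 := (intervalIntegrable_smul_continuousOn hs.deriv_isPrimitive.1 hs'.continuousOn).add
    (intervalIntegrable_smul_of_continuousOn hs.continuousOn_deriv hs'.isPrimitive.1)
  have i2 := (intervalIntegrable_smul_continuousOn hs.isPrimitive.1 hs'.continuousOn_deriv).add
    (intervalIntegrable_smul_of_continuousOn hs.continuousOn hs'.deriv_isPrimitive.1)
  have h3 := intervalIntegral.integral_sub i1 i2
  simp only [smul_eq_mul] at h3
  rw [← h1, ← h2, hs0, hs0'] at h3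
  have h4 : (E' - E) * overlap U E E' = ∫ t in (0 : ℝ)..1, (E' - E) * ((sine U E).1 t * (sine U E').1 t) := by
    rw [overlap, intervalIntegral.integral_const_mul]
  rw [h4, discr, discr]
  calc _ = (sine U E).2 1 * (sine U E').1 1 - (sine U E).2 0 * 0
        - ((sine U E).1 1 * (sine U E').2 1 - 0 * (sine U E').2 0) := by ring
    _ = _ := by
      rw [← h3]
      congr 1
      ext t
      ring

theorem overlap_self_pos (hU : MemLp U 2 μ01) {E : ℝ} (h : (sine U E).1 1 ≠ 0) :
    0 < overlap U E E := by
  have hc := (sine_isH2 hU E).continuousOn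
  refine intervalIntegral.integral_pos one_pos (hc.mul hc) (fun t _ => mul_self_nonneg _)
    ⟨1, by simp, mul_self_pos.2 h⟩

theorem overlap_near (hU : MemLp U 2 μ01) (E₀ : ℝ) : ∃ C, 0 < C ∧
    ∀ E E' : ℝ, |E - E₀| ≤ 1 → |E' - E₀| ≤ 1 →
      |overlap U E E' - overlap U E₀ E₀| ≤ C * (|E - E₀| + |E' - E₀|) := by
  obtain ⟨C, hC0, hC⟩ := sine_lipschitz_near hU E₀
  refine ⟨C * C, by positivity, fun E E' hE hE' => ?_⟩
  have hc := fun E => (sine_isH2 hU E).continuousOn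
  have hi : ∀ E E' : ℝ, IntervalIntegrable (fun t => (sine U E).1 t * (sine U E').1 t) volume 0 1 :=
    fun E E' => ContinuousOn.intervalIntegrable01 ((hc E).mul (hc E'))
  rw [overlap, overlap, ← intervalIntegral.integral_sub (hi _ _) (hi _ _)]
  have h2 := intervalIntegral.norm_integral_le_of_norm_le_const (a := (0 : ℝ)) (b := 1)
    (f := fun t => (sine U E).1 t * (sine U E').1 t - (sine U E₀).1 t * (sine U E₀).1 t)
    (C := C * C * (|E - E₀| + |E' - E₀|)) (fun t ht => by
      rw [uIoc_of_le zero_le_one] at ht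
      have ht' : t ∈ Icc (0 : ℝ) 1 := ⟨ht.1.le, ht.2⟩
      have e : (sine U E).1 t * (sine U E').1 t - (sine U E₀).1 t * (sine U E₀).1 t
        = ((sine U E).1 t - (sine U E₀).1 t) * (sine U E').1 t
          + (sine U E₀).1 t * ((sine U E').1 t - (sine U E₀).1 t) := by ring
      rw [e, Real.norm_eq_abs]
      refine (abs_add_le _ _).trans ?_
      rw [abs_mul, abs_mul]
      have a1 := (hC E₀ E (by simp) hE t ht').2.1
      have a2 := (hC E' E₀ hE' (by simp) t ht').1
      have a3 := (hC E₀ E (by simp) hE t ht').1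
      have a4 := (hC E₀ E' (by simp) hE' t ht').2.1
      have b1 := mul_le_mul a1 a2 (abs_nonneg _) (by positivity)
      have b2 := mul_le_mul a3 a4 (abs_nonneg _) hC0.le
      linarith)
  simpa using h2

/-- At its zeros, `D_δ` has a nonzero strict derivative and a quadratic remainder. -/
theorem discr_hasStrictDerivAt (hU : MemLp U 2 μ01) {δ E₀ : ℝ} (h0 : discr U δ E₀ = 0) :
    ∃ d : ℝ, d ≠ 0 ∧ HasStrictDerivAt (discr U δ) d E₀ ∧
      (fun E => discr U δ E - d * (E - E₀)) =O[𝓝 E₀] fun E => (E - E₀) ^ 2 := by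
  have hs : (sine U E₀).1 1 ≠ 0 := by
    intro h
    refine sine_deriv_ne_zero hU h ?_
    simpa [discr, h] using h0
  set σ := (sine U E₀).1 1 with hσ
  have hI := overlap_self_pos hU hs
  -- At a zero E₀ of D_δ the Wronskian identity reads -σD_δ(E) = (E - E₀)∫s_{E₀}s_E; divide by E -
  -- E₀ and let E → E₀.
  set d := -overlap U E₀ E₀ / σ with hd
  obtain ⟨C, hC0, hC⟩ := sine_lipschitz_near hU E₀
  obtain ⟨K, hK0, hK⟩ := overlap_near hU E₀
  have hball := Metric.closedBall_mem_nhds E₀ one_pos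
  refine ⟨d, div_ne_zero (neg_ne_zero.2 hI.ne') hs, ?_, ?_⟩
  · rw [HasStrictDerivAt, hasDerivAtFilter_iff_isLittleO]
    have hσn : ∀ᶠ p : ℝ × ℝ in 𝓝 (E₀, E₀), (sine U p.2).1 1 ≠ 0 :=
      ((continuous_sine_one hU).comp continuous_snd).continuousAt.eventually_ne hs
    have hball2 : ∀ᶠ p : ℝ × ℝ in 𝓝 (E₀, E₀), |p.1 - E₀| ≤ 1 ∧ |p.2 - E₀| ≤ 1 :=
      ((continuous_fst.tendsto (E₀, E₀)).eventually hball).and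
        ((continuous_snd.tendsto (E₀, E₀)).eventually hball)
    -- Strict differentiability needs two moving points. This difference quotient is only known to
    -- be bounded, but it comes multiplied by D_δ(p.2), which tends to 0.
    let S : ℝ × ℝ → ℝ := fun p => ((sine U p.1).1 1 - (sine U p.2).1 1) / (p.1 - p.2)
    let ε : ℝ × ℝ → ℝ := fun p =>
      (discr U δ p.2 * S p - overlap U p.2 p.1) / (sine U p.2).1 1 - d
    have hε : Tendsto ε (𝓝 (E₀, E₀)) (𝓝 0) := by
      have t1 : Tendsto (fun p : ℝ × ℝ => discr U δ p.2 * S p) (𝓝 (E₀, E₀)) (𝓝 0) := by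
        have u1 : Tendsto (fun p : ℝ × ℝ => |discr U δ p.2| * C) (𝓝 (E₀, E₀)) (𝓝 0) := by
          have : Continuous fun p : ℝ × ℝ => |discr U δ p.2| * C :=
            (((continuous_discr hU δ).comp continuous_snd).abs).mul continuous_const
          simpa [h0] using this.tendsto (E₀, E₀)
        refine squeeze_zero_norm' ?_ u1
        filter_upwards [hball2] with p hp
        rw [norm_mul, Real.norm_eq_abs, Real.norm_eq_abs]
        refine mul_le_mul_of_nonneg_left ?_ (abs_nonneg _)
        rw [abs_div]
        exact div_le_of_le_mul₀ (abs_nonneg _) hC0.le (hC p.2 p.1 hp.2 hp.1 1 (by simp)).2.1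
      have t2 : Tendsto (fun p : ℝ × ℝ => overlap U p.2 p.1) (𝓝 (E₀, E₀)) (𝓝 (overlap U E₀ E₀)) := by
        rw [tendsto_iff_norm_sub_tendsto_zero]
        have u1 : Tendsto (fun p : ℝ × ℝ => K * (|p.2 - E₀| + |p.1 - E₀|)) (𝓝 (E₀, E₀)) (𝓝 0) := by
          have : Continuous fun p : ℝ × ℝ => K * (|p.2 - E₀| + |p.1 - E₀|) := by fun_prop
          simpa using this.tendsto (E₀, E₀)
        refine squeeze_zero' (Eventually.of_forall fun _ => norm_nonneg _) ?_ u1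
        filter_upwards [hball2] with p hp
        exact hK _ _ hp.2 hp.1
      have t3 : Tendsto (fun p : ℝ × ℝ => (sine U p.2).1 1) (𝓝 (E₀, E₀)) (𝓝 σ) :=
        ((continuous_sine_one hU).comp continuous_snd).tendsto (E₀, E₀)
      have := ((t1.sub t2).div t3 hs).sub_const d
      simpa [hd, ε] using this
    have hmul : (fun p : ℝ × ℝ => discr U δ p.1 - discr U δ p.2 - (p.1 - p.2) • d)
        =ᶠ[𝓝 (E₀, E₀)] fun p => (p.1 - p.2) * ε p := by
      filter_upwards [hσn] with p hp
      have hw := discr_wronskian hU δ p.2 p.1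
      have hS : (p.1 - p.2) * S p = (sine U p.1).1 1 - (sine U p.2).1 1 := by
        rcases eq_or_ne p.1 p.2 with h | h
        · simp [h]
        · simp only [S]; field_simp [sub_ne_zero.2 h]
      simp only [ε, smul_eq_mul, mul_sub]
      congr 1
      rw [mul_div_assoc', eq_div_iff hp, mul_sub, ← mul_assoc, mul_comm (p.1 - p.2) (discr U δ p.2),
        mul_assoc, hS]
      linarith
    refine IsLittleO.congr' (f₁ := fun p : ℝ × ℝ => (p.1 - p.2) * ε p) ?_ hmul.symm .rfl
    have := (isBigO_refl (fun p : ℝ × ℝ => p.1 - p.2) (𝓝 (E₀, E₀))).mul_isLittleO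
      ((isLittleO_one_iff ℝ).2 hε)
    simpa using this
  · refine IsBigO.of_bound (K / |σ|) ?_
    filter_upwards [hball] with E hE
    have hw := discr_wronskian hU δ E₀ E
    rw [h0, zero_mul, zero_sub] at hw
    have e : discr U δ E - d * (E - E₀) = -((E - E₀) * (overlap U E₀ E - overlap U E₀ E₀)) / σ := by
      rw [eq_div_iff hs, hd, sub_mul, mul_assoc, mul_comm (E - E₀) σ, ← mul_assoc,
        div_mul_cancel₀ _ hs]
      linarith
    have h1 := hK E₀ E (by simp) hE
    rw [sub_self, abs_zero, zero_add] at h1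
    rw [e, norm_div, norm_neg, norm_mul, norm_pow, Real.norm_eq_abs, Real.norm_eq_abs,
      Real.norm_eq_abs, div_mul_eq_mul_div]
    have := mul_le_mul_of_nonneg_left h1 (abs_nonneg (E - E₀))
    refine div_le_div_of_nonneg_right ?_ (abs_nonneg _)
    linarith

end Energy

/-! ### High-energy asymptotics -/

section Asymptotics

variable {U : ℝ → ℝ}

theorem norm_cos_sin_le (z : ℂ) :
    ‖Complex.cos z‖ ≤ Real.exp |z.im| ∧ ‖Complex.sin z‖ ≤ Real.exp |z.im| := by
  have h1 : ‖Complex.exp (z * Complex.I)‖ ≤ Real.exp |z.im| := by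
    rw [Complex.norm_exp]
    simpa using neg_le_abs z.im
  have h2 : ‖Complex.exp (-z * Complex.I)‖ ≤ Real.exp |z.im| := by
    rw [Complex.norm_exp]
    simpa using le_abs_self z.im
  constructor
  · rw [Complex.cos, norm_div, Complex.norm_two, div_le_iff₀ two_pos]
    exact (norm_add_le _ _).trans (by linarith)
  · rw [Complex.sin, norm_div, Complex.norm_two, div_le_iff₀ two_pos, norm_mul, Complex.norm_I,
      mul_one]
    exact (norm_sub_le _ _).trans (by linarith)

/-- Variation of constants for `s`, at the energy `k²`. -/
theorem sine_variation (hU : MemLp U 2 μ01) {E : ℝ} {k : ℂ} (hk : k ^ 2 = E) {x : ℝ}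
    (hx : x ∈ Icc (0 : ℝ) 1) :
    ((sine U E).2 x : ℂ) - Complex.cos (k * x)
        = ∫ t in (0 : ℝ)..x, ((U t * (sine U E).1 t : ℝ) : ℂ) * Complex.cos (k * (x - t)) ∧
      k * (sine U E).1 x - Complex.sin (k * x)
        = ∫ t in (0 : ℝ)..x, ((U t * (sine U E).1 t : ℝ) : ℂ) * Complex.sin (k * (x - t)) := by
  obtain ⟨-, hs0, hs1⟩ := sine_spec hU E
  have hs := sine_isH2 hU E
  have h0 : (0 : ℝ) ∈ Icc (0 : ℝ) 1 := by simp
  have hlin : ∀ t : ℝ, HasDerivAt (fun t : ℝ => k * ((x : ℂ) - t)) (-k) t := fun t => by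
    have := ((Complex.ofRealCLM.hasDerivAt (x := t)).const_sub (x : ℂ)).const_mul k
    simpa using this
  have hcos : IsPrimitive (fun t : ℝ => Complex.cos (k * (x - t)))
      fun t => k * Complex.sin (k * (x - t)) :=
    isPrimitive_of_hasDerivAt (by fun_prop) fun t => by
      have := (Complex.hasDerivAt_cos _).comp t (hlin t)
      convert! this using 1; ring
  have hsin : IsPrimitive (fun t : ℝ => Complex.sin (k * (x - t)))
      fun t => -(k * Complex.cos (k * (x - t))) :=
    isPrimitive_of_hasDerivAt (by fun_prop) fun t => by
      have := (Complex.hasDerivAt_sin _).comp t (hlin t)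
      convert! this using 1; ring
  have hkcos : IsPrimitive (fun t : ℝ => k * Complex.cos (k * (x - t)))
      fun t => k * (k * Complex.sin (k * (x - t))) :=
    hcos.clm_comp (ContinuousLinearMap.mul ℝ ℂ k)
  have hksin : IsPrimitive (fun t : ℝ => k * Complex.sin (k * (x - t)))
      fun t => k * -(k * Complex.cos (k * (x - t))) :=
    hsin.clm_comp (ContinuousLinearMap.mul ℝ ℂ k)
  have hint : ∀ {F f : ℝ → ℝ} {G g : ℝ → ℂ}, IsPrimitive F f → IsPrimitive G g →
      IntervalIntegrable (fun t => f t • G t + F t • g t) volume 0 x := fun hF hG =>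
    intervalIntegrable_mono01
      ((intervalIntegrable_smul_continuousOn hF.1 hG.continuousOn).add
        (intervalIntegrable_smul_of_continuousOn hF.continuousOn hG.1)) h0 hx
  have a1 := hs.deriv_isPrimitive.smul_sub_smul hcos hx
  have a2 := hs.isPrimitive.smul_sub_smul hksin hx
  have a3 := hs.deriv_isPrimitive.smul_sub_smul hsin hx
  have a4 := hs.isPrimitive.smul_sub_smul hkcos hx
  have b1 := intervalIntegral.integral_sub (hint hs.deriv_isPrimitive hcos) (hint hs.isPrimitive hksin)
  have b2 := intervalIntegral.integral_add (hint hs.deriv_isPrimitive hsin) (hint hs.isPrimitive hkcos)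
  rw [← a1, ← a2] at b1
  rw [← a3, ← a4] at b2
  simp only [hs0, hs1, sub_self, mul_zero, Complex.cos_zero, Complex.sin_zero, Complex.ofReal_zero,
    sub_zero, one_smul, zero_smul, smul_zero, zero_sub, Complex.real_smul, mul_one] at b1 b2
  constructor
  · rw [← b1]
    congr 1
    ext t
    push_cast
    rw [← hk]
    ring
  · calc _ = -Complex.sin (k * x) + ((sine U E).1 x : ℂ) * k := by ring
      _ = _ := by
        rw [← b2]
        congr 1
        ext t
        push_cast
        rw [← hk]
        ring

/-- If M is the maximum of |s(x)|e^{-|Im k|x}, variation of constants at the maximiser gives |k|M ≤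
1 + NM. Allowing complex `k` treats positive and negative energies together. -/
theorem sine_asymptotics (hU : MemLp U 2 μ01) {E : ℝ} {k : ℂ} (hk : k ^ 2 = E) {N : ℝ}
    (hN : ∫ t in (0 : ℝ)..1, |U t| = N) (hkN : N < ‖k‖) :
    |(sine U E).1 1| ≤ Real.exp |k.im| / (‖k‖ - N) ∧
      ‖((sine U E).2 1 : ℂ) - Complex.cos k‖ ≤ N * Real.exp |k.im| / (‖k‖ - N) := by
  have h0 : (0 : ℝ) ∈ Icc (0 : ℝ) 1 := by simp
  have hUi := intervalIntegrable_of_memLp hU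
  have hN0 : 0 ≤ N := hN ▸ integral_abs_nonneg U
  set s := (sine U E).1 with hs
  have hsc : ContinuousOn s (Icc 0 1) := (sine_isH2 hU E).continuousOn
  set h := |k.im| with hh
  obtain ⟨x₀, hx₀, hmax⟩ := isCompact_Icc.exists_isMaxOn ⟨0, h0⟩
    (hsc.abs.mul (by fun_prop : ContinuousOn (fun t : ℝ => Real.exp (-(h * t))) (Icc 0 1)))
  set M := |s x₀| * Real.exp (-(h * x₀)) with hM
  have hM0 : 0 ≤ M := by positivity
  have hu : ∀ t ∈ Icc (0 : ℝ) 1, |s t| ≤ M * Real.exp (h * t) := by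
    intro t ht
    have h1 : |s t| * Real.exp (-(h * t)) ≤ M := hmax ht
    rwa [Real.exp_neg, ← div_eq_mul_inv, div_le_iff₀ (Real.exp_pos _)] at h1
  have him : ∀ y : ℝ, 0 ≤ y → |(k * y).im| = h * y := fun y hy => by
    rw [Complex.im_mul_ofReal, abs_mul, abs_of_nonneg hy]
  have hb : ∀ x ∈ Icc (0 : ℝ) 1, ∀ g : ℂ → ℂ, (∀ z, ‖g z‖ ≤ Real.exp |z.im|) →
      ‖∫ t in (0 : ℝ)..x, ((U t * s t : ℝ) : ℂ) * g (k * (x - t))‖ ≤ N * M * Real.exp (h * x) := by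
    intro x hx g hg
    calc _ ≤ ∫ t in (0 : ℝ)..x, |U t| * (M * Real.exp (h * x)) := by
          refine intervalIntegral.norm_integral_le_of_norm_le hx.1 (ae_of_all _ fun t ht => ?_)
            (intervalIntegrable_mono01 (hUi.abs.mul_const _) h0 hx)
          rw [norm_mul, Complex.norm_real, Real.norm_eq_abs, abs_mul, mul_assoc]
          refine mul_le_mul_of_nonneg_left ?_ (abs_nonneg _)
          have h1 := hu t ⟨ht.1.le, ht.2.trans hx.2⟩
          have h2 := hg (k * (x - t))
          rw [← Complex.ofReal_sub, him _ (sub_nonneg.2 ht.2), Complex.ofReal_sub] at h2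
          calc _ ≤ M * Real.exp (h * t) * Real.exp (h * (x - t)) :=
                mul_le_mul h1 h2 (norm_nonneg _) (by positivity)
            _ = M * Real.exp (h * x) := by
                rw [mul_assoc, ← Real.exp_add]; congr 2; ring
      _ = (∫ t in (0 : ℝ)..x, |U t|) * (M * Real.exp (h * x)) := by
          rw [intervalIntegral.integral_mul_const]
      _ ≤ N * (M * Real.exp (h * x)) := by
          gcongr
          rw [← hN]
          exact intervalIntegral.integral_mono_interval le_rfl hx.1 hx.2
            (ae_of_all _ fun _ => abs_nonneg _) hUi.abs
      _ = _ := by ring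
  have hMle : M ≤ 1 / (‖k‖ - N) := by
    rw [le_div_iff₀ (sub_pos.2 hkN)]
    have h1 := (sine_variation hU hk hx₀).2
    have h2 : ‖k‖ * |s x₀| ≤ (1 + N * M) * Real.exp (h * x₀) := by
      have h3 : k * s x₀ = Complex.sin (k * x₀)
          + ∫ t in (0 : ℝ)..x₀, ((U t * s t : ℝ) : ℂ) * Complex.sin (k * (x₀ - t)) := by
        rw [← h1]; ring
      have h4 : ‖k‖ * |s x₀| = ‖k * s x₀‖ := by
        rw [norm_mul, Complex.norm_real, Real.norm_eq_abs]
      have h5 := (norm_cos_sin_le (k * x₀)).2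
      rw [him _ hx₀.1] at h5
      rw [h4, h3]
      refine (norm_add_le _ _).trans ?_
      have := hb x₀ hx₀ _ (fun z => (norm_cos_sin_le z).2)
      linarith
    have h6 : |s x₀| = M * Real.exp (h * x₀) := by
      rw [hM, mul_assoc, ← Real.exp_add, neg_add_cancel, Real.exp_zero, mul_one]
    rw [h6, ← mul_assoc] at h2
    have := le_of_mul_le_mul_right h2 (Real.exp_pos _)
    linarith
  have h1 : (1 : ℝ) ∈ Icc (0 : ℝ) 1 := by simp
  constructor
  · have := hu 1 h1
    rw [mul_one] at this
    refine this.trans ?_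
    rw [div_eq_mul_one_div, mul_comm]
    gcongr
  · have e := (sine_variation hU hk h1).1
    rw [Complex.ofReal_one, mul_one] at e
    rw [e]
    have := hb 1 h1 _ (fun z => (norm_cos_sin_le z).1)
    rw [mul_one] at this
    simp only [Complex.ofReal_one] at this
    refine this.trans ?_
    have h2 : N * M * Real.exp h ≤ N * (1 / (‖k‖ - N)) * Real.exp h := by gcongr
    refine h2.trans (le_of_eq ?_)
    ring

/-- An error e^{|Im k|}/4 still determines signs: |cos nπ| = 1 for k = nπ, and cosh κ ≥ e^κ/2 for k
= iκ with κ > 0. -/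
theorem discr_asymptotics (hU : MemLp U 2 μ01) (δ : ℝ) : ∃ K > 0, ∀ (E : ℝ) (k : ℂ), k ^ 2 = E →
    K ≤ ‖k‖ → ‖(discr U δ E : ℂ) - Complex.cos k‖ ≤ Real.exp |k.im| / 4 := by
  set N := ∫ t in (0 : ℝ)..1, |U t| with hN
  have hN0 : 0 ≤ N := integral_abs_nonneg U
  -- Chosen so that (N + |δ/3|)/(|k| - N) ≤ 1/4; the summand 1 keeps |k| - N positive.
  refine ⟨N + 4 * (N + |δ / 3|) + 1, by positivity, fun E k hk hK => ?_⟩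
  have hpos : 0 < ‖k‖ - N := by
    have : 0 ≤ 4 * (N + |δ / 3|) := by positivity
    linarith
  obtain ⟨h1, h2⟩ := sine_asymptotics hU hk hN.symm (sub_pos.1 hpos)
  have e : (discr U δ E : ℂ) - Complex.cos k
      = ((sine U E).2 1 - Complex.cos k) + ((δ / 3 * (sine U E).1 1 : ℝ) : ℂ) := by
    rw [discr]; push_cast; ring
  rw [e]
  refine (norm_add_le _ _).trans ?_
  rw [Complex.norm_real, Real.norm_eq_abs, abs_mul]
  have h3 := mul_le_mul_of_nonneg_left h1 (abs_nonneg (δ / 3))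
  have h4 : N * Real.exp |k.im| / (‖k‖ - N) + |δ / 3| * (Real.exp |k.im| / (‖k‖ - N))
      = Real.exp |k.im| * ((N + |δ / 3|) / (‖k‖ - N)) := by ring
  have h5 : (N + |δ / 3|) / (‖k‖ - N) ≤ 1 / 4 := by
    rw [div_le_div_iff₀ hpos four_pos]; linarith
  have h6 := mul_le_mul_of_nonneg_left h5 (Real.exp_pos |k.im|).le
  linarith

/-- `D_δ((nπ)²)` has the sign of `(-1)ⁿ` for large `n`. -/
theorem discr_sign (hU : MemLp U 2 μ01) (δ : ℝ) :
    ∃ n₀ : ℕ, ∀ n ≥ n₀, 0 < (-1) ^ n * discr U δ ((n * π) ^ 2) := by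
  obtain ⟨K, hK, h⟩ := discr_asymptotics hU δ
  obtain ⟨n₀, hn₀⟩ := exists_nat_ge K
  refine ⟨n₀, fun n hn => ?_⟩
  have hKn : K ≤ ‖((n * π : ℝ) : ℂ)‖ := by
    rw [Complex.norm_real, Real.norm_eq_abs, abs_of_nonneg (by positivity)]
    have h1 : (n₀ : ℝ) ≤ n := by exact_mod_cast hn
    have h2 : (1 : ℝ) ≤ π := by linarith [Real.pi_gt_three]
    have h3 : (n : ℝ) * 1 ≤ n * π := by gcongr
    linarith
  have h1 := h ((n * π) ^ 2) ((n * π : ℝ) : ℂ) (by push_cast; rfl) hKn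
  rw [← Complex.ofReal_cos, Real.cos_nat_mul_pi, ← Complex.ofReal_sub, Complex.norm_real,
    Complex.ofReal_im, abs_zero, Real.exp_zero, Real.norm_eq_abs, abs_le] at h1
  rcases neg_one_pow_eq_or ℝ n with hn | hn <;> rw [hn] at h1 ⊢ <;> linarith [h1.1, h1.2]

/-- `D_δ` is positive at very negative energies. -/
theorem discr_pos_of_neg (hU : MemLp U 2 μ01) (δ : ℝ) :
    ∃ K > 0, ∀ κ : ℝ, K ≤ κ → 0 < discr U δ (-κ ^ 2) := by
  obtain ⟨K, hK, h⟩ := discr_asymptotics hU δ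
  refine ⟨K, hK, fun κ hκ => ?_⟩
  have hκ0 : 0 < κ := hK.trans_le hκ
  have h1 := h (-κ ^ 2) (κ * Complex.I) (by rw [mul_pow, Complex.I_sq]; push_cast; ring)
    (by rw [norm_mul, Complex.norm_I, mul_one, Complex.norm_real]; exact hκ.trans (le_abs_self κ))
  rw [Complex.cos_mul_I, ← Complex.ofReal_cosh, ← Complex.ofReal_sub, Complex.norm_real,
    Real.norm_eq_abs, Complex.im_ofReal_mul, Complex.I_im, mul_one, abs_of_pos hκ0, abs_le,
    Real.cosh_eq] at h1
  have := Real.exp_pos κ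
  have := Real.exp_pos (-κ)
  linarith [h1.1]

/-- D_δ has opposite signs at (nπ)² and ((n+1)π)² for every large n, so the intermediate value
theorem yields zeros beyond any bound. -/
theorem centralEnergies_infinite (hU : MemLp U 2 μ01) (δN δB : ℝ) :
    (centralEnergies U δN δB).Infinite := by
  set δ := (δN + δB) / 2
  obtain ⟨n₀, hn₀⟩ := discr_sign hU δ
  refine infinite_of_not_bddAbove fun ⟨R, hR⟩ => ?_
  obtain ⟨n, hn⟩ := exists_nat_gt (max R n₀)
  have hnR : R < n := (le_max_left _ _).trans_lt hn
  have hnn : n₀ ≤ n := by exact_mod_cast ((le_max_right R (n₀ : ℝ)).trans_lt hn).le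
  have h1 := hn₀ n hnn
  have h2 := hn₀ (n + 1) (by omega)
  have hle : ((n : ℝ) * π) ^ 2 ≤ (((n + 1 : ℕ) : ℝ) * π) ^ 2 := by
    have := Real.pi_pos
    gcongr
    simp
  have hz : ∃ E ∈ Icc (((n : ℝ) * π) ^ 2) ((((n + 1 : ℕ) : ℝ) * π) ^ 2), discr U δ E = 0 := by
    have hc := (continuous_discr hU δ).continuousOn (s := Icc (((n : ℝ) * π) ^ 2) ((((n + 1 : ℕ) : ℝ) * π) ^ 2))
    rw [pow_succ] at h2
    rcases neg_one_pow_eq_or ℝ n with hn | hn <;> rw [hn] at h1 h2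
    · exact intermediate_value_Icc' hle hc ⟨by linarith, by linarith⟩
    · exact intermediate_value_Icc hle hc ⟨by linarith, by linarith⟩
  obtain ⟨E, hE, hE0⟩ := hz
  have h3 : E ≤ R := hR ((mem_centralEnergies_iff hU).2 hE0)
  have h4 : (n : ℝ) ≤ (n * π) ^ 2 := by
    have hp : (1 : ℝ) ≤ π := by linarith [Real.pi_gt_three]
    have hn1 : (n : ℝ) ≤ n * n := by exact_mod_cast Nat.le_mul_self n
    have : (n : ℝ) * n ≤ (n * π) ^ 2 := by
      rw [mul_pow, ← sq]
      exact le_mul_of_one_le_right (by positivity) (one_le_pow₀ hp)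
    linarith
  linarith [hE.1]

/-- The point sought is the least element of the compact set of points in [x, b] with f ≥ 0. -/
theorem exists_gap_right {f : ℝ → ℝ} (hf : Continuous f) {x b : ℝ} (hx : f x < 0) (hxb : x ≤ b)
    (hb : 0 ≤ f b) : ∃ y > x, f y = 0 ∧ ∀ t ∈ Ico x y, f t < 0 := by
  set S := {t | t ∈ Icc x b ∧ 0 ≤ f t} with hS
  have hSc : IsCompact S := by
    have : S = Icc x b ∩ {t | 0 ≤ f t} := by ext; simp [hS]
    rw [this]
    exact isCompact_Icc.inter_right (isClosed_le continuous_const hf)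
  have hne : S.Nonempty := ⟨b, ⟨hxb, le_rfl⟩, hb⟩
  have hmem := hSc.sInf_mem hne
  set y := sInf S
  have hxy : x < y := lt_of_le_of_ne hmem.1.1 fun h => by
    rw [← h] at hmem; exact absurd hmem.2 (not_le.2 hx)
  have hlt : ∀ t ∈ Ico x y, f t < 0 := fun t ht => by
    by_contra! hc
    exact absurd (csInf_le hSc.bddBelow ⟨⟨ht.1, ht.2.le.trans hmem.1.2⟩, hc⟩) (not_le.2 ht.2)
  refine ⟨y, hxy, le_antisymm ?_ hmem.2, hlt⟩
  have hcl : y ∈ closure (Ico x y) := by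
    rw [closure_Ico hxy.ne]; exact ⟨hxy.le, le_rfl⟩
  exact closure_minimal (fun t ht => (hlt t ht).le) (isClosed_le hf continuous_const) hcl

/-- The gap: around a zero of `D_{(δN + δB)/2}` the product `D_{δN} D_{δB}` is negative, up to its
nearest zeros. -/
theorem exists_gap (hU : MemLp U 2 μ01) {δN δB : ℝ} (hδ : δN ≠ δB) {E₀ : ℝ}
    (hE₀ : E₀ ∈ centralEnergies U δN δB) : ∃ E₁ E₂ : ℝ, E₁ < E₀ ∧ E₀ < E₂ ∧
      (∀ E ∈ Ioo E₁ E₂, discr U δN E * discr U δB E < 0) ∧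
      discr U δN E₁ * discr U δB E₁ = 0 ∧ discr U δN E₂ * discr U δB E₂ = 0 := by
  have hc : Continuous fun E => discr U δN E * discr U δB E :=
    (continuous_discr hU δN).mul (continuous_discr hU δB)
  -- The two discriminants average to zero at E₀, so they are ±(δN - δB)s(1)/6 and their product is
  -- minus a nonzero square.
  have h0 : discr U δN E₀ * discr U δB E₀ < 0 := by
    have hs := sine_ne_zero hU hE₀.1
    have h1 := (mem_centralEnergies_iff hU).1 hE₀
    have e1 : discr U δN E₀ = (δN - δB) / 6 * (sine U E₀).1 1 := by
      rw [discr] at h1 ⊢; linarith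
    have e2 : discr U δB E₀ = -((δN - δB) / 6 * (sine U E₀).1 1) := by
      rw [discr] at h1 ⊢; linarith
    have : 0 < ((δN - δB) / 6 * (sine U E₀).1 1) ^ 2 :=
      sq_pos_of_ne_zero (mul_ne_zero (div_ne_zero (sub_ne_zero.2 hδ) (by norm_num)) hs)
    rw [e1, e2]
    linarith
  obtain ⟨nN, hnN⟩ := discr_sign hU δN
  obtain ⟨nB, hnB⟩ := discr_sign hU δB
  obtain ⟨KN, hKN, hN⟩ := discr_pos_of_neg hU δN
  obtain ⟨KB, hKB, hB⟩ := discr_pos_of_neg hU δB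
  -- At (nπ)² with n large both discriminants have the sign of (-1)ⁿ; for `hleft`, both are positive
  -- at -κ² with κ large.
  have hright : ∃ b, E₀ ≤ b ∧ 0 ≤ discr U δN b * discr U δB b := by
    obtain ⟨m, hm⟩ := exists_nat_ge E₀
    set n := m + nN + nB + 1
    refine ⟨(n * π) ^ 2, ?_, ?_⟩
    · have hp : (1 : ℝ) ≤ π := by linarith [Real.pi_gt_three]
      have h1 : (m : ℝ) ≤ n := by simp only [n]; exact_mod_cast by omega
      have h2 : (n : ℝ) ≤ n * n := by exact_mod_cast Nat.le_mul_self n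
      have : (n : ℝ) * n ≤ (n * π) ^ 2 := by
        rw [mul_pow, ← sq]
        exact le_mul_of_one_le_right (by positivity) (one_le_pow₀ hp)
      linarith
    · have h1 := hnN n (by omega)
      have h2 := hnB n (by omega)
      rcases neg_one_pow_eq_or ℝ n with hn | hn <;> rw [hn] at h1 h2 <;> nlinarith
  have hleft : ∃ a, a ≤ E₀ ∧ 0 ≤ discr U δN a * discr U δB a := by
    set κ := max (max KN KB) (|E₀| + 1)
    refine ⟨-κ ^ 2, ?_, ?_⟩
    · have h1 : |E₀| + 1 ≤ κ := le_max_right _ _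
      have := neg_abs_le E₀
      nlinarith [abs_nonneg E₀]
    · exact (mul_pos (hN κ ((le_max_left _ _).trans (le_max_left _ _)))
        (hB κ ((le_max_right _ _).trans (le_max_left _ _)))).le
  obtain ⟨b, hb, hb'⟩ := hright
  obtain ⟨a, ha, ha'⟩ := hleft
  obtain ⟨E₂, h2, h2z, h2n⟩ := exists_gap_right hc h0 hb hb'
  -- The left end point is the right end point of the reflected function, hence the witness -y.
  obtain ⟨y, hy, hyz, hyn⟩ := exists_gap_right (f := fun x => discr U δN (-x) * discr U δB (-x))
    (hc.comp continuous_neg) (x := -E₀) (b := -a) (by simpa using h0) (by linarith) (by simpa using ha')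
  refine ⟨-y, E₂, by linarith, h2, fun E hE => ?_, hyz, h2z⟩
  rcases le_total E₀ E with h | h
  · exact h2n E ⟨h, hE.2⟩
  · simpa using hyn (-E) ⟨by linarith, by linarith [hE.1]⟩

end Asymptotics

/-! ### Phases and gauge transformations -/

theorem phase_zero : phase 0 = 1 := by simp [phase]

theorem phase_add (x y : ℝ) : phase (x + y) = phase x * phase y := by
  rw [phase, phase, phase, ← Complex.exp_add]; push_cast; ring_nf

theorem phase_neg_mul (x : ℝ) : phase (-x) * phase x = 1 := by
  rw [← phase_add, neg_add_cancel, phase_zero]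

theorem phase_mul_neg (x : ℝ) : phase x * phase (-x) = 1 := by
  rw [← phase_add, add_neg_cancel, phase_zero]

theorem phase_ne_zero (x : ℝ) : phase x ≠ 0 := Complex.exp_ne_zero _

theorem norm_phase (x : ℝ) : ‖phase x‖ = 1 := by
  rw [phase, mul_comm, Complex.norm_exp_ofReal_mul_I]

theorem conj_phase (x : ℝ) : (starRingEnd ℂ) (phase x) = phase (-x) := by
  rw [phase, phase, ← Complex.exp_conj]; simp

theorem phase_int_mul_two_pi (n : ℤ) : phase (n * (2 * π)) = 1 := by
  rw [phase, Complex.exp_eq_one_iff]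
  exact ⟨n, by push_cast; ring⟩

theorem phase_pi : phase π = -1 := by
  rw [phase, mul_comm, Complex.exp_pi_mul_I]

theorem phase_eq (x : ℝ) : phase x = Real.cos x + Real.sin x * Complex.I := by
  rw [phase, mul_comm, Complex.exp_mul_I, Complex.ofReal_cos, Complex.ofReal_sin]

theorem exists_int_primitive (f : ℤ → ℝ) : ∃ S : ℤ → ℝ, ∀ n, S n - S (n - 1) = f n := by
  refine ⟨fun n => ∑ i ∈ Finset.Ioc 0 n, f i - ∑ i ∈ Finset.Ioc n 0, f i, fun n => ?_⟩
  dsimp only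
  rcases le_or_gt n 0 with h | h
  · have e1 : Finset.Ioc (0 : ℤ) n = ∅ := Finset.Ioc_eq_empty (by omega)
    have e2 : Finset.Ioc (0 : ℤ) (n - 1) = ∅ := Finset.Ioc_eq_empty (by omega)
    have e3 : Finset.Ioc (n - 1) 0 = insert n (Finset.Ioc n 0) := by
      ext i; simp only [Finset.mem_Ioc, Finset.mem_insert]; omega
    rw [e1, e2, e3, Finset.sum_insert (by simp)]
    simp
  · have e1 : Finset.Ioc n 0 = ∅ := Finset.Ioc_eq_empty (by omega)
    have e2 : Finset.Ioc (n - 1) 0 = ∅ := Finset.Ioc_eq_empty (by omega)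
    have e3 : Finset.Ioc 0 n = insert n (Finset.Ioc 0 (n - 1)) := by
      ext i; simp only [Finset.mem_Ioc, Finset.mem_insert]; omega
    rw [e1, e2, e3, Finset.sum_insert (by simp)]
    simp

/-- A closed discrete one-form on `ℤ²` is exact. -/
theorem exists_int_potential (P Q : ℤ → ℤ → ℝ)
    (h : ∀ m n, P m n - P m (n - 1) = Q m n - Q (m - 1) n) :
    ∃ S : ℤ → ℤ → ℝ, ∀ m n, S m n - S (m - 1) n = P m n ∧ S m n - S m (n - 1) = Q m n := by
  obtain ⟨A, hA⟩ := exists_int_primitive fun m => P m 0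
  choose B hB using fun m => exists_int_primitive (Q m)
  -- Sum P along the row n = 0, then Q along columns. Closedness carries the identity for P from row
  -- 0 to all rows.
  let S : ℤ → ℤ → ℝ := fun m n => A m + B m n - B m 0
  have hQ : ∀ m n, S m n - S m (n - 1) = Q m n := fun m n => by
    simp only [S]; linarith [hB m n]
  refine ⟨S, fun m n => ⟨?_, hQ m n⟩⟩
  have hstep : ∀ n, S m n - S (m - 1) n - P m n = S m (n - 1) - S (m - 1) (n - 1) - P m (n - 1) :=
    fun n => by linarith [hQ m n, hQ (m - 1) n, h m n]
  have hz : ∀ n, S m n - S (m - 1) n - P m n = 0 := by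
    intro n
    induction n using Int.induction_on with
    | zero => simp only [S]; linarith [hA m]
    | succ i ih => rw [hstep, add_sub_cancel_right]; exact ih
    | pred i ih => rw [← hstep]; exact ih
  linarith [hz n]

/-- Two magnetic potentials with the same flux differ by a gauge transformation. -/
theorem exists_gauge {β : Edge → ℝ} {φ : ℝ} (h : HasConstantFlux β φ) :
    ∃ χ : Vertex → ℝ, ∀ e, β e = landau φ e + χ (term e) - χ (init e) := by
  set b : Edge → ℝ := fun e => β e - landau φ e with hb
  -- S will be χ on the N vertices. The f edges force χ(B,γ) = S(γ) + b_f(γ); the g and h edges then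
  -- prescribe the two differences of S, compatible because b = β - landau has zero flux.
  obtain ⟨S, hS⟩ := exists_int_potential (fun m n => b (0, (m - 1, n)) - b (1, (m, n)))
    (fun m n => b (0, (m, n - 1)) - b (2, (m, n))) (fun m n => by
      have := h (m - 1) (n - 1)
      have := h m (n - 1)
      simp only [hb, landau, Fin.isValue, Fin.reduceEq, if_true, if_false, sub_add_cancel] at this ⊢
      push_cast
      linarith)
  refine ⟨fun x => match x with
    | (Atom.N, γ) => S γ.1 γ.2
    | (Atom.B, γ) => S γ.1 γ.2 + b (0, γ), fun e => ?_⟩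
  have hbe : ∀ e, β e = landau φ e + b e := fun e => by simp [hb]
  obtain ⟨j, m, n⟩ := e
  rw [hbe]
  fin_cases j
  · simp [term, init, shift]
    ring
  · have := (hS m n).1
    simp only [term, init, shift, Fin.isValue, Fin.mk_one, Matrix.cons_val_one, Matrix.cons_val_zero,
      Prod.mk_sub_mk, sub_zero]
    linarith
  · have := (hS m n).2
    simp only [term, init, shift, Fin.isValue, Fin.reduceFinMk, Matrix.cons_val,
      Prod.mk_sub_mk, sub_zero]
    linarith

theorem term_zero (γ : ℤ × ℤ) : term (0, γ) = (Atom.B, γ) := by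
  simp [term, shift, ← Prod.zero_eq_mk]

/-! ### Reduction to a discrete equation -/

/-- The vertex conditions of solutions with prescribed boundary derivatives in terms of the vertex
values; `r₀` and `r₁` are the contributions of the sources on the edges. -/
theorem kirchhoff_iff {β : Edge → ℝ} {δN δB σ η : ℝ} (hσ : σ ≠ 0) {u v : Edge → ℝ → ℂ}
    {V : Vertex → ℂ} {r₀ r₁ : Edge → ℂ} (hi : ∀ e, u e 0 = V (init e))
    (ht : ∀ e, phase (β e) * u e 1 = V (term e))
    (h₀ : ∀ e, (σ : ℂ) * v e 0 = u e 1 - η * u e 0 + r₀ e)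
    (h₁ : ∀ e, (σ : ℂ) * v e 1 = η * u e 1 - u e 0 - r₁ e) :
    ((∀ γ : ℤ × ℤ, ∑ j : Fin 3, v (j, γ) 0
        = (robin δN δB (Atom.N, γ) : ℂ) * V (Atom.N, γ)) ∧
      (∀ γ : ℤ × ℤ, -∑ j : Fin 3, phase (β (j, γ + shift j)) * v (j, γ + shift j) 1
        = (robin δN δB (Atom.B, γ) : ℂ) * V (Atom.B, γ))) ↔
    ((∀ γ : ℤ × ℤ, ∑ j : Fin 3, phase (-β (j, γ)) * V (Atom.B, γ - shift j)
        + ∑ j : Fin 3, r₀ (j, γ) = (3 * η + δN * σ : ℝ) * V (Atom.N, γ)) ∧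
      (∀ γ : ℤ × ℤ, ∑ j : Fin 3, phase (β (j, γ + shift j)) * V (Atom.N, γ + shift j)
        + ∑ j : Fin 3, phase (β (j, γ + shift j)) * r₁ (j, γ + shift j)
        = (3 * η + δB * σ : ℝ) * V (Atom.B, γ))) := by
  have hσ' : (σ : ℂ) ≠ 0 := by exact_mod_cast hσ
  have hu1 : ∀ e, u e 1 = phase (-β e) * V (term e) := fun e => by
    rw [← ht, ← mul_assoc, phase_neg_mul, one_mul]
  refine and_congr (forall_congr' fun γ => ?_) (forall_congr' fun γ => ?_)
  · rw [← mul_right_inj' hσ', Finset.mul_sum]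
    have : ∑ j : Fin 3, (σ : ℂ) * v (j, γ) 0 = ∑ j : Fin 3, phase (-β (j, γ)) * V (Atom.B, γ - shift j)
        + ∑ j : Fin 3, r₀ (j, γ) - 3 * η * V (Atom.N, γ) := by
      rw [← Finset.sum_add_distrib]
      simp only [h₀, hu1, hi, init, term, Fin.sum_univ_three]
      ring
    rw [this, sub_eq_iff_eq_add]
    simp only [robin]
    push_cast
    refine Eq.congr_right ?_
    ring
  · rw [← mul_right_inj' hσ', mul_neg, Finset.mul_sum]
    have h2 : ∀ j : Fin 3, (σ : ℂ) * (phase (β (j, γ + shift j)) * v (j, γ + shift j) 1)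
        = η * V (Atom.B, γ) - phase (β (j, γ + shift j)) * V (Atom.N, γ + shift j)
          - phase (β (j, γ + shift j)) * r₁ (j, γ + shift j) := fun j => by
      have h3 := ht (j, γ + shift j)
      have h4 := hi (j, γ + shift j)
      simp only [term, init, add_sub_cancel_right] at h3 h4
      rw [← h3, ← h4]
      linear_combination phase (β (j, γ + shift j)) * h₁ (j, γ + shift j)
    simp only [h2, Fin.sum_univ_three, robin]
    push_cast
    constructor <;> intro h <;> linear_combination h

/-- The discrete eigenvalue equation for the vertex values. -/
def DiscreteEq (β : Edge → ℝ) (a b : ℝ) (V : Vertex → ℂ) : Prop :=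
  (∀ γ : ℤ × ℤ, ∑ j : Fin 3, phase (-β (j, γ)) * V (Atom.B, γ - shift j) = a * V (Atom.N, γ)) ∧
  (∀ γ : ℤ × ℤ, ∑ j : Fin 3, phase (β (j, γ + shift j)) * V (Atom.N, γ + shift j)
    = b * V (Atom.B, γ))

theorem DiscreteEq.gauge {β β' : Edge → ℝ} {a b : ℝ} {V : Vertex → ℂ} {χ : Vertex → ℝ}
    (h : DiscreteEq β a b V) (hβ : ∀ e, β e = β' e + χ (term e) - χ (init e)) :
    DiscreteEq β' a b fun x => phase (-χ x) * V x := by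
  refine ⟨fun γ => ?_, fun γ => ?_⟩
  · rw [mul_left_comm, ← h.1 γ, Finset.mul_sum]
    refine Finset.sum_congr rfl fun j _ => ?_
    rw [← mul_assoc, ← mul_assoc, ← phase_add, ← phase_add, hβ]
    congr 2
    simp only [term, init]
    ring
  · rw [mul_left_comm, ← h.2 γ, Finset.mul_sum]
    refine Finset.sum_congr rfl fun j _ => ?_
    rw [← mul_assoc, ← mul_assoc, ← phase_add, ← phase_add, hβ]
    congr 2
    simp only [term, init, add_sub_cancel_right]
    ring

/-- Floquet conditions for functions on the vertices. -/
def QuasiPeriodic (q : ℕ) (θ : ℝ × ℝ) (W : Vertex → ℂ) : Prop :=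
  ∀ (x : Atom) (γ : ℤ × ℤ), W (x, γ + ((q : ℤ), 0)) = phase θ.1 * W (x, γ) ∧
    W (x, γ + (0, 1)) = phase θ.2 * W (x, γ)

theorem QuasiPeriodic.apply {q : ℕ} {θ : ℝ × ℝ} {W : Vertex → ℂ} (h : QuasiPeriodic q θ W)
    (x : Atom) (m n k l : ℤ) :
    W (x, (m + q * k, n + l)) = phase (k * θ.1 + l * θ.2) * W (x, (m, n)) := by
  have h1 : ∀ (n k : ℤ), W (x, (m + q * k, n)) = phase (k * θ.1) * W (x, (m, n)) := by
    intro n k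
    induction k using Int.induction_on with
    | zero => simp [phase_zero]
    | succ i ih =>
      have := (h x (m + q * i, n)).1
      simp only [Prod.mk_add_mk, add_zero] at this
      rw [mul_add, mul_one, ← add_assoc, this, ih, ← mul_assoc, ← phase_add]
      congr 2
      push_cast
      ring
    | pred i ih =>
      have := (h x (m + q * (-i - 1), n)).1
      simp only [Prod.mk_add_mk, add_zero] at this
      have e : m + (q : ℤ) * (-i - 1) + q = m + q * -i := by ring
      rw [e, ih] at this
      have h2 : phase (-θ.1) * (phase ((-(i : ℤ) : ℤ) * θ.1) * W (x, (m, n)))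
          = W (x, (m + q * (-i - 1), n)) := by
        rw [this, ← mul_assoc, phase_neg_mul, one_mul]
      rw [← h2, ← mul_assoc, ← phase_add]
      congr 2
      push_cast
      ring
  induction l using Int.induction_on with
  | zero => simp [h1]
  | succ i ih =>
    have := (h x (m + q * k, n + i)).2
    simp only [Prod.mk_add_mk, add_zero] at this
    rw [← add_assoc, this, ih, ← mul_assoc, ← phase_add]
    congr 2
    push_cast
    ring
  | pred i ih =>
    have := (h x (m + q * k, n + (-i - 1))).2
    simp only [Prod.mk_add_mk, add_zero] at this
    have e : n + (-(i : ℤ) - 1) + 1 = n + -i := by ring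
    rw [e, ih] at this
    have h2 : phase (-θ.2) * (phase (k * θ.1 + (-(i : ℤ) : ℤ) * θ.2) * W (x, (m, n)))
        = W (x, (m + q * k, n + (-i - 1))) := by
      rw [this, ← mul_assoc, phase_neg_mul, one_mul]
    rw [← h2, ← mul_assoc, ← phase_add]
    congr 2
    push_cast
    ring

theorem smul_edgeSol (U : ℝ → ℝ) (E : ℝ) (c A Z : ℂ) (x : ℝ) :
    c * edgeSol U E A Z x = edgeSol U E (c * A) (c * Z) x := by
  simp only [edgeSol]; ring

theorem three_discr (U : ℝ → ℝ) (δ E : ℝ) :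
    3 * (sine U E).2 1 + δ * (sine U E).1 1 = 3 * discr U δ E := by
  rw [discr]; ring

section Reduction

variable {U : ℝ → ℝ} {β : Edge → ℝ} {δN δB E : ℝ}

/-- The source-free case of `kirchhoff_iff`: each vertex has three edges, so the diagonal term is
3s'(1) + δs(1) = 3D_δ. -/
theorem VertexConditions.discreteEq (hU : MemLp U 2 μ01)
    (hUeven : ∀ᵐ x ∂μ01, U x = U (1 - x)) (hE : E ∉ dirichletSpectrum U) {u v : Edge → ℝ → ℂ}
    (hsol : ∀ e, IsEdgeSolution U E (u e) (v e)) {V : Vertex → ℂ}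
    (hi : ∀ e, u e 0 = V (init e)) (ht : ∀ e, phase (β e) * u e 1 = V (term e)) :
    ((∀ γ : ℤ × ℤ, ∑ j : Fin 3, v (j, γ) 0
        = (robin δN δB (Atom.N, γ) : ℂ) * V (Atom.N, γ)) ∧
      (∀ γ : ℤ × ℤ, -∑ j : Fin 3, phase (β (j, γ + shift j)) * v (j, γ + shift j) 1
        = (robin δN δB (Atom.B, γ) : ℂ) * V (Atom.B, γ))) ↔
      DiscreteEq β (3 * discr U δN E) (3 * discr U δB E) V := by
  rw [kirchhoff_iff (sine_ne_zero hU hE) (r₀ := 0) (r₁ := 0) (η := (sine U E).2 1) hi ht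
    (fun e => by rw [(hsol e).deriv_zero hU hUeven]; simp)
    (fun e => by rw [(hsol e).deriv_one hU]; simp)]
  simp only [Pi.zero_apply, mul_zero, Finset.sum_const_zero, add_zero, three_discr, DiscreteEq]

/-- The dispersion relation in terms of the discrete equation in the Landau gauge. -/
theorem mem_dispersion_iff (hU : MemLp U 2 μ01) (hUeven : ∀ᵐ x ∂μ01, U x = U (1 - x))
    (hE : E ∉ dirichletSpectrum U) {φ : ℝ} {q : ℕ} (hq : q * φ = 2 * π) (θ : ℝ × ℝ) :
    (θ, E) ∈ dispersion U β δN δB φ q ↔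
      (∃ χ : Vertex → ℝ, ∀ e, β e = landau φ e + χ (term e) - χ (init e)) ∧
      ∃ W : Vertex → ℂ, W ≠ 0 ∧ QuasiPeriodic q θ W ∧
        DiscreteEq (landau φ) (3 * discr U δN E) (3 * discr U δB E) W := by
  constructor
  · rintro ⟨χ, hχ, u, v, ⟨e₀, x₀, hx₀, hne⟩, hsol, ⟨V, hi, ht, hK⟩, hF1, hF2⟩
    refine ⟨⟨χ, hχ⟩, fun x => phase (-χ x) * V x, ?_, ?_, ?_⟩
    · intro h0
      have hV : ∀ x, V x = 0 := fun x =>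
        (mul_eq_zero.1 (congrFun h0 x)).resolve_left (phase_ne_zero _)
      have h1 : u e₀ 1 = 0 := by
        have := ht e₀
        rw [hV] at this
        exact (mul_eq_zero.1 this).resolve_left (phase_ne_zero _)
      refine hne ?_
      rw [(hsol e₀).eq_edgeSol hU hUeven hE hx₀, hi, hV, h1]
      simp [edgeSol]
    · have hN : ∀ γ, phase (-χ (Atom.N, γ)) * V (Atom.N, γ)
          = phase (-χ (init (0, γ))) * u (0, γ) 0 := fun γ => by rw [hi]; rfl
      -- The B value is read off the f edge of the same cell: its Landau potential vanishes, so the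
      -- Floquet conditions pass to the vertex without an extra phase.
      have hB : ∀ γ, phase (-χ (Atom.B, γ)) * V (Atom.B, γ)
          = phase (-χ (init (0, γ))) * u (0, γ) 1 := fun γ => by
        have h1 := term_zero γ
        have h2 := ht (0, γ)
        have h3 := hχ (0, γ)
        rw [h1] at h2 h3
        rw [← h2, ← mul_assoc, ← phase_add, h3]
        congr 2
        simp [landau]
        ring
      have t0 : (0 : ℝ) ∈ Icc (0 : ℝ) 1 := by simp
      have t1 : (1 : ℝ) ∈ Icc (0 : ℝ) 1 := by simp
      intro x γ
      cases x
      · simp only [hN]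
        exact ⟨hF1 (0, γ) 0 t0, hF2 (0, γ) 0 t0⟩
      · simp only [hB]
        exact ⟨hF1 (0, γ) 1 t1, hF2 (0, γ) 1 t1⟩
    · exact ((VertexConditions.discreteEq hU hUeven hE hsol hi ht).1 hK).gauge hχ
  · rintro ⟨⟨χ, hχ⟩, W, hW, hQ, hD⟩
    refine ⟨χ, hχ, ?_⟩
    set V : Vertex → ℂ := fun x => phase (χ x) * W x with hV
    have hVD : DiscreteEq β (3 * discr U δN E) (3 * discr U δB E) V := by
      have := hD.gauge (β' := β) (χ := -χ) (fun e => by rw [hχ]; simp; ring)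
      simpa [hV] using this
    set u : Edge → ℝ → ℂ := fun e => edgeSol U E (V (init e)) (phase (-β e) * V (term e)) with hu
    set v : Edge → ℝ → ℂ := fun e => edgeSolDeriv U E (V (init e)) (phase (-β e) * V (term e))
    have hsol : ∀ e, IsEdgeSolution U E (u e) (v e) := fun e =>
      isEdgeSolution_edgeSol hU hUeven E _ _
    have hi : ∀ e, u e 0 = V (init e) := fun e => edgeSol_zero hU hE _ _
    have ht : ∀ e, phase (β e) * u e 1 = V (term e) := fun e => by
      rw [hu]
      dsimp only
      rw [edgeSol_one hU hE, ← mul_assoc, phase_mul_neg, one_mul]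
    have hux : ∀ e x, phase (-χ (init e)) * u e x
        = edgeSol U E (W (init e)) (phase (-landau φ e) * W (term e)) x := by
      intro e x
      rw [hu]
      dsimp only
      rw [smul_edgeSol, hV]
      dsimp only
      rw [← mul_assoc, phase_neg_mul, one_mul, ← mul_assoc, ← mul_assoc, ← phase_add, ← phase_add, hχ]
      congr 3
      ring
    -- Here qφ = 2π enters: the Landau phases become periodic under translation by q cells.
    have hper : ∀ e : Edge, phase (-landau φ (translate (q, 0) e)) = phase (-landau φ e) := by
      rintro ⟨j, m, n⟩
      by_cases hj : j = 2
      · have : -landau φ (translate (q, 0) (j, m, n)) = -landau φ (j, m, n) + (1 : ℤ) * (2 * π) := by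
          simp [landau, translate, hj, ← hq]
          ring
        rw [this, phase_add, phase_int_mul_two_pi, mul_one]
      · simp [landau, translate, hj]
    have hper' : ∀ e : Edge, landau φ (translate (0, 1) e) = landau φ e := by
      rintro ⟨j, γ⟩
      simp [landau, translate]
    refine ⟨u, v, ?_, hsol, ⟨V, hi, ht, (VertexConditions.discreteEq hU hUeven hE hsol hi ht).2 hVD⟩,
      fun e x _ => ?_, fun e x _ => ?_⟩
    · obtain ⟨⟨x, γ⟩, hx⟩ := Function.ne_iff.1 hW
      have hVx : V (x, γ) ≠ 0 := mul_ne_zero (phase_ne_zero _) hx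
      cases x
      · exact ⟨(0, γ), 0, by simp, by rw [hi]; exact hVx⟩
      · refine ⟨(0, γ), 1, by simp, fun h => hVx ?_⟩
        have := ht (0, γ)
        rw [h, mul_zero] at this
        rw [this, term_zero]
    · have h1 : W (init (translate ((q : ℤ), 0) e)) = phase θ.1 * W (init e) := (hQ Atom.N e.2).1
      have h2 : W (term (translate ((q : ℤ), 0) e)) = phase θ.1 * W (term e) := by
        have := (hQ Atom.B (e.2 - shift e.1)).1
        rwa [← add_sub_right_comm] at this
      rw [hux, hux, smul_edgeSol, hper, mul_left_comm, h1, h2]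
    · have h1 : W (init (translate (0, 1) e)) = phase θ.2 * W (init e) := (hQ Atom.N e.2).2
      have h2 : W (term (translate (0, 1) e)) = phase θ.2 * W (term e) := by
        have := (hQ Atom.B (e.2 - shift e.1)).2
        rwa [← add_sub_right_comm] at this
      rw [hux, hux, smul_edgeSol, hper', mul_left_comm, h1, h2]

end Reduction

/-! ### The Floquet fibres for one and two flux quanta per cell -/

/-- Eliminating one unknown shows that each is multiplied by both ab and |p|². Conversely (b, p) is
a solution when b ≠ 0; when b = 0 the symbol p vanishes and (0, 1) works. -/
theorem one_system_iff (a b : ℝ) (p : ℂ) :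
    (∃ x y : ℂ, (x ≠ 0 ∨ y ≠ 0) ∧ (starRingEnd ℂ) p * y = a * x ∧ p * x = b * y) ↔
      a * b = Complex.normSq p := by
  have hp : (starRingEnd ℂ) p * p = (Complex.normSq p : ℂ) := by
    rw [mul_comm, Complex.mul_conj]
  constructor
  · rintro ⟨x, y, hne, h1, h2⟩
    have hx : ((a * b : ℝ) : ℂ) * x = (Complex.normSq p : ℂ) * x := by
      rw [← hp]; push_cast
      linear_combination (-(b : ℂ)) * h1 - (starRingEnd ℂ) p * h2
    have hy : ((a * b : ℝ) : ℂ) * y = (Complex.normSq p : ℂ) * y := by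
      rw [← hp]; push_cast
      linear_combination (-p) * h1 - (a : ℂ) * h2
    rcases hne with h | h
    · exact_mod_cast mul_right_cancel₀ h hx
    · exact_mod_cast mul_right_cancel₀ h hy
  · intro h
    rcases eq_or_ne b 0 with hb | hb
    · have : p = 0 := by rw [← Complex.normSq_eq_zero, ← h, hb, mul_zero]
      exact ⟨0, 1, by simp, by simp [this], by simp [hb]⟩
    · refine ⟨b, p, Or.inl (by exact_mod_cast hb), ?_, by ring⟩
      rw [hp, ← h]; push_cast; ring

theorem exists_kernel_two {p q r s : ℂ} (h : p * s - q * r = 0) :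
    ∃ x y : ℂ, (x ≠ 0 ∨ y ≠ 0) ∧ p * x + q * y = 0 ∧ r * x + s * y = 0 := by
  by_cases h1 : p = 0 ∧ q = 0
  · by_cases h2 : r = 0 ∧ s = 0
    · exact ⟨1, 0, by simp, by simp [h1], by simp [h2]⟩
    · refine ⟨s, -r, ?_, by simp [h1], by ring⟩
      by_contra! hc
      exact h2 ⟨neg_eq_zero.1 hc.2, hc.1⟩
  · refine ⟨q, -p, ?_, by ring, by linear_combination -h⟩
    by_contra! hc
    exact h1 ⟨neg_eq_zero.1 hc.2, hc.1⟩

theorem det_eq_zero_two {p q r s x y : ℂ} (hne : x ≠ 0 ∨ y ≠ 0) (h1 : p * x + q * y = 0)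
    (h2 : r * x + s * y = 0) : p * s - q * r = 0 := by
  rcases hne with h | h <;> refine mul_right_cancel₀ h ?_
  · linear_combination s * h1 - q * h2
  · linear_combination p * h2 - r * h1

/-- The matrix M acting on the n's and the one acting on the b's are adjoint. Elimination turns the
system into det(M*M - ab) = 0, where M*M has trace 6 and determinant |1 - z₂² - z₁|². If the n's
vanish, they are eliminated instead, which gives MM* and the same polynomial. -/
theorem two_system_iff (a b : ℝ) {z₁ w₁ z₂ w₂ : ℂ} (h1 : z₁ * w₁ = 1) (h2 : z₂ * w₂ = 1)
    (hw₁ : (starRingEnd ℂ) z₁ = w₁) (hw₂ : (starRingEnd ℂ) z₂ = w₂) :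
    (∃ n₀ n₁ b₀ b₁ : ℂ, (n₀ ≠ 0 ∨ n₁ ≠ 0 ∨ b₀ ≠ 0 ∨ b₁ ≠ 0) ∧
      (1 + w₂) * b₀ + w₁ * b₁ = a * n₀ ∧ b₀ + (1 - w₂) * b₁ = a * n₁ ∧
      (1 + z₂) * n₀ + n₁ = b * b₀ ∧ z₁ * n₀ + (1 - z₂) * n₁ = b * b₁) ↔
    ((a : ℂ) * b) ^ 2 - 6 * (a * b) + (1 - z₂ ^ 2 - z₁) * (1 - w₂ ^ 2 - w₁) = 0 := by
  constructor
  · rintro ⟨n₀, n₁, b₀, b₁, hne, e1, e2, e3, e4⟩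
    by_cases hn : n₀ ≠ 0 ∨ n₁ ≠ 0
    · have := det_eq_zero_two hn
        (p := (1 + w₂) * (1 + z₂) + w₁ * z₁ - a * b) (q := (1 + w₂) + w₁ * (1 - z₂))
        (r := (1 + z₂) + (1 - w₂) * z₁) (s := 1 + (1 - w₂) * (1 - z₂) - a * b)
        (by linear_combination b * e1 + (1 + w₂) * e3 + w₁ * e4)
        (by linear_combination b * e2 + e3 + (1 - w₂) * e4)
      linear_combination this + a * b * (h1 + 2 * h2)
    · have hb : b₀ ≠ 0 ∨ b₁ ≠ 0 := by tauto
      have := det_eq_zero_two hb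
        (p := (1 + z₂) * (1 + w₂) + 1 - a * b) (q := (1 + z₂) * w₁ + (1 - w₂))
        (r := z₁ * (1 + w₂) + (1 - z₂)) (s := z₁ * w₁ + (1 - z₂) * (1 - w₂) - a * b)
        (by linear_combination (1 + z₂) * e1 + e2 + a * e3)
        (by linear_combination z₁ * e1 + (1 - z₂) * e2 + a * e4)
      linear_combination this + a * b * (h1 + 2 * h2)
  · intro h
    rcases eq_or_ne b 0 with hb | hb
    -- With b = 0 one cannot solve for the b's. The constant term vanishes, both conjugate factors
    -- are zero, and a kernel vector of M* with n₀ = n₁ = 0 is used.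
    · have hd : (1 - z₂ ^ 2 - z₁) * (1 - w₂ ^ 2 - w₁) = 0 := by
        simpa [hb] using h
      have hc : (starRingEnd ℂ) (1 - z₂ ^ 2 - z₁) = 1 - w₂ ^ 2 - w₁ := by
        simp [hw₁, hw₂]
      have hd' : 1 - w₂ ^ 2 - w₁ = 0 := by
        rcases mul_eq_zero.1 hd with h0 | h0
        · rw [← hc, h0, map_zero]
        · exact h0
      obtain ⟨x, y, hne, e1, e2⟩ := exists_kernel_two (p := 1 + w₂) (q := w₁) (r := 1)
        (s := 1 - w₂) (by linear_combination hd')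
      refine ⟨0, 0, x, y, by tauto, ?_, ?_, ?_, ?_⟩
      · linear_combination e1
      · linear_combination e2
      · simp [hb]
      · simp [hb]
    · have hb' : (b : ℂ) ≠ 0 := by exact_mod_cast hb
      obtain ⟨x, y, hne, e1, e2⟩ := exists_kernel_two
        (p := (1 + w₂) * (1 + z₂) + w₁ * z₁ - a * b) (q := (1 + w₂) + w₁ * (1 - z₂))
        (r := (1 + z₂) + (1 - w₂) * z₁) (s := 1 + (1 - w₂) * (1 - z₂) - a * b)
        (by linear_combination h - a * b * (h1 + 2 * h2))
      refine ⟨x, y, ((1 + z₂) * x + y) / b, (z₁ * x + (1 - z₂) * y) / b, by tauto, ?_, ?_, ?_, ?_⟩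
      · field_simp
        linear_combination e1
      · field_simp
        linear_combination e2
      · field_simp
      · field_simp

theorem phase_landau_two_pi (e : Edge) : phase (landau (2 * π) e) = 1 := by
  rw [landau]
  split_ifs
  · have : -(e.2.1 : ℝ) * (2 * π) = ((-e.2.1 : ℤ) : ℝ) * (2 * π) := by push_cast; ring
    rw [this, phase_int_mul_two_pi]
  · exact phase_zero

theorem phase_neg_landau_two_pi (e : Edge) : phase (-landau (2 * π) e) = 1 := by
  have := phase_neg_mul (landau (2 * π) e)
  rwa [phase_landau_two_pi, mul_one] at this

theorem sum_N (β : Edge → ℝ) (V : Vertex → ℂ) (m n : ℤ) :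
    ∑ j : Fin 3, phase (-β (j, (m, n))) * V (Atom.B, (m, n) - shift j)
      = phase (-β (0, (m, n))) * V (Atom.B, (m, n))
        + phase (-β (1, (m, n))) * V (Atom.B, (m - 1, n))
        + phase (-β (2, (m, n))) * V (Atom.B, (m, n - 1)) := by
  simp [Fin.sum_univ_three, shift]

theorem sum_B (β : Edge → ℝ) (V : Vertex → ℂ) (m n : ℤ) :
    ∑ j : Fin 3, phase (β (j, (m, n) + shift j)) * V (Atom.N, (m, n) + shift j)
      = phase (β (0, (m, n))) * V (Atom.N, (m, n))
        + phase (β (1, (m + 1, n))) * V (Atom.N, (m + 1, n))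
        + phase (β (2, (m, n + 1))) * V (Atom.N, (m, n + 1)) := by
  simp [Fin.sum_univ_three, shift]

/-- All Landau phases are 1 at flux 2π, so the equation is translation invariant and quasi-periodic
solutions are plane waves with two free amplitudes. -/
theorem floquet_one_iff (a b : ℝ) (θ : ℝ × ℝ) :
    (∃ W : Vertex → ℂ, W ≠ 0 ∧ QuasiPeriodic 1 θ W ∧ DiscreteEq (landau (2 * π)) a b W) ↔
      a * b = Complex.normSq (1 + phase θ.1 + phase θ.2) := by
  rw [← one_system_iff]
  simp only [map_add, map_one, conj_phase]
  constructor
  · rintro ⟨W, hW, hQ, hN, hB⟩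
    have hval : ∀ x (m n : ℤ), W (x, (m, n)) = phase (m * θ.1 + n * θ.2) * W (x, (0, 0)) := by
      intro x m n
      simpa using hQ.apply x 0 0 m n
    refine ⟨W (Atom.N, (0, 0)), W (Atom.B, (0, 0)), ?_, ?_, ?_⟩
    · by_contra! hc
      refine hW (funext fun ⟨x, m, n⟩ => ?_)
      rw [hval]
      cases x <;> simp [hc.1, hc.2]
    · have := hN (0, 0)
      rw [sum_N, hval _ (0 - 1), hval _ 0 (0 - 1)] at this
      simp only [phase_neg_landau_two_pi] at this
      rw [← this]
      simp
      ring
    · have := hB (0, 0)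
      rw [sum_B, hval _ (0 + 1), hval _ 0 (0 + 1)] at this
      simp only [phase_landau_two_pi] at this
      rw [← this]
      simp
      ring
  · rintro ⟨x, y, hne, h1, h2⟩
    let W : Vertex → ℂ := fun v => phase (v.2.1 * θ.1 + v.2.2 * θ.2) *
      (match v.1 with | Atom.N => x | Atom.B => y)
    refine ⟨W, ?_, ?_, ?_, ?_⟩
    · intro h0
      have hx := congrFun h0 (Atom.N, (0, 0))
      have hy := congrFun h0 (Atom.B, (0, 0))
      simp [W, phase_zero] at hx hy
      tauto
    · intro z γ
      simp only [W]
      refine ⟨?_, ?_⟩ <;> rw [← mul_assoc, ← phase_add] <;> congr 2 <;>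
        simp only [Prod.fst_add, Prod.snd_add] <;> push_cast <;> ring
    · rintro ⟨m, n⟩
      rw [sum_N]
      simp only [phase_neg_landau_two_pi, W]
      have e1 : phase (((m - 1 : ℤ) : ℝ) * θ.1 + n * θ.2)
          = phase (m * θ.1 + n * θ.2) * phase (-θ.1) := by
        rw [← phase_add]; congr 1; push_cast; ring
      have e2 : phase (m * θ.1 + ((n - 1 : ℤ) : ℝ) * θ.2)
          = phase (m * θ.1 + n * θ.2) * phase (-θ.2) := by
        rw [← phase_add]; congr 1; push_cast; ring
      rw [e1, e2]
      linear_combination phase (m * θ.1 + n * θ.2) * h1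
    · rintro ⟨m, n⟩
      rw [sum_B]
      simp only [phase_landau_two_pi, W]
      have e1 : phase (((m + 1 : ℤ) : ℝ) * θ.1 + n * θ.2)
          = phase (m * θ.1 + n * θ.2) * phase θ.1 := by
        rw [← phase_add]; congr 1; push_cast; ring
      have e2 : phase (m * θ.1 + ((n + 1 : ℤ) : ℝ) * θ.2)
          = phase (m * θ.1 + n * θ.2) * phase θ.2 := by
        rw [← phase_add]; congr 1; push_cast; ring
      rw [e1, e2]
      linear_combination phase (m * θ.1 + n * θ.2) * h2

theorem landau_zero (φ : ℝ) (γ : ℤ × ℤ) : landau φ (0, γ) = 0 := by simp [landau]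

theorem landau_one (φ : ℝ) (γ : ℤ × ℤ) : landau φ (1, γ) = 0 := by simp [landau]

theorem phase_landau_pi_even (k n : ℤ) : phase (landau π (2, (2 * k, n))) = 1 := by
  rw [← phase_int_mul_two_pi (-k)]
  congr 1
  simp [landau]
  ring

theorem phase_landau_pi_odd (k n : ℤ) : phase (landau π (2, (2 * k + 1, n))) = -1 := by
  have : landau π (2, (2 * k + 1, n)) = ((-k - 1 : ℤ) : ℝ) * (2 * π) + π := by
    simp [landau]
    ring
  rw [this, phase_add, phase_int_mul_two_pi, phase_pi, one_mul]

theorem phase_neg_landau_pi_even (k n : ℤ) : phase (-landau π (2, (2 * k, n))) = 1 := by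
  have := phase_neg_mul (landau π (2, (2 * k, n)))
  rwa [phase_landau_pi_even, mul_one] at this

theorem phase_neg_landau_pi_odd (k n : ℤ) : phase (-landau π (2, (2 * k + 1, n))) = -1 := by
  have := phase_neg_mul (landau π (2, (2 * k + 1, n)))
  rw [phase_landau_pi_odd] at this
  linear_combination -this

/-- At flux π the phase on the h edges is (-1)^m, so the magnetic cell is doubled: two N and two B
amplitudes, for the two parities of the first coordinate. -/
theorem floquet_two_iff (a b : ℝ) (θ : ℝ × ℝ) :
    (∃ W : Vertex → ℂ, W ≠ 0 ∧ QuasiPeriodic 2 θ W ∧ DiscreteEq (landau π) a b W) ↔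
      (a * b) ^ 2 - 6 * (a * b) + Complex.normSq (1 - phase θ.2 ^ 2 - phase θ.1) = 0 := by
  have hcast : ((a * b) ^ 2 - 6 * (a * b) + Complex.normSq (1 - phase θ.2 ^ 2 - phase θ.1) = 0) ↔
      ((a : ℂ) * b) ^ 2 - 6 * (a * b)
        + (1 - phase θ.2 ^ 2 - phase θ.1) * (1 - phase (-θ.2) ^ 2 - phase (-θ.1)) = 0 := by
    have : (1 - phase θ.2 ^ 2 - phase θ.1) * (1 - phase (-θ.2) ^ 2 - phase (-θ.1))
        = (Complex.normSq (1 - phase θ.2 ^ 2 - phase θ.1) : ℂ) := by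
      rw [← Complex.mul_conj]
      simp [conj_phase]
    rw [this]
    norm_cast
  rw [hcast, ← two_system_iff a b (phase_mul_neg θ.1) (phase_mul_neg θ.2) (conj_phase _)
    (conj_phase _)]
  constructor
  · rintro ⟨W, hW, hQ, hN, hB⟩
    have hval : ∀ x (r k n : ℤ), W (x, (2 * k + r, n))
        = phase (k * θ.1 + n * θ.2) * W (x, (r, 0)) := by
      intro x r k n
      have := hQ.apply x r 0 k n
      rw [zero_add] at this
      rw [← this]
      congr 3
      push_cast
      ring
    refine ⟨W (Atom.N, (0, 0)), W (Atom.N, (1, 0)), W (Atom.B, (0, 0)), W (Atom.B, (1, 0)),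
      ?_, ?_, ?_, ?_, ?_⟩
    · by_contra! hc
      obtain ⟨h1, h2, h3, h4⟩ := hc
      refine hW (funext fun ⟨x, m, n⟩ => ?_)
      rcases Int.even_or_odd' m with ⟨k, rfl | rfl⟩
      · have := hval x 0 k n
        rw [add_zero] at this
        rw [this]
        cases x <;> simp [h1, h3]
      · rw [hval]
        cases x <;> simp [h2, h4]
    · have := hN (0, 0)
      have e1 := hval Atom.B 1 (-1) 0
      have e2 := hval Atom.B 0 0 (-1)
      have p := phase_neg_landau_pi_even 0 0
      norm_num at e1 e2 p
      rw [sum_N] at this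
      simp only [landau_zero, landau_one, neg_zero, phase_zero, zero_sub, p, e1, e2] at this
      linear_combination this
    · have := hN (1, 0)
      have e2 := hval Atom.B 1 0 (-1)
      have p := phase_neg_landau_pi_odd 0 0
      norm_num at e2 p
      rw [sum_N] at this
      simp only [landau_zero, landau_one, neg_zero, phase_zero, zero_sub, p, e2, sub_self] at this
      linear_combination this
    · have := hB (0, 0)
      have e2 := hval Atom.N 0 0 1
      have p := phase_landau_pi_even 0 1
      norm_num at e2 p
      rw [sum_B] at this
      simp only [landau_zero, landau_one, phase_zero, zero_add, p, e2] at this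
      linear_combination this
    · have := hB (1, 0)
      have e1 := hval Atom.N 0 1 0
      have e2 := hval Atom.N 1 0 1
      have p := phase_landau_pi_odd 0 1
      norm_num at e1 e2 p
      rw [sum_B] at this
      have h11 : (1 : ℤ) + 1 = 2 := rfl
      simp only [landau_zero, landau_one, phase_zero, zero_add, p, e1, e2, h11] at this
      linear_combination this
  · rintro ⟨n₀, n₁, b₀, b₁, hne, h1, h2, h3, h4⟩
    let c : Atom → ℤ → ℂ := fun x r => match x with
      | Atom.N => if r = 0 then n₀ else n₁
      | Atom.B => if r = 0 then b₀ else b₁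
    -- Integer division rounds down and the remainder lies in {0, 1} for negative coordinates too,
    -- so quotient and parity index all cells uniformly.
    let W : Vertex → ℂ := fun v =>
      phase ((v.2.1 / 2 : ℤ) * θ.1 + v.2.2 * θ.2) * c v.1 (v.2.1 % 2)
    have hWe : ∀ x (k n : ℤ), W (x, (2 * k, n)) = phase (k * θ.1 + n * θ.2) * c x 0 := by
      intro x k n
      have e1 : 2 * k / 2 = k := by omega
      have e2 : 2 * k % 2 = 0 := by omega
      simp only [W, e1, e2]
    have hWo : ∀ x (k n : ℤ), W (x, (2 * k + 1, n)) = phase (k * θ.1 + n * θ.2) * c x 1 := by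
      intro x k n
      have e1 : (2 * k + 1) / 2 = k := by omega
      have e2 : (2 * k + 1) % 2 = 1 := by omega
      simp only [W, e1, e2]
    have hcN0 : c Atom.N 0 = n₀ := rfl
    have hcN1 : c Atom.N 1 = n₁ := rfl
    have hcB0 : c Atom.B 0 = b₀ := rfl
    have hcB1 : c Atom.B 1 = b₁ := rfl
    have p1 : ∀ k n : ℤ, phase (((k - 1 : ℤ) : ℝ) * θ.1 + n * θ.2)
        = phase (k * θ.1 + n * θ.2) * phase (-θ.1) := fun k n => by
      rw [← phase_add]; congr 1; push_cast; ring
    have p2 : ∀ k n : ℤ, phase (k * θ.1 + ((n - 1 : ℤ) : ℝ) * θ.2)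
        = phase (k * θ.1 + n * θ.2) * phase (-θ.2) := fun k n => by
      rw [← phase_add]; congr 1; push_cast; ring
    have p3 : ∀ k n : ℤ, phase (((k + 1 : ℤ) : ℝ) * θ.1 + n * θ.2)
        = phase (k * θ.1 + n * θ.2) * phase θ.1 := fun k n => by
      rw [← phase_add]; congr 1; push_cast; ring
    have p4 : ∀ k n : ℤ, phase (k * θ.1 + ((n + 1 : ℤ) : ℝ) * θ.2)
        = phase (k * θ.1 + n * θ.2) * phase θ.2 := fun k n => by
      rw [← phase_add]; congr 1; push_cast; ring
    have i1 : ∀ k : ℤ, 2 * k - 1 = 2 * (k - 1) + 1 := fun k => by ring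
    have i2 : ∀ k : ℤ, 2 * k + 1 - 1 = 2 * k := fun k => by ring
    have i3 : ∀ k : ℤ, 2 * k + 1 + 1 = 2 * (k + 1) := fun k => by ring
    refine ⟨W, ?_, ?_, ?_, ?_⟩
    · intro h0
      have w1 := hWe Atom.N 0 0
      have w2 := hWo Atom.N 0 0
      have w3 := hWe Atom.B 0 0
      have w4 := hWo Atom.B 0 0
      simp [h0, phase_zero, hcN0, hcN1, hcB0, hcB1] at w1 w2 w3 w4
      tauto
    · rintro x ⟨m, n⟩
      rcases Int.even_or_odd' m with ⟨k, rfl | rfl⟩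
      · have e : 2 * k + ((2 : ℕ) : ℤ) = 2 * (k + 1) := by push_cast; ring
        simp only [Prod.mk_add_mk, add_zero, e, hWe, p3, p4]
        constructor <;> ring
      · have e : 2 * k + 1 + ((2 : ℕ) : ℤ) = 2 * (k + 1) + 1 := by push_cast; ring
        simp only [Prod.mk_add_mk, add_zero, e, hWo, p3, p4]
        constructor <;> ring
    · rintro ⟨m, n⟩
      rw [sum_N]
      rcases Int.even_or_odd' m with ⟨k, rfl | rfl⟩
      · simp only [landau_zero, landau_one, neg_zero, phase_zero, phase_neg_landau_pi_even, i1, hWe,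
          hWo, p1, p2, hcN0, hcB0, hcB1]
        linear_combination phase (k * θ.1 + n * θ.2) * h1
      · simp only [landau_zero, landau_one, neg_zero, phase_zero, phase_neg_landau_pi_odd, i2, hWe,
          hWo, p2, hcN1, hcB0, hcB1]
        linear_combination phase (k * θ.1 + n * θ.2) * h2
    · rintro ⟨m, n⟩
      rw [sum_B]
      rcases Int.even_or_odd' m with ⟨k, rfl | rfl⟩
      · simp only [landau_zero, landau_one, phase_zero, phase_landau_pi_even, hWe,
          hWo, p4, hcN0, hcN1, hcB0]
        linear_combination phase (k * θ.1 + n * θ.2) * h3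
      · simp only [landau_zero, landau_one, phase_zero, phase_landau_pi_odd, i3, hWe,
          hWo, p3, p4, hcN0, hcN1, hcB1]
        linear_combination phase (k * θ.1 + n * θ.2) * h4

/-! ### The dispersion relation for half a flux quantum -/

theorem normSq_two (θ : ℝ × ℝ) : Complex.normSq (1 - phase θ.2 ^ 2 - phase θ.1)
    = 9 - 2 * (3 + Real.cos θ.1 + Real.cos (2 * θ.2) - Real.cos (θ.1 - 2 * θ.2)) := by
  have h : phase θ.2 ^ 2 = phase (2 * θ.2) := by rw [sq, ← phase_add, two_mul]
  rw [h, phase_eq, phase_eq, Complex.normSq_apply, Real.cos_sub]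
  simp only [Complex.sub_re, Complex.sub_im, Complex.add_re, Complex.add_im, Complex.mul_re,
    Complex.mul_im, Complex.ofReal_re, Complex.ofReal_im, Complex.I_re, Complex.I_im,
    Complex.one_re, Complex.one_im]
  linear_combination Real.sin_sq_add_cos_sq (2 * θ.2) + Real.sin_sq_add_cos_sq θ.1

/-- Keeps the roots 3 ± √(9 - |·|²) of the quadratic real. -/
theorem normSq_two_le (θ : ℝ × ℝ) : Complex.normSq (1 - phase θ.2 ^ 2 - phase θ.1) ≤ 9 := by
  rw [Complex.normSq_eq_norm_sq]
  have : ‖1 - phase θ.2 ^ 2 - phase θ.1‖ ≤ 3 := by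
    refine (norm_sub_le _ _).trans ?_
    have := norm_sub_le 1 (phase θ.2 ^ 2)
    rw [norm_pow, norm_phase, norm_one, one_pow] at this
    rw [norm_phase]
    linarith
  nlinarith [norm_nonneg (1 - phase θ.2 ^ 2 - phase θ.1)]

/-- With X = (3η + αN)(3η + αB) the quadratic has the roots X = 3 ± r, and completing the square in
η gives (6η + αN + αB)² = (αN - αB)² + 4X. -/
theorem etaRoot_iff (η αN αB : ℝ) (θ : ℝ × ℝ) :
    ((3 * η + αN) * (3 * η + αB)) ^ 2 - 6 * ((3 * η + αN) * (3 * η + αB))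
        + Complex.normSq (1 - phase θ.2 ^ 2 - phase θ.1) = 0 ↔
      ∃ s ∈ ({1, -1} : Set ℝ), ∃ t ∈ ({1, -1} : Set ℝ), η = etaRoot s t αN αB θ := by
  set c := 3 + Real.cos θ.1 + Real.cos (2 * θ.2) - Real.cos (θ.1 - 2 * θ.2) with hc
  have h1 := normSq_two_le θ
  have h2 := Complex.normSq_nonneg (1 - phase θ.2 ^ 2 - phase θ.1)
  have hn := normSq_two θ
  rw [hn] at h1 h2 ⊢
  rw [← hc] at h1 h2 ⊢
  have hc0 : 0 ≤ c := by linarith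
  set r := √2 * √c with hr
  have hr0 : 0 ≤ r := by positivity
  have hr2 : r ^ 2 = 2 * c := by
    rw [hr, mul_pow, Real.sq_sqrt zero_le_two, Real.sq_sqrt hc0]
  -- Makes 3 ± r ≥ 0, so the outer radicand is nonnegative and squaring loses no solutions.
  have hr3 : r ≤ 3 := by nlinarith
  set X := (3 * η + αN) * (3 * η + αB) with hX
  have hXη : (6 * η + αN + αB) ^ 2 = (αN - αB) ^ 2 + 4 * X := by rw [hX]; ring
  have hroot : ∀ s t, etaRoot s t αN αB θ
      = -(αN + αB) / 6 + s * √((αN - αB) ^ 2 + 12 + t * (4 * r)) / 6 := by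
    intro s t
    rw [etaRoot, ← hc, hr, mul_assoc 4]
  have key : X ^ 2 - 6 * X + (9 - 2 * c) = 0 ↔ X = 3 + r ∨ X = 3 + -1 * r := by
    have : X ^ 2 - 6 * X + (9 - 2 * c) = (X - (3 + r)) * (X - (3 + -1 * r)) := by
      rw [← hr2]; ring
    rw [this, mul_eq_zero, sub_eq_zero, sub_eq_zero]
  have key2 : ∀ t, 0 ≤ 3 + t * r → (X = 3 + t * r ↔
      ∃ s ∈ ({1, -1} : Set ℝ), η = etaRoot s t αN αB θ) := by
    intro t ht
    have hnn : 0 ≤ (αN - αB) ^ 2 + 12 + t * (4 * r) := by nlinarith [sq_nonneg (αN - αB)]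
    have hsq := Real.sq_sqrt hnn
    set R := √((αN - αB) ^ 2 + 12 + t * (4 * r)) with hR
    have e1 : X = 3 + t * r ↔ (6 * η + αN + αB) ^ 2 = R ^ 2 := by
      rw [hsq, hXη]
      constructor <;> intro h <;> linarith
    rw [e1, sq_eq_sq_iff_eq_or_eq_neg]
    simp only [hroot, mem_insert_iff, mem_singleton_iff, exists_eq_or_imp, exists_eq_left, ← hR]
    refine or_congr ⟨fun h => ?_, fun h => ?_⟩ ⟨fun h => ?_, fun h => ?_⟩ <;> linarith
  have k1 := key2 1 (by linarith)
  have k2 := key2 (-1) (by linarith)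
  rw [one_mul] at k1
  rw [key, k1, k2]
  simp only [mem_insert_iff, mem_singleton_iff, exists_eq_or_imp, exists_eq_left]
  tauto

theorem mem_dispersion_pi_iff {U : ℝ → ℝ} (hU : MemLp U 2 μ01)
    (hUeven : ∀ᵐ x ∂μ01, U x = U (1 - x)) {β : Edge → ℝ} (hβ : HasConstantFlux β π)
    {δN δB E : ℝ} (hE : E ∉ dirichletSpectrum U) (θ : ℝ × ℝ) :
    (θ, E) ∈ dispersion U β δN δB π 2 ↔
      (9 * (discr U δN E * discr U δB E)) ^ 2 - 6 * (9 * (discr U δN E * discr U δB E))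
        + Complex.normSq (1 - phase θ.2 ^ 2 - phase θ.1) = 0 := by
  rw [mem_dispersion_iff hU hUeven hE (by norm_num), floquet_two_iff,
    and_iff_right (exists_gauge hβ)]
  have : 3 * discr U δN E * (3 * discr U δB E) = 9 * (discr U δN E * discr U δB E) := by ring
  rw [this]

theorem mem_dispersion_two_pi_iff {U : ℝ → ℝ} (hU : MemLp U 2 μ01)
    (hUeven : ∀ᵐ x ∂μ01, U x = U (1 - x)) {β : Edge → ℝ} (hβ : HasConstantFlux β (2 * π))
    {δN δB E : ℝ} (hE : E ∉ dirichletSpectrum U) (θ : ℝ × ℝ) :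
    (θ, E) ∈ dispersion U β δN δB (2 * π) 1 ↔
      9 * (discr U δN E * discr U δB E) = Complex.normSq (1 + phase θ.1 + phase θ.2) := by
  rw [mem_dispersion_iff hU hUeven hE (by norm_num), floquet_one_iff,
    and_iff_right (exists_gauge hβ)]
  have : 3 * discr U δN E * (3 * discr U δB E) = 9 * (discr U δN E * discr U δB E) := by ring
  rw [this]

theorem dispersion_pi_iff_etaRoot {U : ℝ → ℝ} (hU : MemLp U 2 μ01)
    (hUeven : ∀ᵐ x ∂μ01, U x = U (1 - x)) {β : Edge → ℝ} (hβ : HasConstantFlux β π)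
    {δN δB E : ℝ} (hE : E ∉ dirichletSpectrum U) (θ : ℝ × ℝ) :
    (θ, E) ∈ dispersion U β δN δB π 2 ↔
      ∃ s ∈ ({1, -1} : Set ℝ), ∃ t ∈ ({1, -1} : Set ℝ),
        eta U E = etaRoot s t (alpha U E δN) (alpha U E δB) θ := by
  rw [mem_dispersion_pi_iff hU hUeven hβ hE, ← etaRoot_iff]
  have h : 9 * (discr U δN E * discr U δB E)
      = (3 * eta U E + alpha U E δN) * (3 * eta U E + alpha U E δB) := by
    rw [eta_eq hU hE, alpha_eq hU hE, alpha_eq hU hE, discr, discr]; ring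
  rw [h]

/-! ### Dirac cones -/

theorem quasimomentum_zero (q : ℕ) : quasimomentum q 0 = 0 := by
  ext i; fin_cases i <;> simp [quasimomentum]

theorem continuous_quasimomentum (q : ℕ) : Continuous (quasimomentum q) := by
  unfold quasimomentum
  refine (PiLp.continuous_toLp 2 _).comp (continuous_pi fun i => ?_)
  fin_cases i <;> simp <;> fun_prop

theorem norm_quasimomentum_sq (q : ℕ) (h : ℝ × ℝ) : ‖quasimomentum q h‖ ^ 2
    = (2 / 3 * (h.1 / q - h.2 / 2)) ^ 2 + h.2 ^ 2 / 3 := by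
  rw [EuclideanSpace.real_norm_sq_eq]
  simp [quasimomentum, Fin.sum_univ_two, div_pow]

/-- If near `(θ₀, E₀)` the set `S` is given by `D_δ(E) = ± ρ(θ)` with `ρ` conical at `θ₀`, then it
has a Dirac cone there. -/
theorem isDiracCone_of_discr {U : ℝ → ℝ} (hU : MemLp U 2 μ01) {δ E₀ : ℝ} (h0 : discr U δ E₀ = 0)
    {S : Set ((ℝ × ℝ) × ℝ)} {q : ℕ} {θ₀ : ℝ × ℝ} {ρ : ℝ × ℝ → ℝ} {c ε : ℝ} (hc : 0 < c) (hε : 0 < ε)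
    (hmem : ∀ θ E, |E - E₀| < ε → ((θ, E) ∈ S ↔ discr U δ E = ρ θ ∨ discr U δ E = -ρ θ))
    (hρ : (fun θ => ρ θ - c * ‖quasimomentum q (θ - θ₀)‖)
      =O[𝓝 θ₀] fun θ => ‖quasimomentum q (θ - θ₀)‖ ^ 2) :
    IsDiracCone S q θ₀ E₀ := by
  obtain ⟨d, hd, hD, hrem⟩ := discr_hasStrictDerivAt hU h0
  -- D_δ is locally invertible at its simple zero, so D_δ(E) = ±ρ(θ) becomes E = g(±ρ(θ)).
  set g := hD.localInverse (discr U δ) d E₀ hd with hg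
  have hgl : ∀ᶠ E in 𝓝 E₀, g (discr U δ E) = E := hD.eventually_left_inverse hd
  have hgr : ∀ᶠ y in 𝓝 (0 : ℝ), discr U δ (g y) = y := h0 ▸ hD.eventually_right_inverse hd
  have hg' : HasStrictDerivAt g d⁻¹ 0 := h0 ▸ hD.to_localInverse hd
  have hg0 : g 0 = E₀ := h0 ▸ hgl.self_of_nhds
  set k : ℝ × ℝ → ℝ := fun θ => ‖quasimomentum q (θ - θ₀)‖ with hk
  have hk0 : k θ₀ = 0 := by simp [hk, quasimomentum_zero]
  have hkc : Tendsto k (𝓝 θ₀) (𝓝 0) := by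
    have : Continuous k := ((continuous_quasimomentum q).comp (continuous_sub_right θ₀)).norm
    simpa [hk0] using this.tendsto θ₀
  have hk2 : (fun θ => k θ ^ 2) =O[𝓝 θ₀] k := by
    have := (hkc.isBigO_one ℝ).mul (isBigO_refl k (𝓝 θ₀))
    simpa [sq] using this
  have hρk : ρ =O[𝓝 θ₀] k := by
    have h1 : (fun θ => c * k θ) =O[𝓝 θ₀] k := (isBigO_refl k _).const_mul_left c
    exact ((hρ.trans hk2).add h1).congr_left fun θ => by simp only [hk]; ring
  -- The neighbourhood filter contains θ₀ itself, where `k` vanishes, so the big-O bound forces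
  -- this.
  have hρ0 : ρ θ₀ = 0 := by
    obtain ⟨C, hC⟩ := hρk.bound
    have := hC.self_of_nhds
    rw [hk0] at this
    simpa using this
  have hρt : Tendsto ρ (𝓝 θ₀) (𝓝 0) := hρk.trans_tendsto hkc
  -- quadratic remainder of the inverse
  have hginv : (fun y => g y - E₀ - d⁻¹ * y) =O[𝓝 0] fun y => y ^ 2 := by
    have hgt : Tendsto g (𝓝 0) (𝓝 E₀) := by simpa [hg0] using hg'.hasDerivAt.continuousAt.tendsto
    have h1 := hrem.comp_tendsto hgt
    have h2 : (fun y => g y - E₀) =O[𝓝 0] fun y => y := by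
      have := hg'.hasDerivAt.isBigO_sub
      simpa [hg0] using this
    have h3 := (h1.trans (h2.pow 2)).const_mul_left (-d⁻¹)
    refine h3.congr' ?_ .rfl
    filter_upwards [hgr] with y hy
    simp only [Function.comp, hy]
    field_simp
    ring
  have hexp : ∀ σ : ℝ, |σ| = 1 → (fun θ => g (σ * ρ θ) - E₀ - d⁻¹ * σ * c * k θ)
      =O[𝓝 θ₀] fun θ => k θ ^ 2 := by
    intro σ hσ
    have ht : Tendsto (fun θ => σ * ρ θ) (𝓝 θ₀) (𝓝 0) := by simpa using hρt.const_mul σ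
    have h1 : (fun θ => g (σ * ρ θ) - E₀ - d⁻¹ * (σ * ρ θ)) =O[𝓝 θ₀] fun θ => k θ ^ 2 :=
      (hginv.comp_tendsto ht).trans ((hρk.const_mul_left σ).pow 2)
    have h2 := hρ.const_mul_left (d⁻¹ * σ)
    refine (h1.add h2).congr_left fun θ => ?_
    ring
  -- D_δ may be decreasing at E₀; σ is its sign of slope, and decides which of g(±ρ) is the upper
  -- band.
  have hσ : ∃ σ : ℝ, |σ| = 1 ∧ (σ = 1 ∨ σ = -1) ∧ 0 < d⁻¹ * σ := by
    rcases lt_or_gt_of_ne hd with h | h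
    · exact ⟨-1, by simp, Or.inr rfl, by simpa using h⟩
    · exact ⟨1, by simp, Or.inl rfl, by simpa using h⟩
  obtain ⟨σ, hσ1, hσs, hσd⟩ := hσ
  obtain ⟨ε', hε', hball⟩ := Metric.eventually_nhds_iff.1 hgl
  refine ⟨d⁻¹ * σ * c, by positivity, min ε ε', lt_min hε hε', fun θ => g (σ * ρ θ),
    fun θ => g (-σ * ρ θ), ?_, by simp [hρ0, hg0], by simp [hρ0, hg0], hexp σ hσ1, ?_⟩
  · have ht1 : Tendsto (fun θ => -ρ θ) (𝓝 θ₀) (𝓝 0) := by simpa using hρt.neg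
    filter_upwards [hρt.eventually hgr, ht1.eventually hgr] with θ hθ1 hθ2 E hE
    have hE1 : g (discr U δ E) = E := hball (by
      rw [Real.dist_eq]; exact hE.trans_le (min_le_right _ _))
    rw [hmem θ E (hE.trans_le (min_le_left _ _))]
    have e1 : discr U δ E = ρ θ ↔ E = g (ρ θ) :=
      ⟨fun h => by rw [← h, hE1], fun h => by rw [h, hθ1]⟩
    have e2 : discr U δ E = -ρ θ ↔ E = g (-ρ θ) :=
      ⟨fun h => by rw [← h, hE1], fun h => by rw [h, hθ2]⟩
    rw [e1, e2]
    rcases hσs with rfl | rfl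
    · simp
    · simp [or_comm]
  · refine (hexp (-σ) (by rwa [abs_neg])).congr_left fun θ => ?_
    ring

theorem phase_expansion (x h : ℝ) (hh : |h| ≤ 1) :
    ‖phase (x + h) - phase x - Complex.I * h * phase x‖ ≤ h ^ 2 := by
  have e : phase (x + h) - phase x - Complex.I * h * phase x
      = phase x * (Complex.exp (Complex.I * h) - 1 - Complex.I * h) := by
    rw [phase_add, phase, phase]; ring
  have hn : ‖Complex.I * h‖ = |h| := by simp
  rw [e, norm_mul, norm_phase, one_mul]
  have := Complex.norm_exp_sub_one_sub_id_le (x := Complex.I * h) (by rw [hn]; exact hh)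
  rwa [hn, sq_abs] at this

/-- Converts quadratic errors in θ into quadratic errors in the quasimomentum. The constants are not
sharp; they produce the 51 = 48 + 3 and 60 = 48 + 4·3 in the cone estimates. -/
theorem sq_le_quasimomentum {q : ℕ} (hq : 1 ≤ q) (hq2 : q ≤ 2) (h : ℝ × ℝ) :
    h.1 ^ 2 ≤ 48 * ‖quasimomentum q h‖ ^ 2 ∧ h.2 ^ 2 ≤ 3 * ‖quasimomentum q h‖ ^ 2 := by
  rw [norm_quasimomentum_sq]
  interval_cases q <;> constructor <;> push_cast <;>
    nlinarith [sq_nonneg (h.1 - 2 * h.2), sq_nonneg (h.1 - h.2), sq_nonneg (h.1 - 4 * h.2),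
      sq_nonneg h.1, sq_nonneg h.2, sq_nonneg (h.1 - h.2 / 2)]

theorem eventually_small (θ₀ : ℝ × ℝ) :
    ∀ᶠ θ in 𝓝 θ₀, |(θ - θ₀).1| ≤ 1 / 2 ∧ |(θ - θ₀).2| ≤ 1 / 2 := by
  filter_upwards [Metric.closedBall_mem_nhds θ₀ (one_half_pos (α := ℝ))] with θ hθ
  rw [Metric.mem_closedBall, dist_eq_norm] at hθ
  exact ⟨(norm_fst_le (θ - θ₀)).trans hθ, (norm_snd_le (θ - θ₀)).trans hθ⟩

theorem isBigO_norm_sub_norm {L P : ℝ × ℝ → ℂ} {f : ℝ × ℝ → ℝ} {θ₀ : ℝ × ℝ} {C : ℝ}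
    (h : ∀ᶠ θ in 𝓝 θ₀, ‖P θ - L θ‖ ≤ C * f θ ^ 2) :
    (fun θ => ‖P θ‖ - ‖L θ‖) =O[𝓝 θ₀] fun θ => f θ ^ 2 := by
  refine IsBigO.of_bound C ?_
  filter_upwards [h] with θ hθ
  rw [Real.norm_eq_abs, norm_pow, Real.norm_eq_abs, sq_abs]
  exact (abs_norm_sub_norm_le _ _).trans hθ

theorem cos_sin_third : Real.cos (2 * π / 3) = -1 / 2 ∧ Real.sin (2 * π / 3) = √3 / 2 := by
  have e : 2 * π / 3 = π - π / 3 := by ring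
  rw [e, Real.cos_pi_sub, Real.sin_pi_sub, Real.cos_pi_div_three, Real.sin_pi_div_three]
  exact ⟨by ring, rfl⟩

/-- At θ_D the three summands are the cube roots of unity and cancel. The linear part L satisfies
|L|² = h₁² - h₁h₂ + h₂², exactly (3/2)² times the squared quasimomentum; this is why the cone is
isotropic. -/
theorem cone_one : (fun θ : ℝ × ℝ => ‖1 + phase θ.1 + phase θ.2‖
      - 3 / 2 * ‖quasimomentum 1 (θ - (2 * π / 3, -2 * π / 3))‖)
    =O[𝓝 (2 * π / 3, -2 * π / 3)]
      fun θ => ‖quasimomentum 1 (θ - (2 * π / 3, -2 * π / 3))‖ ^ 2 := by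
  set θ₀ : ℝ × ℝ := (2 * π / 3, -2 * π / 3) with hθ₀
  obtain ⟨hc, hs⟩ := cos_sin_third
  have p1 : phase (2 * π / 3) = -1 / 2 + √3 / 2 * Complex.I := by
    rw [phase_eq, hc, hs]; push_cast; ring
  have p2 : phase (-2 * π / 3) = -1 / 2 - √3 / 2 * Complex.I := by
    have : -2 * π / 3 = -(2 * π / 3) := by ring
    rw [this, phase_eq, Real.cos_neg, Real.sin_neg, hc, hs]; push_cast; ring
  let L : ℝ × ℝ → ℂ := fun θ => Complex.I * (θ - θ₀).1 * phase (2 * π / 3)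
    + Complex.I * (θ - θ₀).2 * phase (-2 * π / 3)
  have hL : ∀ θ, ‖L θ‖ = 3 / 2 * ‖quasimomentum 1 (θ - θ₀)‖ := by
    intro θ
    refine (sq_eq_sq₀ (norm_nonneg _) (by positivity)).1 ?_
    rw [mul_pow, norm_quasimomentum_sq, ← Complex.normSq_eq_norm_sq]
    simp only [L]
    rw [p1, p2, Complex.normSq_apply]
    have h3 : √3 ^ 2 = 3 := Real.sq_sqrt (by norm_num)
    simp
    linear_combination (((θ.1 - θ₀.1) - (θ.2 - θ₀.2)) ^ 2 / 4) * h3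
  have hb : ∀ᶠ θ in 𝓝 θ₀, ‖(1 + phase θ.1 + phase θ.2) - L θ‖
      ≤ 51 * ‖quasimomentum 1 (θ - θ₀)‖ ^ 2 := by
    filter_upwards [eventually_small θ₀] with θ hθ
    have e1 := phase_expansion (2 * π / 3) (θ - θ₀).1 (by linarith [hθ.1])
    have e2 := phase_expansion (-2 * π / 3) (θ - θ₀).2 (by linarith [hθ.2])
    have a1 : 2 * π / 3 + (θ - θ₀).1 = θ.1 := by simp [hθ₀]
    have a2 : -2 * π / 3 + (θ - θ₀).2 = θ.2 := by simp [hθ₀]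
    rw [a1] at e1
    rw [a2] at e2
    have e3 : (1 + phase θ.1 + phase θ.2) - L θ
        = (phase θ.1 - phase (2 * π / 3) - Complex.I * (θ - θ₀).1 * phase (2 * π / 3))
          + (phase θ.2 - phase (-2 * π / 3) - Complex.I * (θ - θ₀).2 * phase (-2 * π / 3)) := by
      simp only [L]
      have : phase (2 * π / 3) + phase (-2 * π / 3) = -1 := by rw [p1, p2]; ring
      linear_combination this
    rw [e3]
    refine (norm_add_le _ _).trans ?_
    have := sq_le_quasimomentum le_rfl one_le_two (θ - θ₀)
    linarith
  have := isBigO_norm_sub_norm hb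
  simpa only [hL] using this

/-- The same computation with e^{iπ/3} + e^{-iπ/3} = 1. Here |L|² = h₁² - 2h₁h₂ + 4h₂², which is 9
times the squared quasimomentum for q = 2. -/
theorem cone_two : (fun θ : ℝ × ℝ => ‖1 - phase θ.2 ^ 2 - phase θ.1‖
      - 3 * ‖quasimomentum 2 (θ - (π / 3, -π / 6))‖)
    =O[𝓝 (π / 3, -π / 6)] fun θ => ‖quasimomentum 2 (θ - (π / 3, -π / 6))‖ ^ 2 := by
  set θ₀ : ℝ × ℝ := (π / 3, -π / 6) with hθ₀
  have p1 : phase (π / 3) = 1 / 2 + √3 / 2 * Complex.I := by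
    rw [phase_eq, Real.cos_pi_div_three, Real.sin_pi_div_three]; push_cast; ring
  have p2 : phase (-(π / 3)) = 1 / 2 - √3 / 2 * Complex.I := by
    rw [phase_eq, Real.cos_neg, Real.sin_neg, Real.cos_pi_div_three, Real.sin_pi_div_three]
    push_cast; ring
  let L : ℝ × ℝ → ℂ := fun θ => -(Complex.I * (θ - θ₀).1 * phase (π / 3)
    + Complex.I * (2 * (θ - θ₀).2 : ℝ) * phase (-(π / 3)))
  have hL : ∀ θ, ‖L θ‖ = 3 * ‖quasimomentum 2 (θ - θ₀)‖ := by
    intro θ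
    refine (sq_eq_sq₀ (norm_nonneg _) (by positivity)).1 ?_
    rw [mul_pow, norm_quasimomentum_sq, ← Complex.normSq_eq_norm_sq]
    simp only [L]
    rw [p1, p2, Complex.normSq_apply]
    have h3 : √3 ^ 2 = 3 := Real.sq_sqrt (by norm_num)
    simp
    linear_combination (((θ.1 - θ₀.1) - 2 * (θ.2 - θ₀.2)) ^ 2 / 4) * h3
  have hb : ∀ᶠ θ in 𝓝 θ₀, ‖(1 - phase θ.2 ^ 2 - phase θ.1) - L θ‖
      ≤ 60 * ‖quasimomentum 2 (θ - θ₀)‖ ^ 2 := by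
    filter_upwards [eventually_small θ₀] with θ hθ
    have e1 := phase_expansion (π / 3) (θ - θ₀).1 (by linarith [hθ.1])
    have e2 := phase_expansion (-(π / 3)) (2 * (θ - θ₀).2) (by
      rw [abs_mul, abs_two]; linarith [hθ.2])
    have a1 : π / 3 + (θ - θ₀).1 = θ.1 := by simp [hθ₀]
    have a2 : -(π / 3) + 2 * (θ - θ₀).2 = θ.2 + θ.2 := by simp [hθ₀]; ring
    rw [a1] at e1
    rw [a2, phase_add, ← sq] at e2
    have e3 : (1 - phase θ.2 ^ 2 - phase θ.1) - L θ
        = -(phase θ.1 - phase (π / 3) - Complex.I * (θ - θ₀).1 * phase (π / 3))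
          - (phase θ.2 ^ 2 - phase (-(π / 3))
            - Complex.I * (2 * (θ - θ₀).2 : ℝ) * phase (-(π / 3))) := by
      simp only [L]
      have : phase (π / 3) + phase (-(π / 3)) = 1 := by rw [p1, p2]; ring
      linear_combination -this
    rw [e3]
    refine (norm_sub_le _ _).trans ?_
    rw [norm_neg]
    have := sq_le_quasimomentum one_le_two le_rfl (θ - θ₀)
    linarith
  have := isBigO_norm_sub_norm hb
  simpa only [hL] using this

theorem eventually_not_dirichlet {U : ℝ → ℝ} (hU : MemLp U 2 μ01) {E₀ : ℝ}
    (hE₀ : E₀ ∉ dirichletSpectrum U) : ∀ᶠ E in 𝓝 E₀, E ∉ dirichletSpectrum U := by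
  filter_upwards [(continuous_sine_one hU).continuousAt.eventually_ne (sine_ne_zero hU hE₀)]
    with E hE h
  exact hE ((mem_dirichletSpectrum_iff hU).1 h)

/-- For equal couplings 9D² = |1 + e^{iθ₁} + e^{iθ₂}|², hence D = ±ρ, where ρ has slope (1/3)(3/2) =
1/2. -/
theorem isDiracCone_one {U : ℝ → ℝ} (hU : MemLp U 2 μ01) (hUeven : ∀ᵐ x ∂μ01, U x = U (1 - x))
    {β : Edge → ℝ} (hβ : HasConstantFlux β (2 * π)) {δ E₀ : ℝ} (hE₀ : E₀ ∈ centralEnergies U δ δ) :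
    IsDiracCone (dispersion U β δ δ (2 * π) 1) 1 (2 * π / 3, -2 * π / 3) E₀ := by
  have h0 := (mem_centralEnergies_iff hU).1 hE₀
  rw [add_self_div_two] at h0
  obtain ⟨ε, hε, hball⟩ := Metric.eventually_nhds_iff.1 (eventually_not_dirichlet hU hE₀.1)
  refine isDiracCone_of_discr hU h0 (ρ := fun θ => 1 / 3 * ‖1 + phase θ.1 + phase θ.2‖)
    (c := 1 / 2) one_half_pos hε (fun θ E hE => ?_) ?_
  · rw [mem_dispersion_two_pi_iff hU hUeven hβ (hball (by rwa [Real.dist_eq])),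
      ← sq_eq_sq_iff_eq_or_eq_neg, Complex.normSq_eq_norm_sq]
    constructor <;> intro h <;> linarith
  · refine (cone_one.const_mul_left (1 / 3)).congr_left fun θ => ?_
    ring

/-- The correction factor in ρ for flux π. A first-order error suffices because this factor is
multiplied by y, which is itself of first order. -/
theorem isBigO_inv_sqrt : (fun y : ℝ => 1 / √(3 + √(9 - y ^ 2)) - 1 / √6) =O[𝓝 0] fun y => y := by
  have hd : DifferentiableAt ℝ (fun y : ℝ => 1 / √(3 + √(9 - y ^ 2))) 0 := by
    have h9 : √(9 : ℝ) = 3 := by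
      rw [show (9 : ℝ) = 3 ^ 2 by norm_num]; exact Real.sqrt_sq (by norm_num)
    have h1 : DifferentiableAt ℝ (fun y : ℝ => 3 + √(9 - y ^ 2)) 0 :=
      (DifferentiableAt.sqrt (by fun_prop) (by norm_num)).const_add 3
    have h2 : DifferentiableAt ℝ (fun y : ℝ => √(3 + √(9 - y ^ 2))) 0 :=
      h1.sqrt (by simp [h9])
    exact (differentiableAt_const 1).div h2 (by simp [h9])
  have := hd.isBigO_sub
  have h9 : √(9 : ℝ) = 3 := by
    rw [show (9 : ℝ) = 3 ^ 2 by norm_num]; exact Real.sqrt_sq (by norm_num)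
  have h6 : (3 : ℝ) + 3 = 6 := by norm_num
  simpa [h9, h6] using this

/-- Near the cone 9D² is the small root 3 - √(9 - d²) = d²/(3 + √(9 - d²)) of the quadratic. Taking
square roots gives ρ, with slope (1/3)·3/√6 = 1/√6. -/
theorem isDiracCone_two {U : ℝ → ℝ} (hU : MemLp U 2 μ01) (hUeven : ∀ᵐ x ∂μ01, U x = U (1 - x))
    {β : Edge → ℝ} (hβ : HasConstantFlux β π) {δ E₀ : ℝ} (hE₀ : E₀ ∈ centralEnergies U δ δ) :
    IsDiracCone (dispersion U β δ δ π 2) 2 (π / 3, -π / 6) E₀ := by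
  have h0 := (mem_centralEnergies_iff hU).1 hE₀
  rw [add_self_div_two] at h0
  -- Forces 9D² < 3, which excludes the larger root 3 + √(9 - d²).
  have hsmall : ∀ᶠ E in 𝓝 E₀, |discr U δ E| < 1 / 2 := by
    have := (continuous_discr hU δ).abs.tendsto E₀
    rw [h0, abs_zero] at this
    exact this.eventually_lt_const one_half_pos
  obtain ⟨ε, hε, hball⟩ := Metric.eventually_nhds_iff.1
    ((eventually_not_dirichlet hU hE₀.1).and hsmall)
  set d : ℝ × ℝ → ℝ := fun θ => ‖1 - phase θ.2 ^ 2 - phase θ.1‖ with hd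
  have hd9 : ∀ θ, d θ ^ 2 ≤ 9 := fun θ => by
    have := normSq_two_le θ
    rwa [Complex.normSq_eq_norm_sq] at this
  refine isDiracCone_of_discr hU h0 (ρ := fun θ => 1 / 3 * (d θ * (1 / √(3 + √(9 - d θ ^ 2)))))
    (c := 1 / √6) (by positivity) hε (fun θ E hE => ?_) ?_
  · obtain ⟨hE1, hE2⟩ := hball (y := E) (by rwa [Real.dist_eq])
    rw [mem_dispersion_pi_iff hU hUeven hβ hE1, ← sq_eq_sq_iff_eq_or_eq_neg,
      Complex.normSq_eq_norm_sq]
    have hs := Real.sq_sqrt (sub_nonneg.2 (hd9 θ))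
    have hs0 := Real.sqrt_nonneg (9 - d θ ^ 2)
    set r := √(9 - d θ ^ 2)
    have hpos : 0 < 3 + r := by positivity
    have e1 : (1 / 3 * (d θ * (1 / √(3 + r)))) ^ 2 = (3 - r) / 9 := by
      rw [mul_pow, mul_pow, div_pow 1 (√(3 + r)), Real.sq_sqrt hpos.le]
      field_simp
      linear_combination 9 * hs
    rw [e1]
    set D := discr U δ E
    have hD : 9 * (D * D) < 3 := by
      have h1 := abs_lt.1 hE2
      nlinarith [h1.1, h1.2]
    have e2 : (9 * (D * D)) ^ 2 - 6 * (9 * (D * D)) + ‖1 - phase θ.2 ^ 2 - phase θ.1‖ ^ 2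
        = (9 * (D * D) - (3 - r)) * (9 * (D * D) - (3 + r)) := by
      linear_combination hs
    rw [e2, mul_eq_zero]
    constructor
    · rintro (h | h) <;> [linarith; exact absurd h (by linarith)]
    · intro h; left; linarith
  · have hk : Tendsto (fun θ => ‖quasimomentum 2 (θ - (π / 3, -π / 6))‖) (𝓝 (π / 3, -π / 6)) (𝓝 0) := by
      have : Continuous fun θ => ‖quasimomentum 2 (θ - (π / 3, -π / 6))‖ :=
        ((continuous_quasimomentum 2).comp (continuous_sub_right _)).norm
      simpa [quasimomentum_zero] using this.tendsto (π / 3, -π / 6)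
    set k : ℝ × ℝ → ℝ := fun θ => ‖quasimomentum 2 (θ - (π / 3, -π / 6))‖
    have hk2 : (fun θ => k θ ^ 2) =O[𝓝 (π / 3, -π / 6)] k := by
      have := (hk.isBigO_one ℝ).mul (isBigO_refl k (𝓝 (π / 3, -π / 6)))
      simpa [sq] using this
    have hdk : d =O[𝓝 (π / 3, -π / 6)] k := by
      have h1 : (fun θ => 3 * k θ) =O[𝓝 (π / 3, -π / 6)] k := (isBigO_refl k _).const_mul_left 3
      simpa [hd, k] using (cone_two.trans hk2).add h1
    have h1 := hdk.mul ((isBigO_inv_sqrt.comp_tendsto (hdk.trans_tendsto hk)).trans hdk)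
    have h2 := (h1.const_mul_left (1 / 3)).add
      ((cone_two.const_mul_left (1 / 3 * (1 / √6))).congr_right fun θ => sq (k θ))
    refine (h2.congr_left fun θ => ?_).congr_right fun θ => (sq _).symm
    simp only [Function.comp, hd]
    ring

/-! ### Elements of `⨁_e L²[0,1]` -/

theorem norm_sq_Lp {f : Lp ℂ 2 μ01} {u : ℝ → ℂ} (h : (f : ℝ → ℂ) =ᵐ[μ01] u) :
    ‖f‖ ^ 2 = ∫ x, ‖u x‖ ^ 2 ∂μ01 := by
  rw [← inner_self_eq_norm_sq (𝕜 := ℂ), L2.inner_def, ← integral_re (L2.integrable_inner f f)]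
  refine integral_congr_ae ?_
  filter_upwards [h] with x hx
  rw [inner_self_eq_norm_sq, hx]

theorem hasSum_norm_sq {f : GraphL2} {u : Edge → ℝ → ℂ}
    (h : ∀ e, (f e : ℝ → ℂ) =ᵐ[μ01] u e) :
    HasSum (fun e => ∫ x, ‖u e x‖ ^ 2 ∂μ01) (‖f‖ ^ 2) := by
  have := lp.hasSum_norm (p := 2) (by norm_num) f
  simp only [ENNReal.toReal_ofNat, Real.rpow_ofNat] at this
  exact this.congr_fun fun e => (norm_sq_Lp (h e)).symm

theorem exists_graphL2 {u : Edge → ℝ → ℂ} (hm : ∀ e, MemLp (u e) 2 μ01)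
    (hs : Summable fun e => ∫ x, ‖u e x‖ ^ 2 ∂μ01) :
    ∃ f : GraphL2, ∀ e, (f e : ℝ → ℂ) =ᵐ[μ01] u e := by
  have hmem : Memℓp (fun e => (hm e).toLp (u e)) 2 := by
    refine memℓp_gen ?_
    simp only [ENNReal.toReal_ofNat, Real.rpow_ofNat]
    exact hs.congr fun e => (norm_sq_Lp (hm e).coeFn_toLp).symm
  exact ⟨⟨_, hmem⟩, fun e => (hm e).coeFn_toLp⟩

theorem integrable_norm_sq {u : ℝ → ℂ} (h : MemLp u 2 μ01) :
    Integrable (fun x => ‖u x‖ ^ 2) μ01 :=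
  h.norm.integrable_sq

/-- `f` and `H f - z f` are determined by functions on the edges. -/
theorem SchrodingerGraph.of_edges {U : ℝ → ℝ} {β : Edge → ℝ} {δN δB E : ℝ} {f k : GraphL2}
    {u v w : Edge → ℝ → ℂ} (hu : ∀ e, IsH2 (u e) (v e) (w e))
    (hs : Summable (fun e => ∫ x, (‖u e x‖ ^ 2 + ‖v e x‖ ^ 2 + ‖w e x‖ ^ 2) ∂μ01))
    (hV : VertexConditions β δN δB u v) (hf : ∀ e, (f e : ℝ → ℂ) =ᵐ[μ01] u e)
    (hk : ∀ e, (k e : ℝ → ℂ) =ᵐ[μ01] fun x => -w e x + (U x - E) • u e x) :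
    SchrodingerGraph U β δN δB f (k + (E : ℂ) • f) := by
  refine ⟨u, v, w, hu, hs, hV, hf, fun e => ?_⟩
  have h1 : ((k + (E : ℂ) • f : GraphL2) e) = k e + (E : ℂ) • f e := rfl
  rw [h1]
  filter_upwards [hf e, hk e, Lp.coeFn_add (k e) ((E : ℂ) • f e), Lp.coeFn_smul (E : ℂ) (f e)]
    with x h1 h2 h3 h4
  rw [h3, Pi.add_apply, h4, Pi.smul_apply, h1, h2, sub_smul]
  simp only [Complex.real_smul, smul_eq_mul]
  ring

theorem SchrodingerGraph.exists_edges {U : ℝ → ℝ} {β : Edge → ℝ} {δN δB E : ℝ} {f k : GraphL2}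
    (h : SchrodingerGraph U β δN δB f (k + (E : ℂ) • f)) :
    ∃ u v w : Edge → ℝ → ℂ, (∀ e, IsH2 (u e) (v e) (w e)) ∧
      Summable (fun e => ∫ x, (‖u e x‖ ^ 2 + ‖v e x‖ ^ 2 + ‖w e x‖ ^ 2) ∂μ01) ∧
      VertexConditions β δN δB u v ∧ (∀ e, (f e : ℝ → ℂ) =ᵐ[μ01] u e) ∧
      (∀ e, (k e : ℝ → ℂ) =ᵐ[μ01] fun x => -w e x + (U x - E) • u e x) := by
  obtain ⟨u, v, w, hu, hs, hV, hf, hk⟩ := h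
  refine ⟨u, v, w, hu, hs, hV, hf, fun e => ?_⟩
  have h1 : ((k + (E : ℂ) • f : GraphL2) e) = k e + (E : ℂ) • f e := rfl
  have hk := hk e
  rw [h1] at hk
  filter_upwards [hf e, hk, Lp.coeFn_add (k e) ((E : ℂ) • f e), Lp.coeFn_smul (E : ℂ) (f e)]
    with x h1 h2 h3 h4
  rw [h3, Pi.add_apply, h4, Pi.smul_apply, h1] at h2
  rw [sub_smul]
  simp only [Complex.real_smul, smul_eq_mul] at h2 ⊢
  linear_combination h2

/-! ### Exponential weights on the lattice -/

/-- The weight `r^(|γ₁| + |γ₂|)`. -/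
def weight (r : ℝ) (γ : ℤ × ℤ) : ℝ := r ^ γ.1.natAbs * r ^ γ.2.natAbs

theorem weight_pos {r : ℝ} (hr : 0 < r) (γ : ℤ × ℤ) : 0 < weight r γ := by
  unfold weight; positivity

theorem summable_pow_natAbs {r : ℝ} (h0 : 0 ≤ r) (h1 : r < 1) :
    Summable fun n : ℤ => r ^ n.natAbs := by
  refine Summable.of_nat_of_neg ?_ ?_ <;> simpa using summable_geometric_of_lt_one h0 h1

theorem summable_weight_sq {r : ℝ} (h0 : 0 ≤ r) (h1 : r < 1) :
    Summable fun γ => weight r γ ^ 2 := by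
  have h := summable_pow_natAbs (sq_nonneg r) (by nlinarith : r ^ 2 < 1)
  refine (h.mul_of_nonneg h (fun n => by positivity) (fun n => by positivity)).congr fun γ => ?_
  simp only [weight]; ring

theorem pow_natAbs_sub_one {r : ℝ} (h0 : 0 < r) (h1 : r < 1) (n : ℤ) :
    |r ^ (n - 1).natAbs - r ^ n.natAbs| ≤ (1 / r - 1) * r ^ n.natAbs := by
  have hp : 0 < r ^ n.natAbs := by positivity
  have hr : 1 - r ≤ 1 / r - 1 := by
    have : 0 ≤ (1 - r) ^ 2 / r := by positivity
    have e : (1 - r) ^ 2 / r = 1 / r - 1 - (1 - r) := by field_simp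
    linarith
  rcases le_or_gt n 0 with h | h
  · have : (n - 1).natAbs = n.natAbs + 1 := by omega
    rw [this, pow_succ, abs_sub_comm, abs_of_nonneg (by nlinarith)]
    nlinarith
  · have : n.natAbs = (n - 1).natAbs + 1 := by omega
    rw [this, pow_succ]
    have hq : 0 < r ^ (n - 1).natAbs := by positivity
    rw [abs_of_nonneg (by nlinarith)]
    field_simp
    linarith

/-- The relative change of the weight across an edge is O(1 - r), which is what makes the cutoff
error negligible as r → 1. -/
theorem abs_weight_sub_shift {r : ℝ} (h0 : 1 / 2 ≤ r) (h1 : r < 1) (j : Fin 3) (γ : ℤ × ℤ) :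
    |weight r (γ - shift j) - weight r γ| ≤ 2 * (1 - r) * weight r γ := by
  have hr : 1 / r - 1 ≤ 2 * (1 - r) := by
    rw [div_sub_one (by linarith), div_le_iff₀ (by linarith)]; nlinarith
  have hr0 : 0 < r := by linarith
  have hp : ∀ n : ℤ, 0 < r ^ n.natAbs := fun n => by positivity
  have hw := weight_pos hr0 γ
  obtain ⟨m, n⟩ := γ
  have key : ∀ n : ℤ, |r ^ (n - 1).natAbs - r ^ n.natAbs| ≤ 2 * (1 - r) * r ^ n.natAbs :=
    fun n => (pow_natAbs_sub_one hr0 h1 n).trans (by have := hp n; nlinarith)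
  fin_cases j
  · simp [shift, ← Prod.zero_eq_mk]
    exact mul_nonneg (by linarith) hw.le
  · simp only [weight, shift, Fin.mk_one, Matrix.cons_val_one, Matrix.cons_val_zero,
      Prod.mk_sub_mk, sub_zero]
    rw [← sub_mul, abs_mul, abs_of_pos (hp n), ← mul_assoc]
    exact mul_le_mul_of_nonneg_right (key m) (hp n).le
  · simp only [weight, shift, Fin.reduceFinMk, Matrix.cons_val, Prod.mk_sub_mk, sub_zero]
    rw [← mul_sub, abs_mul, abs_of_pos (hp m)]
    nlinarith [key n, hp m]

/-- A function of the cells that is two-periodic in the first direction and one-periodic in the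
second one has a weighted sum comparable to that of its value at one point. -/
theorem weight_sum_periodic {r : ℝ} (h0 : 1 / 2 ≤ r) (h1 : r < 1) {F : ℤ × ℤ → ℝ}
    (hF : ∀ γ, 0 ≤ F γ) (hP : ∀ m n k l : ℤ, F (m + 2 * k, n + l) = F (m, n))
    (hs : Summable fun γ => weight r γ ^ 2 * F γ) (γ₀ : ℤ × ℤ) :
    F γ₀ * ∑' γ, weight r γ ^ 2 ≤ 5 * ∑' γ, weight r γ ^ 2 * F γ := by
  have hr0 : 0 < r := by linarith
  have hinj : Function.Injective fun γ : ℤ × ℤ => γ + (1, 0) := add_left_injective _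
  have hsurj : ∑' γ : ℤ × ℤ, weight r (γ + (1, 0)) ^ 2 * F (γ + (1, 0))
      = ∑' γ, weight r γ ^ 2 * F γ :=
    (Equiv.addRight ((1, 0) : ℤ × ℤ)).tsum_eq fun γ => weight r γ ^ 2 * F γ
  have hs' : Summable fun γ : ℤ × ℤ => weight r (γ + (1, 0)) ^ 2 * F (γ + (1, 0)) :=
    hs.comp_injective hinj
  have hw : ∀ γ : ℤ × ℤ, weight r γ ≤ 2 * weight r (γ + (1, 0)) := fun γ => by
    have := abs_le.1 (abs_weight_sub_shift h0 h1 1 (γ + (1, 0)))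
    have e : γ + (1, 0) - shift 1 = γ := by simp [shift]
    rw [e] at this
    have := weight_pos hr0 (γ + (1, 0))
    nlinarith
  have hpt : ∀ γ, F γ₀ * weight r γ ^ 2
      ≤ weight r γ ^ 2 * F γ + 4 * (weight r (γ + (1, 0)) ^ 2 * F (γ + (1, 0))) := fun γ => by
    -- One of the two neighbouring cells has a first coordinate of the same parity as γ₀, and there
    -- F takes the value F γ₀.
    have hle : F γ₀ ≤ F γ + F (γ + (1, 0)) := by
      obtain ⟨m, n⟩ := γ
      obtain ⟨m₀, n₀⟩ := γ₀
      rcases Int.even_or_odd (m - m₀) with ⟨c, hc⟩ | ⟨c, hc⟩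
      · have := hP m₀ n₀ c (n - n₀)
        rw [show m₀ + 2 * c = m by omega, show n₀ + (n - n₀) = n by omega] at this
        rw [← this]
        exact le_add_of_nonneg_right (hF _)
      · have := hP m₀ n₀ (c + 1) (n - n₀)
        rw [show m₀ + 2 * (c + 1) = m + 1 by omega, show n₀ + (n - n₀) = n by omega] at this
        rw [← this, Prod.mk_add_mk, add_zero]
        exact le_add_of_nonneg_left (hF _)
    have h2 : weight r γ ^ 2 ≤ 4 * weight r (γ + (1, 0)) ^ 2 := by
      have := weight_pos hr0 γ
      nlinarith [hw γ]
    have := mul_le_mul_of_nonneg_right h2 (hF (γ + (1, 0)))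
    have := mul_le_mul_of_nonneg_right hle (sq_nonneg (weight r γ))
    linarith
  rw [← tsum_mul_left]
  calc _ ≤ ∑' γ, (weight r γ ^ 2 * F γ + 4 * (weight r (γ + (1, 0)) ^ 2 * F (γ + (1, 0)))) :=
        Summable.tsum_le_tsum hpt ((summable_weight_sq hr0.le h1).mul_left _)
          (hs.add (hs'.mul_left 4))
    _ = _ := by
        rw [hs.tsum_add (hs'.mul_left 4), tsum_mul_left, hsurj]; ring

theorem bounded_of_periodic {G : Edge → ℝ}
    (hP : ∀ (j : Fin 3) (m n k l : ℤ), G (j, (m + 2 * k, n + l)) = G (j, (m, n))) :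
    ∃ C, ∀ e, G e ≤ C := by
  refine ⟨∑ j : Fin 3, (|G (j, (0, 0))| + |G (j, (1, 0))|), ?_⟩
  rintro ⟨j, m, n⟩
  have h1 : G (j, (m, n)) ≤ |G (j, (0, 0))| + |G (j, (1, 0))| := by
    rcases Int.even_or_odd m with ⟨c, hc⟩ | ⟨c, hc⟩
    · have := hP j 0 0 c n
      rw [show 0 + 2 * c = m by omega, zero_add] at this
      rw [this]
      exact (le_abs_self _).trans (le_add_of_nonneg_right (abs_nonneg _))
    · have := hP j 1 0 c n
      rw [show 1 + 2 * c = m by omega, zero_add] at this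
      rw [this]
      exact (le_abs_self _).trans (le_add_of_nonneg_left (abs_nonneg _))
  exact h1.trans (Finset.single_le_sum (f := fun j : Fin 3 => |G (j, (0, 0))| + |G (j, (1, 0))|)
    (fun j _ => by positivity) (Finset.mem_univ j))

/-! ### Bounded solutions and the spectrum -/

/-- The cubic Hermite polynomial with `p(0) = p'(0) = 0`, `p(1) = A`, `p'(1) = B`. -/
def hermite (A B : ℂ) (x : ℝ) : ℂ := (x ^ 2 * (3 - 2 * x) : ℝ) * A + (x ^ 2 * (x - 1) : ℝ) * B

/-- The derivative of `hermite`. -/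
def hermiteDeriv (A B : ℂ) (x : ℝ) : ℂ :=
  (6 * x * (1 - x) : ℝ) * A + (x * (3 * x - 2) : ℝ) * B

/-- The second derivative of `hermite`. -/
def hermiteDeriv₂ (A B : ℂ) (x : ℝ) : ℂ := (6 - 12 * x : ℝ) * A + (6 * x - 2 : ℝ) * B

theorem hermite_isH2 (A B : ℂ) : IsH2 (hermite A B) (hermiteDeriv A B) (hermiteDeriv₂ A B) := by
  have hc : Continuous (hermiteDeriv₂ A B) := by unfold hermiteDeriv₂; fun_prop
  refine .of_isPrimitive (memLp_of_continuousOn hc.continuousOn 2)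
    (isPrimitive_of_hasDerivAt (by unfold hermiteDeriv; fun_prop) fun x => ?_)
    (isPrimitive_of_hasDerivAt hc fun x => ?_)
  · have h1 : HasDerivAt (fun x : ℝ => x ^ 2 * (3 - 2 * x)) (6 * x * (1 - x)) x := by
      have := ((hasDerivAt_id x).pow 2).mul (((hasDerivAt_id x).const_mul 2).const_sub 3)
      convert! this using 1
      simp; ring
    have h2 : HasDerivAt (fun x : ℝ => x ^ 2 * (x - 1)) (x * (3 * x - 2)) x := by
      have := ((hasDerivAt_id x).pow 2).mul ((hasDerivAt_id x).sub_const 1)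
      convert! this using 1
      simp; ring
    exact (h1.ofReal_comp.mul_const A).add (h2.ofReal_comp.mul_const B)
  · have h1 : HasDerivAt (fun x : ℝ => 6 * x * (1 - x)) (6 - 12 * x) x := by
      have := ((hasDerivAt_id x).const_mul 6).mul ((hasDerivAt_id x).const_sub 1)
      convert! this using 1
      simp; ring
    have h2 : HasDerivAt (fun x : ℝ => x * (3 * x - 2)) (6 * x - 2) x := by
      have := (hasDerivAt_id x).mul (((hasDerivAt_id x).const_mul 3).sub_const 2)
      convert! this using 1
      simp; ring
    exact (h1.ofReal_comp.mul_const A).add (h2.ofReal_comp.mul_const B)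

theorem norm_combination_le {a b M N : ℝ} {A B : ℂ} {c : ℝ} (ha : |a| ≤ M) (hb : |b| ≤ N)
    (hA : ‖A‖ ≤ c) (hB : ‖B‖ ≤ c) : ‖(a : ℂ) * A + (b : ℂ) * B‖ ≤ (M + N) * c := by
  have h0 : 0 ≤ c := (norm_nonneg _).trans hA
  refine (norm_add_le _ _).trans ?_
  rw [norm_mul, norm_mul, Complex.norm_real, Complex.norm_real, add_mul]
  exact add_le_add (mul_le_mul ha hA (norm_nonneg _) ((abs_nonneg _).trans ha))
    (mul_le_mul hb hB (norm_nonneg _) ((abs_nonneg _).trans hb))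

theorem hermite_bound {A B : ℂ} {c : ℝ} (hA : ‖A‖ ≤ c) (hB : ‖B‖ ≤ c) {x : ℝ}
    (hx : x ∈ Icc (0 : ℝ) 1) : ‖hermite A B x‖ ≤ 2 * c ∧ ‖hermiteDeriv A B x‖ ≤ 4 * c ∧
      ‖hermiteDeriv₂ A B x‖ ≤ 10 * c := by
  obtain ⟨h0, h1⟩ := hx
  have hq : 0 ≤ x * (1 - x) := mul_nonneg h0 (by linarith)
  refine ⟨?_, ?_, ?_⟩
  · have := norm_combination_le (a := x ^ 2 * (3 - 2 * x)) (b := x ^ 2 * (x - 1)) (M := 1) (N := 1)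
      (abs_le.2 ⟨by nlinarith [sq_nonneg x], by nlinarith [sq_nonneg (1 - x)]⟩)
      (abs_le.2 ⟨by nlinarith, by nlinarith⟩) hA hB
    exact this.trans_eq (by ring)
  · have := norm_combination_le (a := 6 * x * (1 - x)) (b := x * (3 * x - 2)) (M := 2) (N := 2)
      (abs_le.2 ⟨by nlinarith, by nlinarith [sq_nonneg (2 * x - 1)]⟩)
      (abs_le.2 ⟨by nlinarith, by nlinarith⟩) hA hB
    exact this.trans_eq (by ring)
  · have := norm_combination_le (a := 6 - 12 * x) (b := 6 * x - 2) (M := 6) (N := 4)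
      (abs_le.2 ⟨by linarith, by linarith⟩)
      (abs_le.2 ⟨by linarith, by linarith⟩) hA hB
    exact this.trans_eq (by ring)

theorem sum_fin3_tsum {f : ℤ × ℤ → ℝ} (hf : Summable f) :
    (Summable fun e : Edge => f e.2) ∧ ∑' e : Edge, f e.2 = 3 * ∑' γ, f γ := by
  have h : HasSum (fun e : Edge => f e.2) (∑ _j : Fin 3, ∑' γ, f γ) := by
    have hs : Summable fun e : Edge => f e.2 := by
      have := (summable_prod_of_nonneg (f := fun e : Edge => ‖f e.2‖) fun _ => norm_nonneg _).2
        ⟨fun _ => hf.norm, Summable.of_finite⟩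
      exact this.of_norm
    have := hs.hasSum
    rw [hs.tsum_prod, tsum_fintype] at this
    exact this
  refine ⟨h.summable, ?_⟩
  rw [h.tsum_eq]
  simp

/-- Periodic moduli leave finitely many end values. Since s(1) ≠ 0 these control u'(0), and the a
priori bound spreads this over the edge. -/
theorem exists_uniform_bound {U : ℝ → ℝ} (hU : MemLp U 2 μ01)
    (hUeven : ∀ᵐ x ∂μ01, U x = U (1 - x)) {E : ℝ} (hE : E ∉ dirichletSpectrum U)
    {u v : Edge → ℝ → ℂ} (hsol : ∀ e, IsEdgeSolution U E (u e) (v e))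
    (hP : ∀ x ∈ Icc (0 : ℝ) 1, ∀ (j : Fin 3) (m n k l : ℤ),
      ‖u (j, (m + 2 * k, n + l)) x‖ = ‖u (j, (m, n)) x‖) :
    ∃ C, ∀ e, ∀ x ∈ Icc (0 : ℝ) 1, ‖u e x‖ ≤ C ∧ ‖v e x‖ ≤ C := by
  obtain ⟨C₀, h0⟩ := bounded_of_periodic (G := fun e => ‖u e 0‖) (hP 0 (by simp))
  obtain ⟨C₁, h1⟩ := bounded_of_periodic (G := fun e => ‖u e 1‖) (hP 1 (by simp))
  have hs := sine_ne_zero hU hE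
  refine ⟨aprioriConst U E * (C₀ + (C₁ + |(sine U E).2 1| * C₀) / |(sine U E).1 1|),
    fun e x hx => ?_⟩
  have hv : ‖v e 0‖ ≤ (C₁ + |(sine U E).2 1| * C₀) / |(sine U E).1 1| := by
    rw [le_div_iff₀ (abs_pos.2 hs), mul_comm]
    have := congrArg norm ((hsol e).deriv_zero hU hUeven)
    rw [norm_mul, Complex.norm_real, Real.norm_eq_abs] at this
    rw [this]
    refine (norm_sub_le _ _).trans (add_le_add (h1 e) ?_)
    rw [norm_mul, Complex.norm_real, Real.norm_eq_abs]
    exact mul_le_mul_of_nonneg_left (h0 e) (abs_nonneg _)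
  have hle := mul_le_mul_of_nonneg_left (add_le_add (h0 e) hv) (aprioriConst_pos U E).le
  have := (hsol e).apriori_bound hU hx
  exact ⟨this.1.trans hle, this.2.trans hle⟩

set_option maxHeartbeats 600000 in
/-- Cutting off a bounded solution with the weights `r^(|γ₁| + |γ₂|)`. -/
theorem exists_cutoff {U : ℝ → ℝ} (hU : MemLp U 2 μ01) {β : Edge → ℝ} {δN δB E : ℝ}
    {u v : Edge → ℝ → ℂ} (hsol : ∀ e, IsEdgeSolution U E (u e) (v e))
    (hV : VertexConditions β δN δB u v) {C : ℝ}
    (hC : ∀ e, ∀ x ∈ Icc (0 : ℝ) 1, ‖u e x‖ ≤ C ∧ ‖v e x‖ ≤ C) {r : ℝ} (h0 : 1 / 2 ≤ r)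
    (h1 : r < 1) : ∃ f k : GraphL2, SchrodingerGraph U β δN δB f (k + (E : ℂ) • f) ∧
      ‖k‖ ^ 2 ≤ (2 * (1 - r)) ^ 2 * (∫ x, (10 * C * (1 + |U x - E|)) ^ 2 ∂μ01) *
        (3 * ∑' γ, weight r γ ^ 2) ∧
      ∑' e : Edge, weight r e.2 ^ 2 * ∫ x, ‖u e x‖ ^ 2 ∂μ01
        ≤ 2 * ‖f‖ ^ 2 + 2 * ((2 * (1 - r)) ^ 2 *
          (∫ x, (10 * C * (1 + |U x - E|)) ^ 2 ∂μ01) * (3 * ∑' γ, weight r γ ^ 2)) := by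
  have hr0 : 0 < r := by linarith
  have hC0 : 0 ≤ C := (norm_nonneg _).trans (hC (0, (0, 0)) 0 (by simp)).1
  obtain ⟨V, hi, ht, hN, hB⟩ := hV
  set ρ : Edge → ℝ := fun e => weight r e.2 with hρ
  -- Each edge carries the weight of its initial vertex, which is wrong at the terminal end. The
  -- Hermite correction adds Δu(1) and Δu'(1) there and changes nothing at the initial end, so the
  -- vertex conditions survive and the new source comes from the correction alone.
  set Δ : Edge → ℝ := fun e => weight r (e.2 - shift e.1) - weight r e.2 with hΔ
  have hρ0 : ∀ e, 0 < ρ e := fun e => weight_pos hr0 _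
  have hΔρ : ∀ e, |Δ e| ≤ 2 * (1 - r) * ρ e := fun e => abs_weight_sub_shift h0 h1 e.1 e.2
  have hΔ1 : ∀ e, |Δ e| ≤ ρ e := fun e => (hΔρ e).trans (by nlinarith [hρ0 e])
  set A : Edge → ℂ := fun e => Δ e * u e 1
  set B : Edge → ℂ := fun e => Δ e * v e 1
  have hA : ∀ e, ‖A e‖ ≤ |Δ e| * C := fun e => by
    simp only [A, norm_mul, Complex.norm_real, Real.norm_eq_abs]
    exact mul_le_mul_of_nonneg_left (hC e 1 (by simp)).1 (abs_nonneg _)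
  have hB' : ∀ e, ‖B e‖ ≤ |Δ e| * C := fun e => by
    simp only [B, norm_mul, Complex.norm_real, Real.norm_eq_abs]
    exact mul_le_mul_of_nonneg_left (hC e 1 (by simp)).2 (abs_nonneg _)
  -- One square-integrable majorant for all edges; 10 is the bound for the second derivative of the
  -- Hermite polynomial.
  set G : ℝ → ℝ := fun x => 10 * C * (1 + |U x - E|) with hG
  have hGm : MemLp G 2 μ01 := by
    have h : MemLp (fun x => |U x - E|) 2 μ01 := (memLp_sub_const hU E).abs
    have h' : MemLp (fun x => 1 + |U x - E|) 2 μ01 := (memLp_const (1 : ℝ)).add h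
    exact h'.const_mul (10 * C)
  have hGi : Integrable (fun x => G x ^ 2) μ01 := hGm.integrable_sq
  have hGC : ∀ x, 10 * C ≤ G x := fun x => by
    have := mul_nonneg (by linarith : 0 ≤ 10 * C) (abs_nonneg (U x - E))
    simp only [hG]; linarith
  have hGU : ∀ x, 10 * C * |U x - E| + 10 * C = G x := fun x => by simp only [hG]; ring
  have hmem : ∀ {p : ℝ → Prop}, (∀ x ∈ Icc (0 : ℝ) 1, p x) → ∀ᵐ x ∂μ01, p x := fun h =>
    ae_μ01_iff.2 (ae_of_all _ h)
  obtain ⟨hsw, htw⟩ := sum_fin3_tsum (summable_weight_sq hr0.le h1)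
  -- the functions on the edges
  have hH2 : ∀ e, IsH2 (fun x => ρ e • u e x + hermite (A e) (B e) x)
      (fun x => ρ e • v e x + hermiteDeriv (A e) (B e) x)
      (fun x => ρ e • (U x - E) • u e x + hermiteDeriv₂ (A e) (B e) x) := fun e =>
    (((hsol e).isH2 hU).clm_comp (ContinuousLinearMap.lsmul ℝ ℝ (ρ e))).add (hermite_isH2 _ _)
  have hb1 : ∀ e, ∀ x ∈ Icc (0 : ℝ) 1, ‖hermite (A e) (B e) x‖ ≤ |Δ e| * G x := fun e x hx => by
    have := (hermite_bound (hA e) (hB' e) hx).1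
    have := mul_le_mul_of_nonneg_left (hGC x) (abs_nonneg (Δ e))
    nlinarith [mul_nonneg (abs_nonneg (Δ e)) hC0]
  have hb2 : ∀ e, ∀ x ∈ Icc (0 : ℝ) 1,
      ‖-hermiteDeriv₂ (A e) (B e) x + (U x - E) • hermite (A e) (B e) x‖ ≤ |Δ e| * G x := by
    intro e x hx
    have h3 := hermite_bound (hA e) (hB' e) hx
    refine (norm_add_le _ _).trans ?_
    rw [norm_neg, norm_smul, Real.norm_eq_abs, ← hGU]
    have h4 := mul_le_mul_of_nonneg_left h3.1 (abs_nonneg (U x - E))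
    have h5 := mul_nonneg (abs_nonneg (U x - E)) (mul_nonneg (abs_nonneg (Δ e)) hC0)
    nlinarith [h3.2.2]
  have hU1 : ∀ e, ∀ x ∈ Icc (0 : ℝ) 1, ‖ρ e • u e x + hermite (A e) (B e) x‖ ≤ ρ e * G x ∧
      ‖ρ e • v e x + hermiteDeriv (A e) (B e) x‖ ≤ ρ e * G x ∧
      ‖ρ e • (U x - E) • u e x + hermiteDeriv₂ (A e) (B e) x‖ ≤ 2 * (ρ e * G x) := by
    intro e x hx
    have h3 := hermite_bound (hA e) (hB' e) hx
    have h4 := hC e x hx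
    have h5 : |Δ e| * C ≤ ρ e * C := mul_le_mul_of_nonneg_right (hΔ1 e) hC0
    have h6 := mul_le_mul_of_nonneg_left (hGC x) (hρ0 e).le
    have h7 := mul_nonneg (hρ0 e).le hC0
    have h8 := mul_nonneg (mul_nonneg (hρ0 e).le hC0) (abs_nonneg (U x - E))
    have h9 : ‖ρ e • u e x‖ ≤ ρ e * C := by
      rw [norm_smul, Real.norm_of_nonneg (hρ0 e).le]
      exact mul_le_mul_of_nonneg_left h4.1 (hρ0 e).le
    have h10 : ‖ρ e • v e x‖ ≤ ρ e * C := by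
      rw [norm_smul, Real.norm_of_nonneg (hρ0 e).le]
      exact mul_le_mul_of_nonneg_left h4.2 (hρ0 e).le
    have h11 : ‖ρ e • (U x - E) • u e x‖ ≤ ρ e * C * |U x - E| := by
      rw [norm_smul, norm_smul, Real.norm_of_nonneg (hρ0 e).le, Real.norm_eq_abs]
      have := mul_le_mul_of_nonneg_left h4.1 (mul_nonneg (hρ0 e).le (abs_nonneg (U x - E)))
      nlinarith
    have h12 := hGU x
    refine ⟨(norm_add_le _ _).trans ?_, (norm_add_le _ _).trans ?_, (norm_add_le _ _).trans ?_⟩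
    · linarith
    · linarith
    · have : ρ e * G x = ρ e * (10 * C * |U x - E| + 10 * C) := by rw [h12]
      nlinarith
  have hsum : ∀ {F : Edge → ℝ → ℝ} {c : ℝ}, (∀ e x, 0 ≤ F e x) →
      (∀ e, ∀ x ∈ Icc (0 : ℝ) 1, F e x ≤ c * ρ e ^ 2 * G x ^ 2) →
      Summable (fun e => ∫ x, F e x ∂μ01) ∧
        ∀ e, ∫ x, F e x ∂μ01 ≤ c * (∫ x, G x ^ 2 ∂μ01) * ρ e ^ 2 := by
    intro F c hF0 hF
    have hle : ∀ e, ∫ x, F e x ∂μ01 ≤ c * (∫ x, G x ^ 2 ∂μ01) * ρ e ^ 2 := fun e => by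
      have := integral_mono_of_nonneg (ae_of_all _ (hF0 e)) (hGi.const_mul (c * ρ e ^ 2))
        (hmem (hF e))
      rw [integral_const_mul] at this
      linarith
    exact ⟨Summable.of_nonneg_of_le (fun e => integral_nonneg (hF0 e)) hle (hsw.mul_left _), hle⟩
  have sqle : ∀ {a b c : ℝ}, 0 ≤ a → a ≤ b * c → a ^ 2 ≤ b ^ 2 * c ^ 2 := fun h h' => by
    rw [← mul_pow]; exact pow_le_pow_left₀ h h' 2
  have hΔG : ∀ e x, (|Δ e| * G x) ^ 2 ≤ (2 * (1 - r)) ^ 2 * ρ e ^ 2 * G x ^ 2 := fun e x => by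
    have := pow_le_pow_left₀ (abs_nonneg _) (hΔρ e) 2
    rw [mul_pow, ← mul_pow _ (ρ e)]
    exact mul_le_mul_of_nonneg_right this (sq_nonneg _)
  -- 6 = 1 + 1 + 2², from the three bounds in `hU1`.
  obtain ⟨hS1, -⟩ := hsum (F := fun e x => ‖ρ e • u e x + hermite (A e) (B e) x‖ ^ 2 +
      ‖ρ e • v e x + hermiteDeriv (A e) (B e) x‖ ^ 2 +
      ‖ρ e • (U x - E) • u e x + hermiteDeriv₂ (A e) (B e) x‖ ^ 2) (c := 6)
    (fun e x => by positivity) (fun e x hx => by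
      obtain ⟨h2, h3, h4⟩ := hU1 e x hx
      have h2 := pow_le_pow_left₀ (norm_nonneg _) h2 2
      have h3 := pow_le_pow_left₀ (norm_nonneg _) h3 2
      have h4 := pow_le_pow_left₀ (norm_nonneg _) h4 2
      nlinarith)
  obtain ⟨hS2, -⟩ := hsum (F := fun e x => ‖ρ e • u e x + hermite (A e) (B e) x‖ ^ 2) (c := 1)
    (fun e x => by positivity) (fun e x hx => by
      rw [one_mul]; exact sqle (norm_nonneg _) (hU1 e x hx).1)
  obtain ⟨hS3, hS3'⟩ := hsum (F := fun e x =>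
      ‖-hermiteDeriv₂ (A e) (B e) x + (U x - E) • hermite (A e) (B e) x‖ ^ 2)
    (c := (2 * (1 - r)) ^ 2) (fun e x => by positivity) (fun e x hx =>
      (pow_le_pow_left₀ (norm_nonneg _) (hb2 e x hx) 2).trans (hΔG e x))
  obtain ⟨hS4, hS4'⟩ := hsum (F := fun e x => ‖hermite (A e) (B e) x‖ ^ 2)
    (c := (2 * (1 - r)) ^ 2) (fun e x => by positivity) (fun e x hx =>
      (pow_le_pow_left₀ (norm_nonneg _) (hb1 e x hx) 2).trans (hΔG e x))
  have hm4 : ∀ e, MemLp (hermite (A e) (B e)) 2 μ01 := fun e =>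
    memLp_of_continuousOn (hermite_isH2 _ _).continuousOn 2
  obtain ⟨f, hf⟩ := exists_graphL2 (fun e => memLp_of_continuousOn (hH2 e).continuousOn 2) hS2
  obtain ⟨k, hk⟩ := exists_graphL2 (fun e => (hermite_isH2 (A e) (B e)).1.neg.add
    (memLp_smul_continuousOn (memLp_sub_const hU E) (hermite_isH2 (A e) (B e)).continuousOn)) hS3
  refine ⟨f, k, .of_edges hH2 hS1 ⟨fun x => weight r x.2 * V x, ?_, ?_, ?_, ?_⟩ hf ?_, ?_, ?_⟩
  · intro e
    simp [hermite, hi, init, ρ]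
  · intro e
    simp only [term] at ht ⊢
    rw [← ht]
    simp only [hermite, A, Δ, ρ, Complex.real_smul]
    push_cast
    ring
  · intro γ
    simp only [hermiteDeriv, ρ, Complex.real_smul, mul_zero, zero_mul, Complex.ofReal_zero,
      add_zero]
    rw [← Finset.mul_sum, hN]
    ring
  · intro γ
    rw [mul_left_comm, ← hB, mul_neg, Finset.mul_sum]
    congr 1
    refine Finset.sum_congr rfl fun j _ => ?_
    simp only [hermiteDeriv, B, Δ, ρ, Complex.real_smul, add_sub_cancel_right]
    push_cast
    ring
  · intro e
    filter_upwards [hk e] with x hx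
    rw [hx, Pi.add_apply, Pi.neg_apply]
    simp only [smul_add, Complex.real_smul]
    ring
  · have := (hasSum_norm_sq hk).tsum_eq
    rw [← this, ← htw, ← tsum_mul_left]
    exact Summable.tsum_le_tsum hS3' hS3 (hsw.mul_left _)
  · have hft := (hasSum_norm_sq hf)
    have h4 : ∑' e, ∫ x, ‖hermite (A e) (B e) x‖ ^ 2 ∂μ01 ≤ (2 * (1 - r)) ^ 2 *
        (∫ x, G x ^ 2 ∂μ01) * (3 * ∑' γ, weight r γ ^ 2) := by
      rw [← htw, ← tsum_mul_left]
      exact Summable.tsum_le_tsum hS4' hS4 (hsw.mul_left _)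
    -- The weighted solution is the cutoff function minus its Hermite correction, and (a + b)² ≤ 2a²
    -- + 2b².
    have hpt : ∀ e, weight r e.2 ^ 2 * ∫ x, ‖u e x‖ ^ 2 ∂μ01
        ≤ 2 * ∫ x, ‖ρ e • u e x + hermite (A e) (B e) x‖ ^ 2 ∂μ01
          + 2 * ∫ x, ‖hermite (A e) (B e) x‖ ^ 2 ∂μ01 := by
      intro e
      have i1 := integrable_norm_sq (memLp_of_continuousOn (hH2 e).continuousOn 2)
      have i2 := integrable_norm_sq (hm4 e)
      rw [← integral_const_mul, ← integral_const_mul, ← integral_const_mul,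
        ← integral_add (i1.const_mul 2) (i2.const_mul 2)]
      refine integral_mono_of_nonneg (ae_of_all _ fun x => by positivity)
        ((i1.const_mul 2).add (i2.const_mul 2)) (ae_of_all _ fun x => ?_)
      have h5 : weight r e.2 * ‖u e x‖ ≤ ‖ρ e • u e x + hermite (A e) (B e) x‖
          + ‖hermite (A e) (B e) x‖ := by
        have := norm_sub_le (ρ e • u e x + hermite (A e) (B e) x) (hermite (A e) (B e) x)
        rwa [add_sub_cancel_right, norm_smul, Real.norm_of_nonneg (hρ0 e).le] at this
      have h6 := pow_le_pow_left₀ (mul_nonneg (hρ0 e).le (norm_nonneg _)) h5 2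
      dsimp only
      rw [← mul_pow]
      refine h6.trans ?_
      nlinarith [sq_nonneg (‖ρ e • u e x + hermite (A e) (B e) x‖ - ‖hermite (A e) (B e) x‖)]
    have hS5 := (hft.summable.mul_left 2).add (hS4.mul_left 2)
    have hS6 := Summable.of_nonneg_of_le
      (fun e : Edge => mul_nonneg (sq_nonneg (weight r e.2))
        (integral_nonneg fun x => sq_nonneg ‖u e x‖)) hpt hS5
    refine (Summable.tsum_le_tsum hpt hS6 hS5).trans ?_
    rw [(hft.summable.mul_left 2).tsum_add (hS4.mul_left 2), tsum_mul_left, tsum_mul_left,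
      hft.tsum_eq]
    linarith

/-- A Weyl sequence argument. A bounded resolvent R would give ‖f‖ ≤ ‖R‖‖k‖ for the cutoffs, with
‖k‖² = O((1 - r)²) times the sum S of squared weights, while by periodicity the solution has
weighted mass at least a fixed multiple of S. Dividing by S and letting r → 1 contradicts
nontriviality. -/
theorem mem_schrodingerSpectrum_of_bounded {U : ℝ → ℝ} (hU : MemLp U 2 μ01)
    (hUeven : ∀ᵐ x ∂μ01, U x = U (1 - x)) {β : Edge → ℝ} {δN δB E : ℝ}
    (hE : E ∉ dirichletSpectrum U) {u v : Edge → ℝ → ℂ}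
    (hsol : ∀ e, IsEdgeSolution U E (u e) (v e)) (hV : VertexConditions β δN δB u v)
    (hne : ∃ e, ∃ x ∈ Icc (0 : ℝ) 1, u e x ≠ 0)
    (hP : ∀ x ∈ Icc (0 : ℝ) 1, ∀ (j : Fin 3) (m n k l : ℤ),
      ‖u (j, (m + 2 * k, n + l)) x‖ = ‖u (j, (m, n)) x‖) :
    (E : ℂ) ∈ schrodingerSpectrum U β δN δB := by
  rintro ⟨R, hR⟩
  obtain ⟨C, hC⟩ := exists_uniform_bound hU hUeven hE hsol hP
  obtain ⟨⟨j₀, γ₀⟩, x₀, hx₀, hne⟩ := hne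
  set F : Edge → ℝ := fun e => ∫ x, ‖u e x‖ ^ 2 ∂μ01 with hF
  have hcont : ∀ e, ContinuousOn (u e) (Icc 0 1) := fun e => ((hsol e).isH2 hU).continuousOn
  have hF0 : ∀ e, 0 ≤ F e := fun e => integral_nonneg fun x => sq_nonneg _
  have hFpos : 0 < F (j₀, γ₀) := by
    simp only [hF]
    rw [integral_μ01]
    refine intervalIntegral.integral_pos one_pos ((hcont _).norm.pow 2) (fun t _ => sq_nonneg _)
      ⟨x₀, hx₀, by positivity⟩
  have hFC : ∀ e, F e ≤ C ^ 2 := fun e => by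
    have := integral_mono_of_nonneg (μ := μ01) (f := fun x => ‖u e x‖ ^ 2) (g := fun _ => C ^ 2)
      (ae_of_all _ fun x => sq_nonneg _) (integrable_const _) (ae_μ01_iff.2 (ae_of_all _
        fun x hx => pow_le_pow_left₀ (norm_nonneg _) (hC e x hx).1 2))
    simpa using this
  have hFP : ∀ (m n k l : ℤ), F (j₀, (m + 2 * k, n + l)) = F (j₀, (m, n)) := fun m n k l =>
    integral_congr_ae (ae_μ01_iff.2 (ae_of_all _ fun x hx => by
      simp only [hP x hx j₀ m n k l]))
  set K := ∫ x, (10 * C * (1 + |U x - E|)) ^ 2 ∂μ01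
  have hK : 0 ≤ K := integral_nonneg fun x => sq_nonneg _
  -- 15 = 5·3: the loss in `weight_sum_periodic` times the three edges per cell.
  set M := 15 * (2 * ‖R‖ ^ 2 + 2) * K with hM
  have key : ∀ r, 1 / 2 ≤ r → r < 1 → F (j₀, γ₀) ≤ M * (2 * (1 - r)) ^ 2 := by
    intro r h0 h1
    have hr0 : 0 ≤ r := by linarith
    obtain ⟨f, k, hfk, hk, hf⟩ := exists_cutoff hU hsol hV hC h0 h1
    have hRk : ‖f‖ ^ 2 ≤ ‖R‖ ^ 2 * ‖k‖ ^ 2 := by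
      rw [← mul_pow, ← (hR f k).1 hfk]
      exact pow_le_pow_left₀ (norm_nonneg _) (R.le_opNorm k) 2
    set S := ∑' γ, weight r γ ^ 2 with hS
    have hsw := summable_weight_sq hr0 h1
    have hS0 : 0 < S := hsw.tsum_pos (fun _ => sq_nonneg _) (0, 0) (by simp [weight])
    have hsF : Summable fun e : Edge => weight r e.2 ^ 2 * F e :=
      Summable.of_nonneg_of_le (fun e => mul_nonneg (sq_nonneg _) (hF0 e))
        (fun e => mul_le_mul_of_nonneg_left (hFC e) (sq_nonneg _))
        ((sum_fin3_tsum hsw).1.mul_right _)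
    have hinj : Function.Injective fun γ : ℤ × ℤ => ((j₀, γ) : Edge) := Prod.mk_right_injective _
    have hsj : Summable fun γ => weight r γ ^ 2 * F (j₀, γ) := by
      have := hsF.comp_injective hinj
      simpa only [Function.comp_def] using this
    have h2 := weight_sum_periodic h0 h1 (fun γ => hF0 (j₀, γ)) hFP hsj γ₀
    have h3 : ∑' γ, weight r γ ^ 2 * F (j₀, γ) ≤ ∑' e : Edge, weight r e.2 ^ 2 * F e :=
      tsum_comp_le_tsum_of_inj hsF (fun e => mul_nonneg (sq_nonneg _) (hF0 e)) hinj
    have h4 := mul_le_mul_of_nonneg_left hk (sq_nonneg ‖R‖)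
    have h5 : F (j₀, γ₀) * S ≤ M * (2 * (1 - r)) ^ 2 * S := by
      rw [hM]
      change ∑' e : Edge, weight r e.2 ^ 2 * F e ≤ _ at hf
      linarith
    exact le_of_mul_le_mul_right h5 hS0
  have hlim : Tendsto (fun r : ℝ => M * (2 * (1 - r)) ^ 2) (𝓝[<] 1) (𝓝 0) := by
    have : Continuous fun r : ℝ => M * (2 * (1 - r)) ^ 2 := by fun_prop
    simpa using (this.tendsto 1).mono_left nhdsWithin_le_nhds
  refine hFpos.not_ge (ge_of_tendsto hlim ?_)
  filter_upwards [Ico_mem_nhdsLT (show (1 / 2 : ℝ) < 1 by norm_num)] with r hr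
  exact key r hr.1 hr.2

/-- Gauge and Floquet factors are unimodular, so the modulus of a Floquet solution is periodic; for
q = 1 it is in particular two-periodic in the first direction. -/
theorem mem_schrodingerSpectrum_of_mem_dispersion {U : ℝ → ℝ} (hU : MemLp U 2 μ01)
    (hUeven : ∀ᵐ x ∂μ01, U x = U (1 - x)) {β : Edge → ℝ} {δN δB φ E : ℝ} {q : ℕ}
    (hq : q = 1 ∨ q = 2) (hE : E ∉ dirichletSpectrum U) {θ : ℝ × ℝ}
    (h : (θ, E) ∈ dispersion U β δN δB φ q) : (E : ℂ) ∈ schrodingerSpectrum U β δN δB := by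
  obtain ⟨χ, -, u, v, hne, hsol, hV, h1, h2⟩ := h
  refine mem_schrodingerSpectrum_of_bounded hU hUeven hE hsol hV hne fun x hx j => ?_
  have e1 : ∀ m n : ℤ, ‖u (j, (m + q, n)) x‖ = ‖u (j, (m, n)) x‖ := fun m n => by
    simpa [norm_phase, translate] using congrArg norm (h1 (j, (m, n)) x hx)
  have e2 : ∀ m n : ℤ, ‖u (j, (m, n + 1)) x‖ = ‖u (j, (m, n)) x‖ := fun m n => by
    simpa [norm_phase, translate] using congrArg norm (h2 (j, (m, n)) x hx)
  have e3 : ∀ m n : ℤ, ‖u (j, (m + 2, n)) x‖ = ‖u (j, (m, n)) x‖ := fun m n => by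
    rcases hq with rfl | rfl
    · have := e1 (m + 1) n
      rw [Nat.cast_one, add_assoc, one_add_one_eq_two] at this
      rw [this]
      exact e1 m n
    · exact e1 m n
  have e4 : ∀ m n k : ℤ, ‖u (j, (m + 2 * k, n)) x‖ = ‖u (j, (m, n)) x‖ := by
    intro m n k
    induction k using Int.induction_on with
    | zero => simp
    | succ i ih => rw [← ih, ← e3 (m + 2 * i) n]; ring_nf
    | pred i ih => rw [← ih, ← e3]; ring_nf
  intro m n k l
  rw [e4]
  induction l using Int.induction_on with
  | zero => simp
  | succ i ih => rw [← ih, ← e2 m (n + i)]; ring_nf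
  | pred i ih => rw [← ih, ← e2]; ring_nf

/-! ### The discrete operator on `ℓ²(ℤ²)` -/

/-- The Hilbert space `ℓ²(ℤ²)`. -/
abbrev CellL2 := lp (fun _ : ℤ × ℤ => ℂ) 2

theorem hasSum_norm_sq_cell (V : CellL2) : HasSum (fun γ => ‖V γ‖ ^ 2) (‖V‖ ^ 2) := by
  simpa using lp.hasSum_norm (p := 2) (by norm_num) V

theorem exists_cellL2 {V : ℤ × ℤ → ℂ} (h : Summable fun γ => ‖V γ‖ ^ 2) :
    ∃ W : CellL2, ∀ γ, W γ = V γ :=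
  ⟨⟨V, memℓp_gen (by simpa using h)⟩, fun _ => rfl⟩

/-- The weighted translation `(W V)(γ) = c(γ) V(γ + p)` with weights of modulus one. -/
def weightedShift (c : ℤ × ℤ → ℂ) (hc : ∀ γ, ‖c γ‖ = 1) (p : ℤ × ℤ) : CellL2 →L[ℂ] CellL2 :=
  have hs : ∀ V : CellL2, HasSum (fun γ => ‖c γ * V (γ + p)‖ ^ 2) (‖V‖ ^ 2) := fun V => by
    simpa [hc, Function.comp_def] using (Equiv.addRight p).hasSum_iff.2 (hasSum_norm_sq_cell V)
  LinearMap.mkContinuous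
    { toFun := fun V => ⟨fun γ => c γ * V (γ + p), memℓp_gen (by simpa using (hs V).summable)⟩
      map_add' := fun V W => by ext γ; simp [mul_add]; rfl
      map_smul' := fun a V => by ext γ; simp [mul_left_comm] } 1 fun V => by
    rw [one_mul]
    refine le_of_eq ((sq_eq_sq₀ (norm_nonneg _) (norm_nonneg _)).1 ?_)
    exact (hasSum_norm_sq_cell _).unique (hs V)

theorem weightedShift_apply (c : ℤ × ℤ → ℂ) (hc : ∀ γ, ‖c γ‖ = 1) (p : ℤ × ℤ) (V : CellL2)
    (γ : ℤ × ℤ) : weightedShift c hc p V γ = c γ * V (γ + p) := rfl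

theorem weightedShift_adjoint (c c' : ℤ × ℤ → ℂ) (hc : ∀ γ, ‖c γ‖ = 1) (hc' : ∀ γ, ‖c' γ‖ = 1)
    (p : ℤ × ℤ) (h : ∀ γ, c' (γ + p) = (starRingEnd ℂ) (c γ)) :
    weightedShift c' hc' (-p) = ContinuousLinearMap.adjoint (weightedShift c hc p) := by
  rw [ContinuousLinearMap.eq_adjoint_iff]
  intro V W
  rw [lp.inner_eq_tsum, lp.inner_eq_tsum, ← (Equiv.addRight p).tsum_eq]
  refine tsum_congr fun γ => ?_
  simp only [weightedShift_apply, Equiv.coe_addRight, add_neg_cancel_right, h, RCLike.inner_apply,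
    map_mul, Complex.conj_conj]
  ring

/-- The operator `(T V)(γ) = ∑_j e^{-iβ_{j,γ}} V(γ - shift j)`. -/
def hopping (β : Edge → ℝ) : CellL2 →L[ℂ] CellL2 :=
  ∑ j : Fin 3, weightedShift (fun γ => phase (-β (j, γ))) (fun _ => norm_phase _) (-shift j)

theorem hopping_apply (β : Edge → ℝ) (V : CellL2) (γ : ℤ × ℤ) :
    hopping β V γ = ∑ j : Fin 3, phase (-β (j, γ)) * V (γ - shift j) := by
  rw [hopping, Fin.sum_univ_three, Fin.sum_univ_three]
  simp only [sub_eq_add_neg]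
  rfl

theorem hopping_adjoint_apply (β : Edge → ℝ) (V : CellL2) (γ : ℤ × ℤ) :
    ContinuousLinearMap.adjoint (hopping β) V γ
      = ∑ j : Fin 3, phase (β (j, γ + shift j)) * V (γ + shift j) := by
  have : ContinuousLinearMap.adjoint (hopping β) = ∑ j : Fin 3, weightedShift
      (fun γ => phase (β (j, γ + shift j))) (fun _ => norm_phase _) (shift j) := by
    rw [hopping, map_sum]
    refine Finset.sum_congr rfl fun j _ => ?_
    rw [← weightedShift_adjoint _ (fun γ => phase (β (j, γ + shift j))) _ (fun _ => norm_phase _)]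
    · simp
    · intro γ
      rw [conj_phase]; simp
  rw [this, Fin.sum_univ_three, Fin.sum_univ_three]
  rfl

/-- For `a b < 0` the discrete equation with sources has a unique solution, which is bounded by the
sources. -/
theorem exists_discrete_solution (T : CellL2 →L[ℂ] CellL2) {a b : ℝ} (hab : a * b < 0) :
    (∀ gN gB : CellL2, ∃ VN VB : CellL2, T VB + gN = (a : ℂ) • VN ∧
      ContinuousLinearMap.adjoint T VN + gB = (b : ℂ) • VB) ∧
    ∃ K, 0 ≤ K ∧ ∀ gN gB VN VB : CellL2, T VB + gN = (a : ℂ) • VN →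
      ContinuousLinearMap.adjoint T VN + gB = (b : ℂ) • VB →
      ‖VN‖ ≤ K * (‖gN‖ + ‖gB‖) ∧ ‖VB‖ ≤ K * (‖gN‖ + ‖gB‖) := by
  set T' := ContinuousLinearMap.adjoint T with hT'
  have hb : (b : ℂ) ≠ 0 := by
    rintro h
    rw [Complex.ofReal_eq_zero] at h
    simp [h] at hab
  -- star T' * T' is TT*, whose real spectrum is nonnegative, so the negative number ab lies in the
  -- resolvent set.
  have hu : IsUnit (algebraMap ℝ (CellL2 →L[ℂ] CellL2) (a * b) - star T' * T') := by
    rw [← spectrum.notMem_iff]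
    exact fun h => absurd (spectrum_star_mul_self_nonneg _ h) hab.not_ge
  obtain ⟨S, hS⟩ := hu
  have hSapp : ∀ V, (S : CellL2 →L[ℂ] CellL2) V = ((a * b : ℝ) : ℂ) • V - T (T' V) := by
    intro V
    rw [hS]
    have e : star T' = T := by
      rw [ContinuousLinearMap.star_eq_adjoint, hT', ContinuousLinearMap.adjoint_adjoint]
    rw [e, sub_apply, mul_apply_eq_comp, Algebra.algebraMap_eq_smul_one,
      smul_apply, one_apply_eq_self]
    rfl
  set S' : CellL2 →L[ℂ] CellL2 := ((S⁻¹ : (CellL2 →L[ℂ] CellL2)ˣ) : CellL2 →L[ℂ] CellL2)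
  have h1 : ∀ V, (S : CellL2 →L[ℂ] CellL2) (S' V) = V := fun V => by
    rw [← mul_apply_eq_comp, Units.mul_inv, one_apply_eq_self]
  have h2 : ∀ V, S' ((S : CellL2 →L[ℂ] CellL2) V) = V := fun V => by
    rw [← mul_apply_eq_comp, Units.inv_mul, one_apply_eq_self]
  refine ⟨fun gN gB => ?_, ?_⟩
  -- Substituting b V_B = T*V_N + g_B into b times the first equation leaves (ab - TT*)V_N = T g_B +
  -- b g_N.
  · refine ⟨S' (T gB + (b : ℂ) • gN), (b : ℂ)⁻¹ • (T' (S' (T gB + (b : ℂ) • gN)) + gB), ?_, ?_⟩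
    · set V := S' (T gB + (b : ℂ) • gN) with hV
      have h3 : (S : CellL2 →L[ℂ] CellL2) V = T gB + (b : ℂ) • gN := h1 _
      rw [hSapp] at h3
      have h4 : T (T' V) + T gB + (b : ℂ) • gN = ((a * b : ℝ) : ℂ) • V := by
        rw [add_assoc, ← h3]; abel
      rw [map_smul, map_add]
      have h5 := congrArg (fun W => (b : ℂ)⁻¹ • W) h4
      simp only [smul_add, smul_smul, inv_mul_cancel₀ hb, one_smul] at h5 ⊢
      rw [h5]
      congr 1
      push_cast
      field_simp
    · rw [smul_smul, mul_inv_cancel₀ hb, one_smul]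
  · set K₁ := ‖S'‖ * (‖T‖ + |b|) with hK₁
    have hK₁0 : 0 ≤ K₁ := by positivity
    refine ⟨K₁ + |b|⁻¹ * (‖T'‖ * K₁ + 1), by positivity, fun gN gB VN VB hN hB => ?_⟩
    have h3 : VN = S' (T gB + (b : ℂ) • gN) := by
      rw [← h2 VN, hSapp]
      congr 1
      have h4 := congrArg (fun W => (b : ℂ) • W) hN
      have h5 := congrArg T hB
      simp only [map_add, map_smul, smul_add, smul_smul] at h4 h5
      rw [mul_comm] at h4
      push_cast
      rw [← h4, ← h5]; abel
    have h4 : ‖VN‖ ≤ K₁ * (‖gN‖ + ‖gB‖) := by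
      rw [h3, hK₁, mul_assoc]
      refine (S'.le_opNorm _).trans (mul_le_mul_of_nonneg_left ?_ (norm_nonneg _))
      refine (norm_add_le _ _).trans ?_
      have := T.le_opNorm gB
      rw [norm_smul, Complex.norm_real, Real.norm_eq_abs]
      nlinarith [norm_nonneg gN, norm_nonneg gB, norm_nonneg T, abs_nonneg b,
        mul_nonneg (norm_nonneg T) (norm_nonneg gN), mul_nonneg (abs_nonneg b) (norm_nonneg gB)]
    have hg : 0 ≤ ‖gN‖ + ‖gB‖ := by positivity
    have h5 : ‖VB‖ ≤ |b|⁻¹ * (‖T'‖ * K₁ + 1) * (‖gN‖ + ‖gB‖) := by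
      have e : VB = (b : ℂ)⁻¹ • (T' VN + gB) := by
        rw [hB, smul_smul, inv_mul_cancel₀ hb, one_smul]
      rw [e, norm_smul, norm_inv, Complex.norm_real, Real.norm_eq_abs, mul_assoc]
      refine mul_le_mul_of_nonneg_left ?_ (by positivity)
      refine (norm_add_le _ _).trans ?_
      have := (T'.le_opNorm VN).trans (mul_le_mul_of_nonneg_left h4 (norm_nonneg _))
      nlinarith [norm_nonneg gN]
    have h6 : 0 ≤ |b|⁻¹ * (‖T'‖ * K₁ + 1) * (‖gN‖ + ‖gB‖) := by positivity
    have h7 : 0 ≤ K₁ * (‖gN‖ + ‖gB‖) := by positivity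
    exact ⟨by linarith, by linarith⟩

/-! ### Sums over edges and cells -/

theorem hasSum_cells {h : Edge → ℝ} (hs : Summable h) (p : Fin 3 → ℤ × ℤ) :
    HasSum (fun γ => ∑ j : Fin 3, h (j, γ + p j)) (∑' e, h e) := by
  have hj : ∀ j, Summable fun γ => h (j, γ) := fun j => hs.prod_factor j
  rw [hs.tsum_prod, tsum_fintype]
  refine hasSum_sum fun j _ => ?_
  exact (Equiv.addRight (p j)).hasSum_iff.2 (hj j).hasSum

theorem hasSum_edges {G : ℤ × ℤ → ℝ} {S : ℝ} (h : HasSum G S) (p : Fin 3 → ℤ × ℤ) :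
    HasSum (fun e : Edge => G (e.2 + p e.1)) (3 * S) := by
  obtain ⟨h1, h2⟩ := sum_fin3_tsum h.summable
  have h3 : HasSum (fun e : Edge => G e.2) (3 * S) := by
    rw [← h.tsum_eq, ← h2]; exact h1.hasSum
  let σ : Edge ≃ Edge :=
    { toFun := fun e => (e.1, e.2 + p e.1)
      invFun := fun e => (e.1, e.2 - p e.1)
      left_inv := fun e => by simp
      right_inv := fun e => by simp }
  exact σ.hasSum_iff.2 h3

/-- Sums of three edge quantities of modulus at most `M` times those of an `ℓ²` family. -/
theorem exists_cellL2_sum {κ : Edge → ℝ} {S : ℝ} (hκ : HasSum (fun e => κ e ^ 2) S) {M : ℝ}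
    {ρ : Fin 3 → ℤ × ℤ → ℂ} {p : Fin 3 → ℤ × ℤ} (hρ : ∀ j γ, ‖ρ j γ‖ ≤ M * κ (j, γ + p j)) :
    ∃ W : CellL2, (∀ γ, W γ = ∑ j, ρ j γ) ∧ ‖W‖ ^ 2 ≤ 3 * M ^ 2 * S := by
  have hle : ∀ γ, ‖∑ j, ρ j γ‖ ^ 2 ≤ 3 * M ^ 2 * ∑ j : Fin 3, κ (j, γ + p j) ^ 2 := fun γ => by
    have h1 : ‖∑ j, ρ j γ‖ ≤ ∑ j : Fin 3, M * κ (j, γ + p j) :=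
      (norm_sum_le _ _).trans (Finset.sum_le_sum fun j _ => hρ j γ)
    have h2 := sq_sum_le_card_mul_sum_sq (s := Finset.univ) (f := fun j => M * κ (j, γ + p j))
    have h3 := pow_le_pow_left₀ (norm_nonneg _) h1 2
    simp only [mul_pow, ← Finset.mul_sum, Finset.card_univ, Fintype.card_fin] at h2 h3
    push_cast at h2
    linarith
  have hc := (hasSum_cells hκ.summable p).mul_left (3 * M ^ 2)
  rw [hκ.tsum_eq] at hc
  obtain ⟨W, hW⟩ := exists_cellL2 (Summable.of_nonneg_of_le (fun _ => sq_nonneg _) hle hc.summable)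
  refine ⟨W, hW, ?_⟩
  refine hasSum_le (fun γ => ?_) (hasSum_norm_sq_cell W) hc
  rw [hW]
  exact hle γ

/-! ### Estimates on an edge -/

/-- On a probability space the variance of ‖k‖ is nonnegative. -/
theorem integral_norm_le_sqrt {k : ℝ → ℂ} (hk : MemLp k 2 μ01) :
    ∫ t in (0 : ℝ)..1, ‖k t‖ ≤ √(∫ x, ‖k x‖ ^ 2 ∂μ01) := by
  rw [← integral_μ01]
  refine Real.le_sqrt_of_sq_le ?_
  have i1 : Integrable (fun x => ‖k x‖) μ01 := (hk.integrable one_le_two).norm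
  have i2 := integrable_norm_sq hk
  set m := ∫ x, ‖k x‖ ∂μ01 with hm
  have h : 0 ≤ ∫ x, (‖k x‖ ^ 2 - 2 * m * ‖k x‖ + m ^ 2) ∂μ01 :=
    integral_nonneg fun x => by
      have := sq_nonneg (‖k x‖ - m)
      simp only [Pi.zero_apply]
      linarith
  have i3 : Integrable (fun x => ‖k x‖ ^ 2 - 2 * m * ‖k x‖) μ01 := i2.sub (i1.const_mul _)
  rw [integral_add i3 (integrable_const _),
    integral_sub i2 (i1.const_mul _), integral_const_mul, ← hm] at h
  simp only [integral_const, probReal_univ, one_smul] at h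
  linarith

theorem norm_integral_smul_le {g : ℝ → ℝ} {k : ℝ → ℂ} {M : ℝ}
    (hg : ∀ t ∈ Icc (0 : ℝ) 1, |g t| ≤ M) (hk : MemLp k 2 μ01) :
    ‖∫ t in (0 : ℝ)..1, g t • k t‖ ≤ M * √(∫ x, ‖k x‖ ^ 2 ∂μ01) := by
  have hM : 0 ≤ M := (abs_nonneg _).trans (hg 0 (by simp))
  refine (intervalIntegral.norm_integral_le_of_norm_le (g := fun t => M * ‖k t‖) zero_le_one
    (ae_of_all _ fun t ht => ?_) ((intervalIntegrable_of_memLp hk).norm.const_mul M)).trans ?_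
  · rw [norm_smul, Real.norm_eq_abs]
    exact mul_le_mul_of_nonneg_right (hg t ⟨ht.1.le, ht.2⟩) (norm_nonneg _)
  · rw [intervalIntegral.integral_const_mul]
    exact mul_le_mul_of_nonneg_left (integral_norm_le_sqrt hk) hM

/-- Average ‖u(x)‖ ≤ ‖u(y)‖ + ∫‖v‖, squared, over y. This makes the vertex values of a function in
the domain square summable. -/
theorem IsH2.trace_sq_le {u v w : ℝ → ℂ} (h : IsH2 u v w) {x : ℝ} (hx : x ∈ Icc (0 : ℝ) 1) :
    ‖u x‖ ^ 2 ≤ 2 * ∫ t, (‖u t‖ ^ 2 + ‖v t‖ ^ 2 + ‖w t‖ ^ 2) ∂μ01 := by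
  have hum := memLp_of_continuousOn h.continuousOn 2
  have hvm := memLp_of_continuousOn h.continuousOn_deriv 2
  have iu := integrable_norm_sq hum
  have iv := integrable_norm_sq hvm
  have iw := integrable_norm_sq h.1
  have hvi := h.isPrimitive.1
  set m := ∫ t in (0 : ℝ)..1, ‖v t‖ with hm
  have hm0 : 0 ≤ m := intervalIntegral.integral_nonneg zero_le_one fun _ _ => norm_nonneg _
  have hm2 : m ^ 2 ≤ ∫ t, ‖v t‖ ^ 2 ∂μ01 := by
    have := pow_le_pow_left₀ hm0 (integral_norm_le_sqrt hvm) 2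
    rwa [Real.sq_sqrt (integral_nonneg fun _ => sq_nonneg _)] at this
  have hpt : ∀ y ∈ Icc (0 : ℝ) 1, ‖u x‖ ^ 2 ≤ 2 * ‖u y‖ ^ 2 + 2 * m ^ 2 := fun y hy => by
    have h1 : u x - u y = ∫ t in y..x, v t := by
      rw [h.2.1 x hx, h.2.1 y hy, ← intervalIntegral.integral_interval_sub_left
        (intervalIntegrable_mono01 hvi (x := 0) (by simp) hx)
        (intervalIntegrable_mono01 hvi (by simp) hy)]
      abel
    have h2 : ‖u x - u y‖ ≤ m := by
      rw [h1, hm]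
      refine (intervalIntegral.norm_integral_le_abs_integral_norm).trans ?_
      refine (intervalIntegral.abs_integral_mono_interval ?_ (ae_of_all _ fun _ => norm_nonneg _)
        hvi.norm).trans_eq (abs_of_nonneg hm0)
      rw [uIoc_of_le (zero_le_one' ℝ)]
      rcases le_total y x with hyx | hyx
      · rw [uIoc_of_le hyx]; exact Ioc_subset_Ioc hy.1 hx.2
      · rw [uIoc_of_ge hyx]; exact Ioc_subset_Ioc hx.1 hy.2
    have h3 : ‖u x‖ ≤ ‖u y‖ + m := by
      have := norm_le_norm_add_norm_sub' (u x) (u y)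
      linarith
    have h4 := pow_le_pow_left₀ (norm_nonneg _) h3 2
    nlinarith [sq_nonneg (‖u y‖ - m)]
  have h5 := integral_mono_ae (μ := μ01) (integrable_const (‖u x‖ ^ 2))
    ((iu.const_mul 2).add (integrable_const (2 * m ^ 2))) (ae_μ01_iff.2 (ae_of_all _ hpt))
  rw [integral_add' (iu.const_mul 2) (integrable_const _), integral_const_mul] at h5
  simp only [integral_const, probReal_univ, one_smul] at h5
  have i4 : Integrable (fun t => ‖u t‖ ^ 2 + ‖v t‖ ^ 2) μ01 := iu.add iv
  rw [integral_add i4 iw, integral_add iu iv]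
  have : 0 ≤ ∫ t, ‖w t‖ ^ 2 ∂μ01 := integral_nonneg fun _ => sq_nonneg _
  linarith

theorem IsH2.memLp_source {U : ℝ → ℝ} (hU : MemLp U 2 μ01) (E : ℝ) {u v w : ℝ → ℂ}
    (h : IsH2 u v w) : MemLp (fun t => (U t - E) • u t - w t) 2 μ01 :=
  (memLp_smul_continuousOn (memLp_sub_const hU E) h.continuousOn).sub h.1

theorem sq_add_three_le (a b c : ℝ) : (a + b + c) ^ 2 ≤ 3 * (a ^ 2 + b ^ 2 + c ^ 2) := by
  nlinarith [sq_nonneg (a - b), sq_nonneg (a - c), sq_nonneg (b - c)]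

/-- Outside the Dirichlet spectrum, a function on an edge is bounded in `H²` by its boundary values
and the source. -/
theorem exists_edge_bound {U : ℝ → ℝ} (hU : MemLp U 2 μ01)
    (hUeven : ∀ᵐ x ∂μ01, U x = U (1 - x)) {E : ℝ} (hE : E ∉ dirichletSpectrum U) :
    ∃ C, 0 ≤ C ∧ ∀ u v w : ℝ → ℂ, IsH2 u v w →
      ∫ x, (‖u x‖ ^ 2 + ‖v x‖ ^ 2 + ‖w x‖ ^ 2) ∂μ01 ≤
        C * (‖u 0‖ ^ 2 + ‖u 1‖ ^ 2 + ∫ x, ‖(U x - E) • u x - w x‖ ^ 2 ∂μ01) := by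
  have hs := sine_ne_zero hU hE
  set c := aprioriConst U E with hc
  have hc0 : 0 < c := aprioriConst_pos U E
  set τ := (1 + |(sine U E).2 1| + c) / |(sine U E).1 1| with hτ
  have hτ0 : 0 ≤ τ := by positivity
  set P := ∫ x, (U x - E) ^ 2 ∂μ01 with hP
  have hP0 : 0 ≤ P := integral_nonneg fun _ => sq_nonneg _
  have hPi : Integrable (fun x => (U x - E) ^ 2) μ01 := (memLp_sub_const hU E).integrable_sq
  refine ⟨2 * (c * (τ + 1)) ^ 2 * 3 * (1 + P) + 2, by positivity, fun u v w h => ?_⟩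
  set k : ℝ → ℂ := fun x => (U x - E) • u x - w x with hk
  have hkm : MemLp k 2 μ01 := h.memLp_source hU E
  have ik := integrable_norm_sq hkm
  set κ := √(∫ x, ‖k x‖ ^ 2 ∂μ01) with hκ
  have hκ0 : 0 ≤ κ := Real.sqrt_nonneg _
  have hκ2 : κ ^ 2 = ∫ x, ‖k x‖ ^ 2 ∂μ01 := Real.sq_sqrt (integral_nonneg fun _ => sq_nonneg _)
  set N := ‖u 0‖ + ‖u 1‖ + κ with hN
  -- Green's formula with the reflected s expresses s(1)u'(0) by the end values and the source; s(1)
  -- ≠ 0 is used here.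
  have hv0 : ‖v 0‖ ≤ τ * N := by
    rw [hτ, div_mul_eq_mul_div, le_div_iff₀ (abs_pos.2 hs)]
    have h1 := h.green_left hU hUeven E
    have h2 := norm_integral_smul_le (g := fun t => (sine U E).1 (1 - t)) (M := c)
      (fun t ht => sine_le hU E ⟨by linarith [ht.2], by linarith [ht.1]⟩) hkm
    have h3 : (sine U E).1 1 • v 0 = (∫ t in (0 : ℝ)..1, (sine U E).1 (1 - t) • k t) + u 1
        - (sine U E).2 1 • u 0 := by rw [← h1]; abel
    have h4 := congrArg norm h3
    rw [norm_smul, Real.norm_eq_abs] at h4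
    rw [mul_comm, h4]
    refine (norm_sub_le _ _).trans ((add_le_add_left (norm_add_le _ _) _).trans ?_)
    rw [norm_smul, Real.norm_eq_abs, hN]
    have a1 := mul_nonneg (abs_nonneg ((sine U E).2 1)) (add_nonneg (norm_nonneg (u 1)) hκ0)
    have a2 := mul_nonneg hc0.le (add_nonneg (norm_nonneg (u 0)) (norm_nonneg (u 1)))
    have a3 := norm_nonneg (u 0)
    nlinarith
  have hb : ∀ x ∈ Icc (0 : ℝ) 1, ‖u x‖ ≤ c * (τ + 1) * N ∧ ‖v x‖ ≤ c * (τ + 1) * N := by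
    intro x hx
    have h1 := h.apriori_bound hU E hx
    have h2 : ∫ t in (0 : ℝ)..1, ‖w t - (U t - E) • u t‖ ≤ κ := by
      simp only [norm_sub_rev (w _)]
      exact integral_norm_le_sqrt hkm
    have h3 : ‖u 0‖ + ‖v 0‖ + ∫ t in (0 : ℝ)..1, ‖w t - (U t - E) • u t‖ ≤ (τ + 1) * N := by
      have := norm_nonneg (u 1)
      have e : (τ + 1) * N = τ * N + N := by ring
      rw [e, hN]; linarith
    have h4 := mul_le_mul_of_nonneg_left h3 hc0.le
    rw [← mul_assoc] at h4
    exact ⟨h1.1.trans h4, h1.2.trans h4⟩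
  set L := (c * (τ + 1)) ^ 2 * N ^ 2 with hL
  have hL0 : 0 ≤ L := by positivity
  have hpt : ∀ x ∈ Icc (0 : ℝ) 1, ‖u x‖ ^ 2 + ‖v x‖ ^ 2 + ‖w x‖ ^ 2 ≤
      2 * L + 2 * L * (U x - E) ^ 2 + 2 * ‖k x‖ ^ 2 := by
    intro x hx
    have h1 := pow_le_pow_left₀ (norm_nonneg _) (hb x hx).1 2
    have h2 := pow_le_pow_left₀ (norm_nonneg _) (hb x hx).2 2
    rw [mul_pow, ← hL] at h1 h2
    have h3 : ‖w x‖ ≤ |U x - E| * ‖u x‖ + ‖k x‖ := by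
      have := norm_sub_le ((U x - E) • u x) (k x)
      rwa [norm_smul, Real.norm_eq_abs, hk, sub_sub_cancel] at this
    have h4 := pow_le_pow_left₀ (norm_nonneg _) h3 2
    have h5 := mul_le_mul_of_nonneg_left h1 (sq_nonneg (U x - E))
    have h6 := sq_nonneg (|U x - E| * ‖u x‖ - ‖k x‖)
    have h7 := sq_abs (U x - E)
    have h8 : (|U x - E| * ‖u x‖) ^ 2 = (U x - E) ^ 2 * ‖u x‖ ^ 2 := by rw [mul_pow, h7]
    nlinarith
  have i1 : Integrable (fun x => 2 * L + 2 * L * (U x - E) ^ 2) μ01 :=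
    (integrable_const _).add (hPi.const_mul _)
  have h1 := integral_mono_of_nonneg (ae_of_all _ fun x => by positivity)
    (i1.add (ik.const_mul 2)) (ae_μ01_iff.2 (ae_of_all _ hpt))
  rw [integral_add' i1 (ik.const_mul 2), integral_const_mul,
    integral_add (integrable_const _) (hPi.const_mul _), integral_const_mul (2 * L), ← hP] at h1
  simp only [integral_const, probReal_univ, one_smul] at h1
  have h2 := sq_add_three_le ‖u 0‖ ‖u 1‖ κ
  have h3 : L ≤ (c * (τ + 1)) ^ 2 * (3 * (‖u 0‖ ^ 2 + ‖u 1‖ ^ 2 + κ ^ 2)) :=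
    mul_le_mul_of_nonneg_left h2 (sq_nonneg _)
  have h4 := mul_le_mul_of_nonneg_right h3 (by linarith : 0 ≤ 2 * (1 + P))
  rw [← hκ2] at h1 ⊢
  have h5 := sq_nonneg ‖u 0‖
  have h6 := sq_nonneg ‖u 1‖
  nlinarith

/-- A particular solution with zero initial data, corrected by the homogeneous solution with the
missing end values. -/
theorem exists_boundaryValueProblem {U : ℝ → ℝ} (hU : MemLp U 2 μ01)
    (hUeven : ∀ᵐ x ∂μ01, U x = U (1 - x)) {E : ℝ} (hE : E ∉ dirichletSpectrum U) {k : ℝ → ℂ}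
    (hk : MemLp k 2 μ01) (A Z : ℂ) :
    ∃ u v : ℝ → ℂ, IsH2 u v (fun x => (U x - E) • u x - k x) ∧ u 0 = A ∧ u 1 = Z := by
  obtain ⟨p, p', hp, hp0, -⟩ := exists_initialValueProblem (memLp_sub_const hU E) hk 0 0
  have hq := (isEdgeSolution_edgeSol hU hUeven E A (Z - p 1)).isH2 hU
  refine ⟨fun x => p x + edgeSol U E A (Z - p 1) x, fun x => p' x + edgeSolDeriv U E A (Z - p 1) x,
    ?_, ?_, ?_⟩
  · have := hp.add hq
    convert! this using 2
    rw [smul_add]; abel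
  · simp [hp0, edgeSol_zero hU hE]
  · simp [edgeSol_one hU hE]

/-! ### The resolvent in a gap -/

section Resolvent

variable {U : ℝ → ℝ} {β : Edge → ℝ} {δN δB E : ℝ}

/-- Linearity of the graph; it supplies both the uniqueness and the linearity of the resolvent. -/
theorem SchrodingerGraph.add_smul {f g f' g' : GraphL2} (h : SchrodingerGraph U β δN δB f g)
    (h' : SchrodingerGraph U β δN δB f' g') (c : ℂ) :
    SchrodingerGraph U β δN δB (f + c • f') (g + c • g') := by
  obtain ⟨u, v, w, hu, hs, ⟨V, hi, ht, hN, hB⟩, hf, hg⟩ := h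
  obtain ⟨u', v', w', hu', hs', ⟨V', hi', ht', hN', hB'⟩, hf', hg'⟩ := h'
  have hsq : ∀ a b : ℂ, ‖a + c * b‖ ^ 2 ≤ 2 * ‖a‖ ^ 2 + 2 * ‖c‖ ^ 2 * ‖b‖ ^ 2 := fun a b => by
    have h1 := pow_le_pow_left₀ (norm_nonneg _) (norm_add_le a (c * b)) 2
    rw [norm_mul] at h1
    nlinarith [sq_nonneg (‖a‖ - ‖c‖ * ‖b‖)]
  have hH : ∀ e, IsH2 (fun x => u e x + c * u' e x) (fun x => v e x + c * v' e x)
      (fun x => w e x + c * w' e x) := fun e =>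
    (hu e).add ((hu' e).clm_comp ((ContinuousLinearMap.mul ℂ ℂ c).restrictScalars ℝ))
  have hint : ∀ {u v w : ℝ → ℂ}, IsH2 u v w →
      Integrable (fun x => ‖u x‖ ^ 2 + ‖v x‖ ^ 2 + ‖w x‖ ^ 2) μ01 := fun h =>
    ((integrable_norm_sq (memLp_of_continuousOn h.continuousOn 2)).add
      (integrable_norm_sq (memLp_of_continuousOn h.continuousOn_deriv 2))).add
      (integrable_norm_sq h.1)
  have hval : ∀ (f f' : GraphL2) (u u' : Edge → ℝ → ℂ), (∀ e, (f e : ℝ → ℂ) =ᵐ[μ01] u e) →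
      (∀ e, (f' e : ℝ → ℂ) =ᵐ[μ01] u' e) →
      ∀ e, ((f + c • f') e : ℝ → ℂ) =ᵐ[μ01] fun x => u e x + c * u' e x := by
    intro f f' u u' h h' e
    have h1 : (f + c • f' : GraphL2) e = f e + c • f' e := rfl
    rw [h1]
    filter_upwards [h e, h' e, Lp.coeFn_add (f e) (c • f' e), Lp.coeFn_smul c (f' e)]
      with x h1 h2 h3 h4
    rw [h3, Pi.add_apply, h4, Pi.smul_apply, h1, h2, smul_eq_mul]
  refine ⟨_, _, _, hH, ?_, ⟨fun x => V x + c * V' x, ?_, ?_, ?_, ?_⟩, hval f f' u u' hf hf', ?_⟩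
  · refine Summable.of_nonneg_of_le (fun e => integral_nonneg fun x => by positivity) (fun e => ?_)
      ((hs.mul_left 2).add (hs'.mul_left (2 * ‖c‖ ^ 2)))
    rw [← integral_const_mul, ← integral_const_mul,
      ← integral_add ((hint (hu e)).const_mul _) ((hint (hu' e)).const_mul _)]
    refine integral_mono (hint (hH e))
      (((hint (hu e)).const_mul _).add ((hint (hu' e)).const_mul _)) fun x => ?_
    have h1 := hsq (u e x) (u' e x)
    have h2 := hsq (v e x) (v' e x)
    have h3 := hsq (w e x) (w' e x)
    dsimp only
    linarith
  · intro e
    dsimp only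
    rw [hi, hi']
  · intro e
    dsimp only
    rw [← ht, ← ht']; ring
  · intro γ
    rw [Finset.sum_add_distrib, ← Finset.mul_sum, hN, hN']; ring
  · intro γ
    have e : -∑ j : Fin 3, phase (β (j, γ + shift j)) *
        (v (j, γ + shift j) 1 + c * v' (j, γ + shift j) 1)
        = -∑ j : Fin 3, phase (β (j, γ + shift j)) * v (j, γ + shift j) 1
          + c * -∑ j : Fin 3, phase (β (j, γ + shift j)) * v' (j, γ + shift j) 1 := by
      simp only [Fin.sum_univ_three]; ring
    rw [e, hB, hB']; ring
  · intro e
    filter_upwards [hval g g' _ _ hg hg' e] with x hx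
    rw [hx]
    simp only [Complex.real_smul]
    ring

/-- The vertex conditions of functions with sources as equations in `ℓ²(ℤ²)`. -/
theorem kirchhoff_iff_hopping (hU : MemLp U 2 μ01) (hUeven : ∀ᵐ x ∂μ01, U x = U (1 - x))
    (hE : E ∉ dirichletSpectrum U) {u v w : Edge → ℝ → ℂ} (hu : ∀ e, IsH2 (u e) (v e) (w e))
    {V : Vertex → ℂ} (hi : ∀ e, u e 0 = V (init e))
    (ht : ∀ e, phase (β e) * u e 1 = V (term e)) {VN VB gN gB : CellL2}
    (hVN : ∀ γ, VN γ = V (Atom.N, γ)) (hVB : ∀ γ, VB γ = V (Atom.B, γ))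
    (hgN : ∀ γ, gN γ = ∑ j : Fin 3, ∫ t in (0 : ℝ)..1,
      (sine U E).1 (1 - t) • ((U t - E) • u (j, γ) t - w (j, γ) t))
    (hgB : ∀ γ, gB γ = ∑ j : Fin 3, phase (β (j, γ + shift j)) * ∫ t in (0 : ℝ)..1,
      (sine U E).1 t • ((U t - E) • u (j, γ + shift j) t - w (j, γ + shift j) t)) :
    ((∀ γ : ℤ × ℤ, ∑ j : Fin 3, v (j, γ) 0
        = (robin δN δB (Atom.N, γ) : ℂ) * V (Atom.N, γ)) ∧
      (∀ γ : ℤ × ℤ, -∑ j : Fin 3, phase (β (j, γ + shift j)) * v (j, γ + shift j) 1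
        = (robin δN δB (Atom.B, γ) : ℂ) * V (Atom.B, γ))) ↔
    (hopping β VB + gN = ((3 * discr U δN E : ℝ) : ℂ) • VN ∧
      ContinuousLinearMap.adjoint (hopping β) VN + gB = ((3 * discr U δB E : ℝ) : ℂ) • VB) := by
  rw [kirchhoff_iff (sine_ne_zero hU hE) (η := (sine U E).2 1) hi ht
    (r₀ := fun e => ∫ t in (0 : ℝ)..1, (sine U E).1 (1 - t) • ((U t - E) • u e t - w e t))
    (r₁ := fun e => ∫ t in (0 : ℝ)..1, (sine U E).1 t • ((U t - E) • u e t - w e t))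
    (fun e => by
      rw [← (hu e).green_left hU hUeven E]
      simp only [Complex.real_smul]
      ring)
    (fun e => by
      rw [← (hu e).green_right hU E]
      simp only [Complex.real_smul]
      ring), three_discr, three_discr]
  have hcell : ∀ (F G : CellL2) (a : ℝ) (W : CellL2),
      F + G = (a : ℂ) • W ↔ ∀ γ, F γ + G γ = (a : ℂ) * W γ := fun F G a W =>
    ⟨fun h γ => congrArg (fun X : CellL2 => X γ) h, fun h => lp.ext (funext h)⟩
  rw [hcell, hcell]
  simp only [hopping_apply, hopping_adjoint_apply, hVN, hVB, hgN, hgB]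

theorem exists_sources (hU : MemLp U 2 μ01) (E : ℝ) (β : Edge → ℝ) {k : GraphL2}
    {κ : Edge → ℝ → ℂ} (hκ : ∀ e, MemLp (κ e) 2 μ01) (hk : ∀ e, (k e : ℝ → ℂ) =ᵐ[μ01] κ e) :
    ∃ gN gB : CellL2,
      (∀ γ, gN γ = ∑ j : Fin 3, ∫ t in (0 : ℝ)..1, (sine U E).1 (1 - t) • κ (j, γ) t) ∧
      (∀ γ, gB γ = ∑ j : Fin 3, phase (β (j, γ + shift j)) *
        ∫ t in (0 : ℝ)..1, (sine U E).1 t • κ (j, γ + shift j) t) ∧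
      ‖gN‖ ≤ 2 * aprioriConst U E * ‖k‖ ∧ ‖gB‖ ≤ 2 * aprioriConst U E * ‖k‖ := by
  have hc := aprioriConst_pos U E
  have hsum : HasSum (fun e => √(∫ x, ‖κ e x‖ ^ 2 ∂μ01) ^ 2) (‖k‖ ^ 2) := by
    refine (hasSum_norm_sq hk).congr_fun fun e => ?_
    rw [Real.sq_sqrt (integral_nonneg fun _ => sq_nonneg _)]
  -- √3 ≤ 2, where the 3 comes from Cauchy–Schwarz over the edges at a vertex.
  have hle : ∀ W : CellL2, ‖W‖ ^ 2 ≤ 3 * aprioriConst U E ^ 2 * ‖k‖ ^ 2 →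
      ‖W‖ ≤ 2 * aprioriConst U E * ‖k‖ := fun W h => by
    refine le_of_sq_le_sq (h.trans ?_) (by positivity)
    have : 0 ≤ aprioriConst U E ^ 2 * ‖k‖ ^ 2 := by positivity
    nlinarith
  obtain ⟨gN, hN, hN'⟩ := exists_cellL2_sum hsum (M := aprioriConst U E)
    (ρ := fun j γ => ∫ t in (0 : ℝ)..1, (sine U E).1 (1 - t) • κ (j, γ) t) (p := 0)
    (fun j γ => by
      simpa using norm_integral_smul_le (g := fun t => (sine U E).1 (1 - t))
        (fun t ht => sine_le hU E ⟨by linarith [ht.2], by linarith [ht.1]⟩) (hκ (j, γ)))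
  obtain ⟨gB, hB, hB'⟩ := exists_cellL2_sum hsum (M := aprioriConst U E)
    (ρ := fun j γ => phase (β (j, γ + shift j)) *
        ∫ t in (0 : ℝ)..1, (sine U E).1 t • κ (j, γ + shift j) t) (p := shift)
    (fun j γ => by
      rw [norm_mul, norm_phase, one_mul]
      exact norm_integral_smul_le (fun t ht => sine_le hU E ht) (hκ _))
  exact ⟨gN, gB, hN, hB, hle _ hN', hle _ hB'⟩

/-- The source bounds the vertex values through the discrete system, and vertex values with source
bound the function on each edge; summing the squares over the edges gives the estimate. -/
theorem exists_resolvent_bound (hU : MemLp U 2 μ01) (hUeven : ∀ᵐ x ∂μ01, U x = U (1 - x))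
    (hE : E ∉ dirichletSpectrum U) (hD : discr U δN E * discr U δB E < 0) :
    ∃ C, 0 ≤ C ∧ ∀ f k : GraphL2, SchrodingerGraph U β δN δB f (k + (E : ℂ) • f) →
      ‖f‖ ≤ C * ‖k‖ := by
  obtain ⟨-, K, hK, hbound⟩ := exists_discrete_solution (hopping β)
    (a := 3 * discr U δN E) (b := 3 * discr U δB E) (by nlinarith)
  obtain ⟨C, hC, hedge⟩ := exists_edge_bound hU hUeven hE
  have hc := aprioriConst_pos U E
  set L := K * (4 * aprioriConst U E) with hL
  have hL0 : 0 ≤ L := by positivity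
  -- 6 = 3 + 3: every N and every B value is an end value of three edges.
  refine ⟨√(C * (6 * L ^ 2 + 1)), Real.sqrt_nonneg _, fun f k h => ?_⟩
  obtain ⟨u, v, w, hu, hs, ⟨V, hi, ht, hVK⟩, hf, hk⟩ := h.exists_edges
  simp only [neg_add_eq_sub] at hk
  obtain ⟨gN, gB, hgN, hgB, hgN', hgB'⟩ := exists_sources hU E β
    (fun e => (hu e).memLp_source hU E) hk
  have hs0 : Summable fun γ : ℤ × ℤ =>
      2 * ∫ x, (‖u (0, γ) x‖ ^ 2 + ‖v (0, γ) x‖ ^ 2 + ‖w (0, γ) x‖ ^ 2) ∂μ01 :=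
    (hs.prod_factor (0 : Fin 3)).mul_left 2
  have hinit : ∀ e, ‖V (Atom.N, e.2)‖ = ‖u e 0‖ := fun e => by rw [hi]; rfl
  have hterm : ∀ e, ‖V (Atom.B, e.2 - shift e.1)‖ = ‖u e 1‖ := fun e => by
    have := congrArg norm (ht e)
    rw [norm_mul, norm_phase, one_mul] at this
    exact this.symm
  obtain ⟨VN, hVN⟩ := exists_cellL2 (V := fun γ => V (Atom.N, γ))
    (Summable.of_nonneg_of_le (fun _ => sq_nonneg _) (fun γ => by
      rw [hinit (0, γ)]; exact (hu (0, γ)).trace_sq_le (by simp)) hs0)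
  obtain ⟨VB, hVB⟩ := exists_cellL2 (V := fun γ => V (Atom.B, γ))
    (Summable.of_nonneg_of_le (fun _ => sq_nonneg _) (fun γ => by
      have := hterm (0, γ)
      rw [show ((0 : Fin 3), γ).2 - shift ((0 : Fin 3), γ).1 = γ by
        simp [shift, ← Prod.zero_eq_mk]] at this
      rw [this]; exact (hu (0, γ)).trace_sq_le (by simp)) hs0)
  obtain ⟨h1, h2⟩ := (kirchhoff_iff_hopping hU hUeven hE hu hi ht hVN hVB hgN hgB).1 hVK
  have hb := hbound gN gB VN VB h1 h2
  have hKL : K * (‖gN‖ + ‖gB‖) ≤ L * ‖k‖ := by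
    rw [hL, mul_assoc]
    exact mul_le_mul_of_nonneg_left (by linarith) hK
  have hN2 := pow_le_pow_left₀ (norm_nonneg _) (hb.1.trans hKL) 2
  have hB2 := pow_le_pow_left₀ (norm_nonneg _) (hb.2.trans hKL) 2
  have hsN := hasSum_edges (hasSum_norm_sq_cell VN) 0
  have hsB := hasSum_edges (hasSum_norm_sq_cell VB) (fun j => -shift j)
  have htot := ((hsN.add hsB).add (hasSum_norm_sq hk)).mul_left C
  have hf2 : ‖f‖ ^ 2 ≤ C * (3 * ‖VN‖ ^ 2 + 3 * ‖VB‖ ^ 2 + ‖k‖ ^ 2) := by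
    refine hasSum_le (fun e => ?_) (hasSum_norm_sq hf) htot
    have h3 := hedge _ _ _ (hu e)
    have h4 : ∫ x, ‖u e x‖ ^ 2 ∂μ01 ≤ ∫ x, (‖u e x‖ ^ 2 + ‖v e x‖ ^ 2 + ‖w e x‖ ^ 2) ∂μ01 := by
      refine integral_mono_of_nonneg (ae_of_all _ fun _ => sq_nonneg _)
        (((integrable_norm_sq (memLp_of_continuousOn (hu e).continuousOn 2)).add
        (integrable_norm_sq (memLp_of_continuousOn (hu e).continuousOn_deriv 2))).add
        (integrable_norm_sq (hu e).1)) (ae_of_all _ fun x => ?_)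
      have := sq_nonneg ‖v e x‖
      have := sq_nonneg ‖w e x‖
      dsimp only
      linarith
    simp only [hVN, hVB, Pi.zero_apply, add_zero, ← sub_eq_add_neg, hinit, hterm]
    exact h4.trans h3
  refine le_of_sq_le_sq ?_ (by positivity)
  rw [mul_pow, Real.sq_sqrt (by positivity)]
  refine hf2.trans ?_
  rw [mul_assoc]
  refine mul_le_mul_of_nonneg_left ?_ hC
  rw [mul_pow] at hN2 hB2
  linarith

/-- The sources on the edges determine the inhomogeneous discrete system; its solution prescribes
end values for the edge boundary value problems, and the Kirchhoff conditions then hold by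
`kirchhoff_iff_hopping`. -/
theorem exists_resolvent_solution (hU : MemLp U 2 μ01) (hUeven : ∀ᵐ x ∂μ01, U x = U (1 - x))
    (hE : E ∉ dirichletSpectrum U) (hD : discr U δN E * discr U δB E < 0) (k : GraphL2) :
    ∃ f : GraphL2, SchrodingerGraph U β δN δB f (k + (E : ℂ) • f) := by
  obtain ⟨hsolve, -⟩ := exists_discrete_solution (hopping β)
    (a := 3 * discr U δN E) (b := 3 * discr U δB E) (by nlinarith)
  obtain ⟨C, hC, hedge⟩ := exists_edge_bound hU hUeven hE
  have hκ : ∀ e, MemLp (k e : ℝ → ℂ) 2 μ01 := fun e => Lp.memLp (k e)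
  obtain ⟨gN, gB, hgN, hgB, -, -⟩ := exists_sources hU E β (k := k) hκ fun e => .rfl
  obtain ⟨VN, VB, h1, h2⟩ := hsolve gN gB
  choose u v hu hu0 hu1 using fun e : Edge => exists_boundaryValueProblem hU hUeven hE (hκ e)
    (VN e.2) (phase (-β e) * VB (e.2 - shift e.1))
  have hsrc : ∀ e x, (U x - E) • u e x - ((U x - E) • u e x - k e x) = k e x := fun e x =>
    sub_sub_cancel _ _
  let V : Vertex → ℂ := fun x => match x with
    | (Atom.N, γ) => VN γ
    | (Atom.B, γ) => VB γ
  have hi : ∀ e, u e 0 = V (init e) := hu0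
  have ht : ∀ e, phase (β e) * u e 1 = V (term e) := fun e => by
    rw [hu1, ← mul_assoc, phase_mul_neg, one_mul]; rfl
  have hVK := (kirchhoff_iff_hopping (δN := δN) (δB := δB) hU hUeven hE hu hi ht (VN := VN)
    (VB := VB) (gN := gN) (gB := gB) (fun _ => rfl) (fun _ => rfl) (by simpa only [hsrc] using hgN)
    (by simpa only [hsrc] using hgB)).2 ⟨h1, h2⟩
  have hsN := hasSum_edges (hasSum_norm_sq_cell VN) 0
  have hsB := hasSum_edges (hasSum_norm_sq_cell VB) (fun j => -shift j)
  have htot := ((hsN.add hsB).add (hasSum_norm_sq (f := k) fun e => .rfl)).mul_left C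
  have hs : Summable fun e => ∫ x, (‖u e x‖ ^ 2 + ‖v e x‖ ^ 2
      + ‖(U x - E) • u e x - k e x‖ ^ 2) ∂μ01 := by
    refine Summable.of_nonneg_of_le (fun e => integral_nonneg fun x => by positivity) (fun e => ?_)
      htot.summable
    have h3 := hedge _ _ _ (hu e)
    simp only [hsrc, hu0, hu1, norm_mul, norm_phase, one_mul] at h3
    simpa only [Pi.zero_apply, add_zero, ← sub_eq_add_neg] using h3
  have hm : ∀ e, MemLp (u e) 2 μ01 := fun e => memLp_of_continuousOn (hu e).continuousOn 2
  obtain ⟨f, hf⟩ := exists_graphL2 hm (Summable.of_nonneg_of_le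
    (fun e => integral_nonneg fun _ => sq_nonneg _) (fun e => by
      refine integral_mono_of_nonneg (ae_of_all _ fun _ => sq_nonneg _)
        (((integrable_norm_sq (hm e)).add
        (integrable_norm_sq (memLp_of_continuousOn (hu e).continuousOn_deriv 2))).add
        (integrable_norm_sq (hu e).1)) (ae_of_all _ fun x => ?_)
      have := sq_nonneg ‖v e x‖
      have := sq_nonneg ‖(U x - E) • u e x - k e x‖
      dsimp only
      linarith) hs)
  exact ⟨f, .of_edges hu hs ⟨V, hi, ht, hVK⟩ hf fun e => ae_of_all _ fun x =>
    ((neg_add_eq_sub _ _).trans (hsrc e x)).symm⟩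

theorem notMem_schrodingerSpectrum (hU : MemLp U 2 μ01) (hUeven : ∀ᵐ x ∂μ01, U x = U (1 - x))
    (hE : E ∉ dirichletSpectrum U) (hD : discr U δN E * discr U δB E < 0) :
    (E : ℂ) ∉ schrodingerSpectrum U β δN δB := by
  rw [schrodingerSpectrum, mem_ofPred_eq, not_not]
  obtain ⟨C, hC, hbound⟩ := exists_resolvent_bound (β := β) hU hUeven hE hD
  choose F hF using exists_resolvent_solution (β := β) hU hUeven hE hD
  have huniq : ∀ {f f' k : GraphL2}, SchrodingerGraph U β δN δB f (k + (E : ℂ) • f) →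
      SchrodingerGraph U β δN δB f' (k + (E : ℂ) • f') → f = f' := by
    intro f f' k h h'
    have h1 := h.add_smul h' (-1)
    have e : k + (E : ℂ) • f + (-1 : ℂ) • (k + (E : ℂ) • f')
        = 0 + (E : ℂ) • (f + (-1 : ℂ) • f') := by module
    rw [e] at h1
    have h2 := hbound _ _ h1
    rw [norm_zero, mul_zero] at h2
    have h3 := norm_le_zero_iff.1 h2
    rwa [neg_one_smul, ← sub_eq_add_neg, sub_eq_zero] at h3
  have hlin : ∀ (k k' : GraphL2) (c : ℂ), F (k + c • k') = F k + c • F k' := fun k k' c => by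
    refine huniq (hF _) ?_
    have e : k + c • k' + (E : ℂ) • (F k + c • F k')
        = k + (E : ℂ) • F k + c • (k' + (E : ℂ) • F k') := by module
    rw [e]
    exact (hF k).add_smul (hF k') c
  have hzero : F 0 = 0 := by
    have h := hbound _ _ (hF 0)
    rw [norm_zero, mul_zero] at h
    exact norm_le_zero_iff.1 h
  refine ⟨LinearMap.mkContinuous
    { toFun := F
      map_add' := fun k k' => by simpa using hlin k k' 1
      map_smul' := fun c k => by simpa [hzero] using hlin 0 k c } C
    fun k => hbound _ _ (hF k), fun f k => ⟨fun h => huniq (hF k) h, ?_⟩⟩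
  rintro rfl
  exact hF k

end Resolvent

/-! ### Gaps -/

/-- At a Dirichlet energy both discriminants equal s'(1) ≠ 0, so their product is positive. Hence
the closed gap contains no Dirichlet energy. -/
theorem notMem_dirichletSpectrum_of_discr {U : ℝ → ℝ} (hU : MemLp U 2 μ01) {δN δB E : ℝ}
    (h : discr U δN E * discr U δB E ≤ 0) : E ∉ dirichletSpectrum U := by
  intro hE
  have h0 := (mem_dirichletSpectrum_iff hU).1 hE
  have := sine_deriv_ne_zero hU h0
  simp only [discr, h0, mul_zero, add_zero] at h
  exact absurd h (mul_self_pos.2 this).not_ge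

theorem hasGapAt_of_dispersion {U : ℝ → ℝ} (hU : MemLp U 2 μ01)
    (hUeven : ∀ᵐ x ∂μ01, U x = U (1 - x)) {β : Edge → ℝ} {δN δB φ E₀ : ℝ} {q : ℕ}
    (hq : q = 1 ∨ q = 2) (hδ : δN ≠ δB) (hE₀ : E₀ ∈ centralEnergies U δN δB) {θ₀ : ℝ × ℝ}
    (hneg : ∀ θ E, E ∉ dirichletSpectrum U → discr U δN E * discr U δB E < 0 →
      (θ, E) ∉ dispersion U β δN δB φ q)
    (hzero : ∀ E, E ∉ dirichletSpectrum U → discr U δN E * discr U δB E = 0 →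
      (θ₀, E) ∈ dispersion U β δN δB φ q) :
    HasGapAt (schrodingerSpectrum U β δN δB) (dispersion U β δN δB φ q) θ₀ E₀ := by
  obtain ⟨E₁, E₂, h1, h2, hlt, he1, he2⟩ := exists_gap hU hδ hE₀
  have hd : ∀ {E}, discr U δN E * discr U δB E ≤ 0 → E ∉ dirichletSpectrum U :=
    notMem_dirichletSpectrum_of_discr hU
  have hm1 := hzero E₁ (hd he1.le) he1
  have hm2 := hzero E₂ (hd he2.le) he2
  exact ⟨E₁, E₂, h1, h2, fun E hE =>
    ⟨notMem_schrodingerSpectrum hU hUeven (hd (hlt E hE).le) (hlt E hE),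
      fun θ => hneg θ E (hd (hlt E hE).le) (hlt E hE)⟩,
    mem_schrodingerSpectrum_of_mem_dispersion hU hUeven hq (hd he1.le) hm1,
    mem_schrodingerSpectrum_of_mem_dispersion hU hUeven hq (hd he2.le) hm2, hm1, hm2⟩

/-- For X < 0 every term of X² - 6X + |·|² is nonnegative and the first two are positive; at θ_D the
last term vanishes, so X = 0 is a solution. -/
theorem hasGapAt_two {U : ℝ → ℝ} (hU : MemLp U 2 μ01)
    (hUeven : ∀ᵐ x ∂μ01, U x = U (1 - x)) {β : Edge → ℝ} (hβ : HasConstantFlux β π) {δN δB E₀ : ℝ}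
    (hδ : δN ≠ δB) (hE₀ : E₀ ∈ centralEnergies U δN δB) :
    HasGapAt (schrodingerSpectrum U β δN δB) (dispersion U β δN δB π 2) (π / 3, -π / 6) E₀ := by
  refine hasGapAt_of_dispersion hU hUeven (.inr rfl) hδ hE₀ (fun θ E hE hD => ?_)
    fun E hE hD => ?_
  · rw [mem_dispersion_pi_iff hU hUeven hβ hE]
    have := Complex.normSq_nonneg (1 - phase θ.2 ^ 2 - phase θ.1)
    exact (by nlinarith : (0 : ℝ) < _).ne'
  · rw [mem_dispersion_pi_iff hU hUeven hβ hE, hD]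
    have : (1 : ℂ) - phase (-π / 6) ^ 2 - phase (π / 3) = 0 := by
      rw [sq, ← phase_add, show -π / 6 + -π / 6 = -(π / 3) by ring, phase_eq, phase_eq,
        Real.cos_neg, Real.sin_neg, Real.cos_pi_div_three]
      push_cast
      ring
    simp [this]

theorem hasGapAt_one {U : ℝ → ℝ} (hU : MemLp U 2 μ01)
    (hUeven : ∀ᵐ x ∂μ01, U x = U (1 - x)) {β : Edge → ℝ} (hβ : HasConstantFlux β (2 * π))
    {δN δB E₀ : ℝ} (hδ : δN ≠ δB) (hE₀ : E₀ ∈ centralEnergies U δN δB) :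
    HasGapAt (schrodingerSpectrum U β δN δB) (dispersion U β δN δB (2 * π) 1)
      (2 * π / 3, -2 * π / 3) E₀ := by
  refine hasGapAt_of_dispersion hU hUeven (.inl rfl) hδ hE₀ (fun θ E hE hD => ?_)
    fun E hE hD => ?_
  · rw [mem_dispersion_two_pi_iff hU hUeven hβ hE]
    have := Complex.normSq_nonneg (1 + phase θ.1 + phase θ.2)
    exact (by linarith : _ < _).ne
  · rw [mem_dispersion_two_pi_iff hU hUeven hβ hE, hD]
    have : (1 : ℂ) + phase (2 * π / 3) + phase (-2 * π / 3) = 0 := by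
      rw [show 2 * π / 3 = π - π / 3 by ring, show -2 * π / 3 = -(π - π / 3) by ring, phase_eq,
        phase_eq, Real.cos_neg, Real.sin_neg, Real.cos_pi_sub, Real.cos_pi_div_three]
      push_cast
      ring
    rw [mul_zero, this, map_zero]

end MagneticHex

end

theorem mainTheorem5
    (U : ℝ → ℝ) (hU : MemLp U 2 MagneticHex.μ01)
    (hUeven : ∀ᵐ x ∂MagneticHex.μ01, U x = U (1 - x))
    (δN δB : ℝ)
    (a : MagneticHex.Edge → ℝ → ℝ) (ha : ∀ e, ContDiffOn ℝ 1 (a e) (Icc 0 1)) :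
    (MagneticHex.centralEnergies U δN δB).Infinite ∧
    (MagneticHex.HasConstantFlux (MagneticHex.beta a) π →
      (∀ (θ : ℝ × ℝ) (E : ℝ), E ∉ MagneticHex.dirichletSpectrum U →
        ((θ, E) ∈ MagneticHex.dispersion U (MagneticHex.beta a) δN δB π 2 ↔
          ∃ s ∈ ({1, -1} : Set ℝ), ∃ t ∈ ({1, -1} : Set ℝ),
            MagneticHex.eta U E =
              MagneticHex.etaRoot s t (MagneticHex.alpha U E δN) (MagneticHex.alpha U E δB) θ)) ∧
      (δN = δB → ∀ E₀ ∈ MagneticHex.centralEnergies U δN δB,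
        MagneticHex.IsDiracCone (MagneticHex.dispersion U (MagneticHex.beta a) δN δB π 2)
          2 (π / 3, -π / 6) E₀) ∧
      (δN ≠ δB → ∀ E₀ ∈ MagneticHex.centralEnergies U δN δB,
        MagneticHex.HasGapAt
          (MagneticHex.schrodingerSpectrum U (MagneticHex.beta a) δN δB)
          (MagneticHex.dispersion U (MagneticHex.beta a) δN δB π 2) (π / 3, -π / 6) E₀)) ∧
    (MagneticHex.HasConstantFlux (MagneticHex.beta a) (2 * π) →
      (δN = δB → ∀ E₀ ∈ MagneticHex.centralEnergies U δN δB,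
        MagneticHex.IsDiracCone (MagneticHex.dispersion U (MagneticHex.beta a) δN δB (2 * π) 1)
          1 (2 * π / 3, -2 * π / 3) E₀) ∧
      (δN ≠ δB → ∀ E₀ ∈ MagneticHex.centralEnergies U δN δB,
        MagneticHex.HasGapAt
          (MagneticHex.schrodingerSpectrum U (MagneticHex.beta a) δN δB)
          (MagneticHex.dispersion U (MagneticHex.beta a) δN δB (2 * π) 1)
          (2 * π / 3, -2 * π / 3) E₀)) := by
  refine ⟨MagneticHex.centralEnergies_infinite hU δN δB,
    fun hβ => ⟨fun θ E hE => MagneticHex.dispersion_pi_iff_etaRoot hU hUeven hβ hE θ, ?_,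
      fun hδ E₀ hE₀ => MagneticHex.hasGapAt_two hU hUeven hβ hδ hE₀⟩,
    fun hβ => ⟨?_, fun hδ E₀ hE₀ => MagneticHex.hasGapAt_one hU hUeven hβ hδ hE₀⟩⟩
  · rintro rfl E₀ hE₀
    exact MagneticHex.isDiracCone_two hU hUeven hβ hE₀
  · rintro rfl E₀ hE₀
    exact MagneticHex.isDiracCone_one hU hUeven hβ hE₀
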